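/- **Higher-order a priori energy estimate for the coupled Boussinesq--solid system.** Let $d\ge 1$, $s>\frac d2+1$. Let $\mathfrak b\in C_c^\infty(\mathbb R^d)$ be the profile of the solid, $\mu,\varepsilon,c_{fric},\tilde M,\overline\delta>0$ and $p_{atm}\ge 0$ parameters ($p_{atm}=P_{atm}/(\varrho gH_0)$), and consider for $\mathcal U=(\zeta,\overline V):[0,T]\times\mathbb R^d\to\mathbb R\times\mathbb R^d$ and $X_S:[0,T]\to\mathbb R^d$ the system $$\begin{cases}\partial_t\zeta+\nabla\cdot(h\overline V)=-\nabla\mathfrak b(x-X_S)\cdot\dot X_S,\\ (1-\frac\mu3\Delta)\partial_t\overline V+\nabla\zeta+\varepsilon(\overline V\cdot\nabla)\overline V=-\frac\mu2\nabla\big(\nabla^2\mathfrak b(x-X_S)\dot X_S\cdot\dot X_S-\nabla\mathfrak b(x-X_S)\cdot\ddot X_S\big),\\ \ddot X_S=-\frac{c_{fric}}{\sqrt\mu}\Big(\frac{\tilde c_{solid}}{\varepsilon}+\frac1{\tilde M}\int_{\operatorname{supp}\mathfrak b+X_S}\zeta\,dx\Big)\frac{\dot X_S}{|\dot X_S|+\overline\delta}+\frac{\varepsilon}{\tilde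 M}\int_{\mathbb R^d}\zeta\,\nabla\mathfrak b(x-X_S)\,dx,\end{cases}$$ where $h=1+\varepsilon(\zeta-\mathfrak b(x-X_S))$ and $\tilde c_{solid}=\varepsilon+\frac{|\operatorname{supp}\mathfrak b|}{\tilde M}(p_{atm}+1)-\frac{\varepsilon}{\tilde M}\int\mathfrak b$. The space $\mathcal X^s$ consists of the $\mathcal U=(\zeta,\overline V)$ for which the norm $$\|\mathcal U\|_{\mathcal X^s}=\|\zeta\|_{H^s}+\|\overline V\|_{H^s}+\sqrt\mu\,\|\overline V\|_{H^{s+1}}$$ is finite; we also use the equivalent Hilbert norm $$|\!|\!|\mathcal U|\!|\!|_{\mathcal X^s}^2=\|\zeta\|_{H^s}^2+\|\overline V\|_{H^s}^2+\mu\|\overline V\|_{H^{s+1}}^2,$$ where $\|f\|_{H^s}=\|(1-\Delta)^{s/2}f\|_{L^2}$ for scalar $f$, and the $H^s$ norms of the vectors $\overline V$ and $\mathcal U$ are the square roots of the sums of the squares over the components. For every $\kappa>0$ there is a continuous function $c=c_{d,s,\kappa}$ of four variables, nondecreasing in each of them, such that for every $B\in\mathbb R$ there is $\mu_0>0$ (depending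 on $d,s,\kappa,B$) with the following property. Assume $\|\mathfrak b\|_{H^{s+3}}\le B$, $0<\mu\le\mu_0$, $0<\varepsilon\le\kappa\mu$, $T>0$, and let $\mathcal U\in C([0,T];\mathcal X^s)\cap C^1([0,T];\mathcal X^{s-1})$ and $X_S\in C^1([0,T])$, with $\dot X_S$ differentiable, satisfy the system on $[0,T]$ (the fluid equations in the sense of distributions), with $(X_S(0),\dot X_S(0))=(0,\sqrt\varepsilon\,V_{S_0})$, $V_{S_0}\in\mathbb R^d$. Assume that the water height is bounded below: $h\ge h_{min}$ on $[0,T)\times\mathbb R^d$ for some $h_{min}>0$. Put $$c_s=c\Big(c_{fric},\ \tilde M^{-1},\ \sup_{t\in[0,T]}\|\mathcal U(t)\|_{H^s},\ \|\mathfrak b\|_{H^{s+3}}\Big).$$ Then $$\sup_{t\in[0,T]}e^{-\sqrt\varepsilon c_st}\Big(\tfrac12|\!|\!|\mathcal U(t)|\!|\!|_{\mathcal X^s}^2+\tfrac1{2\varepsilon}|\dot X_S(t)|^2\Big)\le 2|\!|\!|\mathcal U(0)|\!|\!|_{\mathcal X^s}^2+2|V_{S_0}|^2+\sqrt\varepsilon\,T\,c_s\|\mathfrak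 b\|_{H^{s+3}}^2,$$ and, for the norm $\|\cdot\|_{\mathcal X^s}$, $$\sup_{t\in[0,T]}e^{-\sqrt\varepsilon c_st}\Big(\tfrac12\|\mathcal U(t)\|_{\mathcal X^s}^2+\tfrac1{2\varepsilon}|\dot X_S(t)|^2\Big)\le 3\|\mathcal U(0)\|_{\mathcal X^s}^2+3|V_{S_0}|^2+\sqrt\varepsilon\,T\,c_s\|\mathfrak b\|_{H^{s+3}}^2.$$ -/

import Mathlib

open MeasureTheory Set Filter Topology

noncomputable section

namespace BoussinesqSolid

open scoped FourierTransform SchwartzMap LineDeriv Laplacian ContDiff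

/-! ### Sobolev spaces on `ℝ^d` -/

/-- The horizontal space `ℝ^d`. -/
abbrev Space (d : ℕ) : Type := EuclideanSpace ℝ (Fin d)

/-- Real-valued square integrable functions on `ℝ^d`. -/
abbrev L2 (d : ℕ) : Type := Lp ℝ 2 (volume : Measure (Space d))

/-- The Fourier transform (with kernel `exp (-2πi x·ξ)`) of a real-valued `L²` function. -/
def fourierL2 {d : ℕ} (f : L2 d) : Lp ℂ 2 (volume : Measure (Space d)) :=
  𝓕 (Complex.ofRealCLM.compLp f)

/-- The square `‖Λ^s f‖²_{L²}` of the `H^s` norm, `Λ^s = (1 - Δ)^{s/2}`, with values in `[0, ∞]`.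
With the above convention the symbol of `1 - Δ` is `1 + (2π|ξ|)²`. -/
def sobolevSq {d : ℕ} (s : ℝ) (f : L2 d) : ENNReal :=
  ∫⁻ ξ : Space d,
    ENNReal.ofReal ((1 + (2 * Real.pi * ‖ξ‖) ^ 2) ^ s) * ‖fourierL2 f ξ‖ₑ ^ 2

/-- The function `f` belongs to `H^s`. -/
def MemHs {d : ℕ} (s : ℝ) (f : L2 d) : Prop := sobolevSq s f < ⊤

/-- The `H^s` norm of a function (meaningful for `f` in `H^s`). -/
def hsNorm {d : ℕ} (s : ℝ) (f : L2 d) : ℝ := √(sobolevSq s f).toReal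

/-- The `H^s` norm of a vector field. -/
def hsNormVec {d : ℕ} (s : ℝ) (V : Fin d → L2 d) : ℝ := √(∑ i, hsNorm s (V i) ^ 2)

/-- The pairs `U = (ζ, V)` of a surface elevation and a velocity field, of class `L²`. -/
abbrev State (d : ℕ) : Type := L2 d × (Fin d → L2 d)

/-- The `H^s` norm of `U = (ζ, V)`. -/
def hsNormState {d : ℕ} (s : ℝ) (U : State d) : ℝ := √(hsNorm s U.1 ^ 2 + hsNormVec s U.2 ^ 2)

/-- The pair `U = (ζ, V)` belongs to `X^s` (for a shallowness parameter `μ > 0`). -/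
def MemX {d : ℕ} (s : ℝ) (U : State d) : Prop :=
  MemHs s U.1 ∧ ∀ i, MemHs s (U.2 i) ∧ MemHs (s + 1) (U.2 i)

/-- The norm `‖ζ‖_{H^s} + ‖V‖_{H^s} + √μ ‖V‖_{H^{s+1}}` of `X^s`. -/
def xNorm {d : ℕ} (μ s : ℝ) (U : State d) : ℝ :=
  hsNorm s U.1 + hsNormVec s U.2 + √μ * hsNormVec (s + 1) U.2

/-- The equivalent Hilbert norm of `X^s`, whose square is
`‖ζ‖²_{H^s} + ‖V‖²_{H^s} + μ ‖V‖²_{H^{s+1}}`. -/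
def xHilbertNorm {d : ℕ} (μ s : ℝ) (U : State d) : ℝ :=
  √(hsNorm s U.1 ^ 2 + hsNormVec s U.2 ^ 2 + μ * hsNormVec (s + 1) U.2 ^ 2)

/-- `U` is a continuous curve in `X^s` on `[0, T]`. -/
def ContinuousInX {d : ℕ} (μ s T : ℝ) (U : ℝ → State d) : Prop :=
  ∀ t ∈ Icc 0 T, MemX s (U t) ∧
    Tendsto (fun r => xNorm μ s (U r - U t)) (𝓝[Icc 0 T] t) (𝓝 0)

/-- `U'` is the time derivative of `U` on `[0, T]`, the difference quotients converging in
`X^s`. -/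
def HasTimeDerivInX {d : ℕ} (μ s T : ℝ) (U U' : ℝ → State d) : Prop :=
  ∀ t ∈ Icc 0 T,
    Tendsto (fun r => xNorm μ s ((r - t)⁻¹ • (U r - U t) - U' t)) (𝓝[Icc 0 T \ {t}] t) (𝓝 0)

/-- The `j`-th coordinate vector of `ℝ^d`. -/
def coord {d : ℕ} (j : Fin d) : Space d := EuclideanSpace.single j 1

/-- The function `g` is the weak partial derivative `∂_j u` of `u`. -/
def IsWeakPartial {d : ℕ} (j : Fin d) (u g : L2 d) : Prop :=
  ∀ φ : 𝓢(Space d, ℝ), ∫ x, u x * (∂_{coord j} φ) x = -∫ x, g x * φ x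

/-! ### The solid and the parameters -/

/-- The shape of the solid lying on the flat bottom: the graph of a smooth compactly supported
function (in the reference position). -/
structure Solid (d : ℕ) where
  /-- the profile -/
  shape : Space d → ℝ
  smooth : ContDiff ℝ ∞ shape
  compact : HasCompactSupport shape

/-- The profile of the solid as an `L²` function. -/
def Solid.toL2 {d : ℕ} (b : Solid d) : L2 d :=
  (b.smooth.continuous.memLp_of_hasCompactSupport b.compact : MemLp b.shape 2 volume).toLp b.shape

/-- The dimensionless parameters of the coupled system. -/
structure Params where
  /-- the shallowness parameter -/
  μ : ℝ
  /-- the nonlinearity parameter -/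
  ε : ℝ
  /-- the coefficient of friction -/
  cfric : ℝ
  /-- the dimensionless mass of the solid -/
  M : ℝ
  /-- the dimensionless atmospheric pressure `P_atm / (ϱ g H₀)` -/
  patm : ℝ
  /-- the regularization parameter of the friction law -/
  δ : ℝ
  μ_pos : 0 < μ
  ε_pos : 0 < ε
  cfric_pos : 0 < cfric
  M_pos : 0 < M
  patm_nonneg : 0 ≤ patm
  δ_pos : 0 < δ

/-- The constant `ε + |supp b| / M * (P_atm / (ϱ g H₀) + 1) - ε * Vol / M` of the solid, where
the volume of the solid is the integral of its profile. -/
def solidConst {d : ℕ} (p : Params) (b : Solid d) : ℝ :=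
  p.ε + (volume (tsupport b.shape)).toReal / p.M * (p.patm + 1)
    - p.ε * (∫ x, b.shape x) / p.M

/-- The acceleration `F[U](Y, Z)` of a solid with displacement `Y` and velocity `Z`, under
friction and the pressure of a fluid with surface elevation `ζ`. -/
def solidForce {d : ℕ} (p : Params) (b : Solid d) (ζ : L2 d) (Y Z : Space d) : Space d :=
  -((p.cfric / √p.μ *
      (1 / p.ε * solidConst p b
        + 1 / p.M * ∫ x in (fun y => y + Y) '' tsupport b.shape, ζ x)) •
    (1 / (‖Z‖ + p.δ)) • Z)
  + (p.ε / p.M) • ∫ x, ζ x • gradient b.shape (x - Y)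

/-- The water height `1 + ε (ζ(x) - b(x - Y))`. -/
def height {d : ℕ} (p : Params) (b : Solid d) (ζ : L2 d) (Y : Space d) (x : Space d) : ℝ :=
  1 + p.ε * (ζ x - b.shape (x - Y))

/-- The function `∂_t² [b(x - X(t))] = ∇²b(x - Y) Z · Z - ∇b(x - Y) · A` of `x`, for a solid with
displacement `Y`, velocity `Z` and acceleration `A`. -/
def bottomAccel {d : ℕ} (b : Solid d) (Y Z A : Space d) (x : Space d) : ℝ :=
  inner ℝ (fderiv ℝ (gradient b.shape) (x - Y) Z) Z - inner ℝ (gradient b.shape (x - Y)) A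

/-- The mass equation `∂_t ζ + ∇·(h V) = -∇b(x - Y) · Z`, in the sense of distributions. -/
def MassEq {d : ℕ} (p : Params) (b : Solid d) (U U' : State d) (Y Z : Space d) : Prop :=
  ∀ φ : 𝓢(Space d, ℝ),
    (∫ x, U'.1 x * φ x)
      - ∑ j, ∫ x, height p b U.1 Y x * U.2 j x * (∂_{coord j} φ) x
    = -∫ x, inner ℝ (gradient b.shape (x - Y)) Z * φ x

/-- The momentum equation
`(1 - (μ/3) Δ) ∂_t V + ∇ζ + ε (V·∇) V = -(μ/2) ∇(∇²b(x - Y) Z · Z - ∇b(x - Y) · A)`,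
in the sense of distributions; `DV i j` is the weak partial derivative `∂_j V_i`. -/
def MomentumEq {d : ℕ} (p : Params) (b : Solid d) (U U' : State d) (Y Z A : Space d) : Prop :=
  ∃ DV : Fin d → Fin d → L2 d, (∀ i j, IsWeakPartial j (U.2 i) (DV i j)) ∧
    ∀ (i : Fin d) (φ : 𝓢(Space d, ℝ)),
      (∫ x, U'.2 i x * (φ x - p.μ / 3 * (Δ φ) x))
        - (∫ x, U.1 x * (∂_{coord i} φ) x)
        + p.ε * (∫ x, (∑ j, U.2 j x * DV i j x) * φ x)
      = -(p.μ / 2) * ∫ x, fderiv ℝ (bottomAccel b Y Z A) x (coord i) * φ x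

/-- A solution of the coupled Boussinesq-solid system on `[0, T]`, with
`U ∈ C([0,T]; X^s) ∩ C¹([0,T]; X^{s-1})`; here `U'` is the time derivative of `U = (ζ, V)`, and
`X'`, `X''` are the velocity and the acceleration of the displacement `X` of the solid. -/
structure IsSolution {d : ℕ} (p : Params) (b : Solid d) (s T : ℝ) (U U' : ℝ → State d)
    (X X' X'' : ℝ → Space d) : Prop where
  continuous : ContinuousInX p.μ s T U
  hasTimeDeriv : HasTimeDerivInX p.μ (s - 1) T U U'
  continuous_deriv : ContinuousInX p.μ (s - 1) T U'
  hasDeriv_X : ∀ t ∈ Icc 0 T, HasDerivWithinAt X (X' t) (Icc 0 T) t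
  hasDeriv_X' : ∀ t ∈ Icc 0 T, HasDerivWithinAt X' (X'' t) (Icc 0 T) t
  mass : ∀ t ∈ Icc 0 T, MassEq p b (U t) (U' t) (X t) (X' t)
  momentum : ∀ t ∈ Icc 0 T, MomentumEq p b (U t) (U' t) (X t) (X' t) (X'' t)
  newton : ∀ t ∈ Icc 0 T, X'' t = solidForce p b (U t).1 (X t) (X' t)

end BoussinesqSolid

end

open BoussinesqSolid

/-! The proof is an `H^s` energy estimate carried out on the Fourier side.

Acceleration. With Z = X', the time derivative of b(x - X) is -∂_Z b(x - X), so the source of the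
momentum equation is exactly the time derivative of (μ/2)∇∂_Z b. Put W = V + Q with Q = (1 -
(μ/3)Δ)⁻¹(-(μ/2)∇∂_Z b). Then (1 - (μ/3)Δ)∂_t W = -∇ζ - ε(V·∇)V (`IsSolution.momentum_corrected`),
and the acceleration, whose friction part carries the factor 1/(ε√μ), has left the fluid equations.
It survives only in the power Z·X''/ε of the forces on the solid, where friction is dissipative
because a nonnegative water height makes its coefficient nonnegative
(`friction_coefficient_nonneg`).

Rate. The energy is half the sum of ‖ζ‖² in `H^s`, of the quadratic form of 1 - (μ/3)Δ in `H^s` at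
W, and of |Z|²/ε. In its derivative the pairings of ζ with ∇·V and of V with ∇ζ cancel
(`rate_pointwise`). The flux ζV would lose one derivative of ζ; symmetrizing the double Fourier
integral turns the weight into a difference that gains it back (`transport_bound`). The other terms
follow from the algebra property of `H^s`, s > d/2. Derivatives of V cost its `H^{s+1}` norm, which
is affordable since ε ≤ κμ gives ε ≤ √ε·√κ·√μ; the other terms contain |Z| = √ε(|Z|/√ε). The rate is
therefore at most a constant times √ε times the energy (`rate_le_energy`).

Regularity. The solution is differentiable only in `X^{s-1}`, so the energy itself need not be
differentiable. The weight ⟨2πξ⟩^{2s} is replaced by min(⟨2πξ⟩, R)^{2s}: the truncated energy is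
differentiable, and its rate is bounded uniformly in R. For small μ the correction Q changes the
energy by at most a twentieth (`truncEnergy_bounds`). Integrating in time, letting R tend to
infinity and applying Grönwall gives `IsSolution.energy_le`; comparing norms gives the theorem. -/

noncomputable section

namespace BoussinesqSolid

open scoped FourierTransform SchwartzMap LineDeriv Laplacian ContDiff

/-! ### The Fourier transform of real-valued `L²` functions -/

/-! ### Schwartz functions: complexification and Fourier symbols of derivatives. -/

section Schwartz

variable {d : ℕ}

/-- Composition of a Schwartz function with a real continuous linear map. -/
def postcomp {F G : Type*} [NormedAddCommGroup F] [NormedSpace ℝ F] [NormedAddCommGroup G]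
    [NormedSpace ℝ G] (L : F →L[ℝ] G) : 𝓢(Space d, F) →L[ℝ] 𝓢(Space d, G) :=
  SchwartzMap.bilinLeftCLM (((ContinuousLinearMap.lsmul ℝ ℝ).flip).comp L)
    (g := fun _ => (1 : ℝ)) (Function.HasTemperateGrowth.const 1)

@[simp] theorem postcomp_apply {F G : Type*} [NormedAddCommGroup F] [NormedSpace ℝ F]
    [NormedAddCommGroup G] [NormedSpace ℝ G] (L : F →L[ℝ] G) (f : 𝓢(Space d, F)) (x : Space d) :
    postcomp L f x = L (f x) := by
  simp [postcomp, SchwartzMap.bilinLeftCLM_apply]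

/-- The complexification of a real-valued Schwartz function. -/
def toComplex (f : 𝓢(Space d, ℝ)) : 𝓢(Space d, ℂ) := postcomp Complex.ofRealCLM f

@[simp] theorem toComplex_apply (f : 𝓢(Space d, ℝ)) (x : Space d) :
    toComplex f x = (f x : ℂ) := by simp [toComplex]

theorem toComplex_re_add_im (f : 𝓢(Space d, ℂ)) :
    f = toComplex (postcomp Complex.reCLM f)
      + Complex.I • toComplex (postcomp Complex.imCLM f) := by
  ext x
  simp [mul_comm Complex.I, Complex.re_add_im]

theorem toComplex_lineDeriv (f : 𝓢(Space d, ℝ)) (m : Space d) :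
    toComplex (∂_{m} f) = ∂_{m} (toComplex f) := by
  ext x
  rw [toComplex_apply, SchwartzMap.lineDerivOp_apply_eq_fderiv,
    SchwartzMap.lineDerivOp_apply_eq_fderiv]
  have h : (toComplex f : Space d → ℂ) = Complex.ofRealCLM ∘ f := by
    ext y; simp
  rw [h, fderiv_comp _ Complex.ofRealCLM.differentiableAt f.differentiable.differentiableAt]
  simp

theorem orthonormalBasis_coord (j : Fin d) : EuclideanSpace.basisFun (Fin d) ℝ j = coord j := by
  simp [coord]

theorem toComplex_laplacian (f : 𝓢(Space d, ℝ)) : toComplex (Δ f) = Δ (toComplex f) := by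
  rw [SchwartzMap.laplacian_eq_sum (EuclideanSpace.basisFun (Fin d) ℝ),
    SchwartzMap.laplacian_eq_sum (EuclideanSpace.basisFun (Fin d) ℝ)]
  simp only [← toComplex_lineDeriv]
  simp [toComplex]

theorem inner_coord (x : Space d) (j : Fin d) : inner ℝ x (coord j) = x j := by
  simp [coord, EuclideanSpace.inner_single_right]

theorem fourierInv_lineDeriv_apply (f : 𝓢(Space d, ℂ)) (m ξ : Space d) :
    𝓕⁻ (∂_{m} f) ξ = -(2 * Real.pi * Complex.I * (inner ℝ ξ m : ℝ)) * 𝓕⁻ f ξ := by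
  have h : (inner ℝ · m : Space d → ℝ).HasTemperateGrowth := by fun_prop
  rw [SchwartzMap.fourierInv_lineDerivOp_eq]
  simp [SchwartzMap.smulLeftCLM_apply_apply h, mul_assoc]

theorem fourier_lineDeriv_apply (f : 𝓢(Space d, ℂ)) (m ξ : Space d) :
    𝓕 (∂_{m} f) ξ = (2 * Real.pi * Complex.I * (inner ℝ ξ m : ℝ)) * 𝓕 f ξ := by
  have h : (inner ℝ · m : Space d → ℝ).HasTemperateGrowth := by fun_prop
  rw [SchwartzMap.fourier_lineDerivOp_eq]
  simp [SchwartzMap.smulLeftCLM_apply_apply h, mul_assoc]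

theorem fourierInv_laplacian_apply (f : 𝓢(Space d, ℂ)) (ξ : Space d) :
    𝓕⁻ (Δ f) ξ = -((2 * Real.pi * ‖ξ‖) ^ 2 : ℝ) * 𝓕⁻ f ξ := by
  rw [SchwartzMap.laplacian_eq_sum (EuclideanSpace.basisFun (Fin d) ℝ)]
  have : 𝓕⁻ (∑ i, ∂_{EuclideanSpace.basisFun (Fin d) ℝ i}
      (∂_{EuclideanSpace.basisFun (Fin d) ℝ i} f))
      = ∑ i, 𝓕⁻ (∂_{EuclideanSpace.basisFun (Fin d) ℝ i}
      (∂_{EuclideanSpace.basisFun (Fin d) ℝ i} f)) :=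
    map_sum (FourierTransform.fourierInvCLM ℂ 𝓢(Space d, ℂ)) _ _
  rw [this, _root_.sum_apply]
  simp only [fourierInv_lineDeriv_apply, orthonormalBasis_coord, inner_coord]
  rw [mul_pow, EuclideanSpace.real_norm_sq_eq]
  push_cast
  rw [Finset.mul_sum, ← Finset.sum_neg_distrib, Finset.sum_mul]
  refine Finset.sum_congr rfl fun i _ => ?_
  ring_nf
  rw [Complex.I_sq]
  ring

end Schwartz

/-! ### Pairing Fourier transforms with test functions; Hermitian symmetry. -/

section Pairing

variable {d : ℕ}

/-- The `L²` Fourier transform is the distributional one, so testing it on 𝓕⁻φ moves the transform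
from f to φ. -/
theorem integral_mul_eq_integral_fourierL2 (f : L2 d) (φ : 𝓢(Space d, ℂ)) :
    ∫ x, (f x : ℂ) * φ x = ∫ ξ, fourierL2 f ξ * 𝓕⁻ φ ξ := by
  have h := congrArg (fun T => T (𝓕⁻ φ))
    (Lp.fourier_toTemperedDistribution_eq (Complex.ofRealCLM.compLp f))
  simp only [TemperedDistribution.fourier_apply, FourierTransform.fourier_fourierInv_eq] at h
  rw [Lp.toTemperedDistribution_apply, Lp.toTemperedDistribution_apply] at h
  calc _ = ∫ x, φ x • (Complex.ofRealCLM.compLp f) x := by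
        refine integral_congr_ae ?_
        filter_upwards [Complex.ofRealCLM.coeFn_compLp f] with x hx
        rw [hx]; simp [mul_comm]
    _ = _ := h
    _ = _ := by simp [fourierL2, mul_comm]

theorem fourierL2_sub (f g : L2 d) : fourierL2 (f - g) = fourierL2 f - fourierL2 g := by
  have : Complex.ofRealCLM.compLp (f - g)
      = Complex.ofRealCLM.compLp f - Complex.ofRealCLM.compLp g :=
    map_sub (Complex.ofRealCLM.compLpL 2 (volume : Measure (Space d))) f g
  rw [fourierL2, this]
  exact map_sub (Lp.fourierTransformₗᵢ (Space d) ℂ) _ _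

theorem fourierL2_smul (c : ℝ) (f : L2 d) : fourierL2 (c • f) = (c : ℂ) • fourierL2 f := by
  have : Complex.ofRealCLM.compLp (c • f) = (c : ℂ) • Complex.ofRealCLM.compLp f := by
    rw [show Complex.ofRealCLM.compLp (c • f) = c • Complex.ofRealCLM.compLp f from
      map_smul (Complex.ofRealCLM.compLpL 2 (volume : Measure (Space d))) c f]
    exact (Complex.coe_smul c _).symm
  rw [fourierL2, this]
  exact map_smul (Lp.fourierTransformₗᵢ (Space d) ℂ) _ _

/-- A function whose product with every Schwartz function is integrable. -/
def Testable (G : Space d → ℂ) : Prop := ∀ ψ : 𝓢(Space d, ℂ), Integrable (fun ξ => G ξ * ψ ξ)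

theorem Testable.add {G H : Space d → ℂ} (hG : Testable G) (hH : Testable H) :
    Testable (fun ξ => G ξ + H ξ) := fun ψ => by
  simp only [add_mul]
  exact (hG ψ).add (hH ψ)

theorem Testable.sub {G H : Space d → ℂ} (hG : Testable G) (hH : Testable H) :
    Testable (fun ξ => G ξ - H ξ) := fun ψ => by
  simp only [sub_mul]
  exact (hG ψ).sub (hH ψ)

theorem Testable.const_mul {G : Space d → ℂ} (hG : Testable G) (c : ℂ) :
    Testable (fun ξ => c * G ξ) := fun ψ => by
  simpa only [mul_assoc] using (hG ψ).const_mul c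

theorem Testable.sum {ι : Type*} {s : Finset ι} {G : ι → Space d → ℂ}
    (hG : ∀ i ∈ s, Testable (G i)) : Testable (fun ξ => ∑ i ∈ s, G i ξ) := fun ψ => by
  simpa only [Finset.sum_mul] using integrable_finsetSum s fun i hi => hG i hi ψ

theorem Testable.temperate_mul {G : Space d → ℂ} (hG : Testable G) {g : Space d → ℂ}
    (hg : g.HasTemperateGrowth) : Testable (fun ξ => g ξ * G ξ) := fun ψ => by
  have := hG (SchwartzMap.smulLeftCLM ℂ g ψ)
  simp only [SchwartzMap.smulLeftCLM_apply_apply hg, smul_eq_mul] at this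
  refine this.congr (Eventually.of_forall fun ξ => ?_)
  simp only; ring

theorem testable_of_memLp {G : Space d → ℂ} (hG : MemLp G 2) : Testable G := fun ψ =>
  MemLp.integrable_mul hG (ψ.memLp 2)

theorem testable_of_integrable {G : Space d → ℂ} (hG : Integrable G) : Testable G := fun ψ => by
  have := hG.bdd_mul (c := SchwartzMap.seminorm ℝ 0 0 ψ)
    ψ.continuous.aestronglyMeasurable (Eventually.of_forall (ψ.norm_le_seminorm ℝ))
  simpa only [mul_comm] using this

theorem Testable.locallyIntegrable {G : Space d → ℂ} (hG : Testable G) :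
    LocallyIntegrable G := by
  intro x
  let f : ContDiffBump x := ⟨1, 2, one_pos, one_lt_two⟩
  refine ⟨Metric.closedBall x 1, Metric.closedBall_mem_nhds x one_pos, ?_⟩
  refine ((hG (toComplex (f.hasCompactSupport.toSchwartzMap f.contDiff))).integrableOn).congr_fun
    (fun y hy => ?_) measurableSet_closedBall
  simp [f.one_of_mem_closedBall hy]

/-- The equations are tested only with real Schwartz functions. This is enough: splitting the
transform of a bump function into real and imaginary parts writes the bump as a complex combination
of inverse transforms of real functions. Every identity between Fourier transforms below is obtained
this way. -/
theorem Testable.ae_eq_zero {G : Space d → ℂ} (hG : Testable G)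
    (h : ∀ φ : 𝓢(Space d, ℝ), ∫ ξ, G ξ * 𝓕⁻ (toComplex φ) ξ = 0) : ∀ᵐ ξ, G ξ = 0 := by
  refine ae_eq_zero_of_integral_contDiff_smul_eq_zero hG.locallyIntegrable fun g hg hgs => ?_
  set ψ := toComplex (hgs.toSchwartzMap hg) with hψ
  have h1 : ψ = 𝓕⁻ (toComplex (postcomp Complex.reCLM (𝓕 ψ)))
      + Complex.I • 𝓕⁻ (toComplex (postcomp Complex.imCLM (𝓕 ψ))) := by
    rw [← FourierTransform.fourierInv_smul, ← FourierTransform.fourierInv_add,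
      ← toComplex_re_add_im, FourierTransform.fourierInv_fourier_eq]
  calc ∫ x, g x • G x = ∫ x, G x * ψ x := by
        refine integral_congr_ae (Eventually.of_forall fun x => ?_)
        simp [hψ, mul_comm]
    _ = ∫ x, (G x * 𝓕⁻ (toComplex (postcomp Complex.reCLM (𝓕 ψ))) x
        + Complex.I * (G x * 𝓕⁻ (toComplex (postcomp Complex.imCLM (𝓕 ψ))) x)) := by
        refine integral_congr_ae (Eventually.of_forall fun x => ?_)
        simp only
        conv_lhs => rw [h1]
        simp only [_root_.add_apply, _root_.smul_apply, smul_eq_mul]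
        ring
    _ = 0 := by
        rw [integral_add (hG _) ((hG _).const_mul _), integral_const_mul, h, h]
        simp

/-- Both sides have the same pairings with transforms of real test functions, because f is real. The
symmetrization in `transport_bound` rests on this symmetry. -/
theorem fourierL2_neg_ae (f : L2 d) :
    ∀ᵐ ξ, fourierL2 f (-ξ) = (starRingEnd ℂ) (fourierL2 f ξ) := by
  have hm : MemLp (fun ξ => (starRingEnd ℂ) (fourierL2 f (-ξ))) 2 :=
    ((Lp.memLp (fourierL2 f)).comp_measurePreserving (Measure.measurePreserving_neg _)).star
  have hT := (testable_of_memLp (Lp.memLp (fourierL2 f))).sub (testable_of_memLp hm)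
  have h0 := hT.ae_eq_zero fun φ => by
    simp only [sub_mul]
    rw [integral_sub (testable_of_memLp (Lp.memLp (fourierL2 f)) _) (testable_of_memLp hm _),
      sub_eq_zero]
    have hψ : ∀ ξ, 𝓕⁻ (toComplex φ) (-ξ) = (starRingEnd ℂ) (𝓕⁻ (toComplex φ) ξ) := by
      intro ξ
      rw [SchwartzMap.fourierInv_coe, Real.fourierInv_eq', Real.fourierInv_eq', ← integral_conj]
      refine integral_congr_ae (Eventually.of_forall fun x => ?_)
      simp [← Complex.exp_conj, Complex.conj_ofNat]
    have h1 := integral_mul_eq_integral_fourierL2 f (toComplex φ)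
    have h2 : (starRingEnd ℂ) (∫ x, (f x : ℂ) * toComplex φ x)
        = ∫ x, (f x : ℂ) * toComplex φ x := by
      rw [← integral_conj]; simp
    rw [← h1, ← h2, h1, ← integral_conj, ← integral_neg_eq_self]
    refine integral_congr_ae (Eventually.of_forall fun x => ?_)
    simp [hψ]
  filter_upwards [h0] with ξ hξ
  rw [sub_eq_zero] at hξ
  rw [hξ]; simp

end Pairing


/-! ### Fourier inversion, products as convolutions, weak derivatives as multipliers. -/

section Inversion

variable {d : ℕ}

theorem ofReal_integral_mul (f : L2 d) (φ : 𝓢(Space d, ℝ)) :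
    ((∫ x, f x * φ x : ℝ) : ℂ) = ∫ ξ, fourierL2 f ξ * 𝓕⁻ (toComplex φ) ξ := by
  rw [← integral_mul_eq_integral_fourierL2, ← integral_complex_ofReal]
  simp

theorem testable_fourierL2 (f : L2 d) : Testable (fourierL2 f) :=
  testable_of_memLp (Lp.memLp _)

theorem testable_of_bounded {G : Space d → ℂ} (hG : AEStronglyMeasurable G) (c : ℝ)
    (hc : ∀ ξ, ‖G ξ‖ ≤ c) : Testable G := fun ψ =>
  ψ.integrable.bdd_mul hG (Eventually.of_forall hc)

theorem integral_fourierInv_mul {H : Space d → ℂ} (hH : Integrable H) (φ : 𝓢(Space d, ℂ)) :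
    ∫ x, 𝓕⁻ H x * φ x = ∫ ξ, H ξ * 𝓕⁻ φ ξ := by
  have h := VectorFourier.integral_bilin_fourierIntegral_eq_flip
    (ContinuousLinearMap.mul ℂ ℂ) (L := -innerₗ (Space d)) (μ := volume) (ν := volume)
    Real.continuous_fourierChar (continuous_inner (𝕜 := ℝ) (E := Space d)).neg hH φ.integrable
  have e1 : ∀ x, VectorFourier.fourierIntegral Real.fourierChar volume (-innerₗ (Space d)) H x
      = 𝓕⁻ H x := fun x => by
    rw [Real.fourierInv_eq]; simp [VectorFourier.fourierIntegral]
  have e2 : ∀ x, VectorFourier.fourierIntegral Real.fourierChar volume (-innerₗ (Space d)).flip φ x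
      = 𝓕⁻ φ x := fun x => by
    rw [SchwartzMap.fourierInv_coe, Real.fourierInv_eq]
    simp [VectorFourier.fourierIntegral, real_inner_comm]
  simpa only [ContinuousLinearMap.mul_apply', e1, e2] using h

theorem norm_fourierInv_le (H : Space d → ℂ) (x : Space d) : ‖𝓕⁻ H x‖ ≤ ∫ ξ, ‖H ξ‖ := by
  rw [Real.fourierInv_eq]
  refine (norm_integral_le_integral_norm _).trans (le_of_eq ?_)
  simp

theorem continuous_fourierInv {H : Space d → ℂ} (hH : Integrable H) : Continuous (𝓕⁻ H) := by
  have : 𝓕⁻ H = fun x => 𝓕 H (-x) := by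
    ext x; rw [Real.fourierInv_eq_fourier_neg]
  rw [this]
  exact (VectorFourier.fourierIntegral_continuous Real.continuous_fourierChar
    (L := innerₗ (Space d)) (by simpa using continuous_inner) hH).comp continuous_neg

/-- An integrable transform has a bounded continuous inverse transform; both functions have the same
pairings with test functions, so they agree almost everywhere. -/
theorem ae_eq_fourierInv (f : L2 d) (hf : Integrable (fourierL2 f)) :
    ∀ᵐ x, (f x : ℂ) = 𝓕⁻ (fourierL2 f : Space d → ℂ) x := by
  have hfc : MemLp (fun x => (f x : ℂ)) 2 := (Lp.memLp f).ofReal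
  have hb := testable_of_bounded (continuous_fourierInv hf).aestronglyMeasurable _
    (norm_fourierInv_le (fourierL2 f : Space d → ℂ))
  have h := ((testable_of_memLp hfc).sub hb).ae_eq_zero fun φ => by
    simp only [sub_mul]
    rw [integral_sub (testable_of_memLp hfc _) (hb _), integral_mul_eq_integral_fourierL2,
      integral_fourierInv_mul hf, sub_self]
  filter_upwards [h] with x hx using sub_eq_zero.1 hx

/-- The convolution of two complex-valued functions. -/
def conv (F G : Space d → ℂ) (ξ : Space d) : ℂ := ∫ η, F η * G (ξ - η)

theorem integrable_conv {F G : Space d → ℂ} (hF : Integrable F) (hG : Integrable G) :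
    Integrable (conv F G) :=
  hF.integrable_convolution (ContinuousLinearMap.mul ℂ ℂ) hG

theorem fourierInv_conv {F G : Space d → ℂ} (hF : Integrable F) (hG : Integrable G)
    (x : Space d) : 𝓕⁻ (conv F G) x = 𝓕⁻ F x * 𝓕⁻ G x := by
  simp only [Real.fourierInv_eq_fourier_neg]
  exact Real.fourier_mul_convolution_eq hF hG _

/-- Integrability of both transforms, available in `H^s` for s > d/2, makes the pointwise product
the inverse transform of a convolution. All nonlinear terms enter the Fourier side through this
identity. -/
theorem ofReal_integral_mul_mul (f g : L2 d) (hf : Integrable (fourierL2 f))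
    (hg : Integrable (fourierL2 g)) (φ : 𝓢(Space d, ℝ)) :
    ((∫ x, f x * g x * φ x : ℝ) : ℂ)
      = ∫ ξ, conv (fourierL2 f) (fourierL2 g) ξ * 𝓕⁻ (toComplex φ) ξ := by
  rw [← integral_fourierInv_mul (integrable_conv hf hg), ← integral_complex_ofReal]
  refine integral_congr_ae ?_
  filter_upwards [ae_eq_fourierInv f hf, ae_eq_fourierInv g hg] with x h1 h2
  rw [fourierInv_conv hf hg, ← h1, ← h2]
  simp

theorem temperate_coord (j : Fin d) :
    (fun ξ : Space d => ((ξ j : ℝ) : ℂ)).HasTemperateGrowth :=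
  (Complex.ofRealCLM.comp (EuclideanSpace.proj j : Space d →L[ℝ] ℝ)).hasTemperateGrowth

theorem temperate_symbol (j : Fin d) :
    (fun ξ : Space d => 2 * Real.pi * Complex.I * ((ξ j : ℝ) : ℂ)).HasTemperateGrowth :=
  (Function.HasTemperateGrowth.const (2 * Real.pi * Complex.I : ℂ)).mul (temperate_coord j)

theorem IsWeakPartial.fourierL2_ae {j : Fin d} {u g : L2 d} (h : IsWeakPartial j u g) :
    ∀ᵐ ξ, fourierL2 g ξ = 2 * Real.pi * Complex.I * ((ξ j : ℝ) : ℂ) * fourierL2 u ξ := by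
  have hu := (testable_fourierL2 u).temperate_mul (temperate_symbol j)
  have h0 := ((testable_fourierL2 g).sub hu).ae_eq_zero fun φ => by
    simp only [sub_mul]
    rw [integral_sub (testable_fourierL2 g _) (hu _), ← ofReal_integral_mul, sub_eq_zero]
    have := congrArg (fun r : ℝ => -(r : ℂ)) (h φ)
    simp only [ofReal_integral_mul u, Complex.ofReal_neg, neg_neg, toComplex_lineDeriv,
      fourierInv_lineDeriv_apply, inner_coord] at this
    rw [← this, ← integral_neg]
    refine integral_congr_ae (Eventually.of_forall fun ξ => ?_)
    simp only; ring
  filter_upwards [h0] with ξ hξ using sub_eq_zero.1 hξ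

end Inversion

/-! ### The symbol ⟨2πξ⟩. -/

section Weights

variable {d : ℕ}

/-- The symbol `⟨2πξ⟩` of `(1 - Δ)^{1/2}`. -/
def jb (ξ : Space d) : ℝ := √(1 + (2 * Real.pi * ‖ξ‖) ^ 2)

theorem sq_jb (ξ : Space d) : jb ξ ^ 2 = 1 + (2 * Real.pi * ‖ξ‖) ^ 2 :=
  Real.sq_sqrt (by positivity)

theorem one_le_jb (ξ : Space d) : 1 ≤ jb ξ := by
  rw [jb, Real.one_le_sqrt]; nlinarith [sq_nonneg (2 * Real.pi * ‖ξ‖)]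

theorem jb_pos (ξ : Space d) : 0 < jb ξ := one_pos.trans_le (one_le_jb ξ)

@[fun_prop] theorem continuous_jb : Continuous (jb : Space d → ℝ) := by unfold jb; fun_prop

theorem two_pi_norm_le_jb (ξ : Space d) : 2 * Real.pi * ‖ξ‖ ≤ jb ξ :=
  Real.le_sqrt_of_sq_le (by linarith)

@[fun_prop] theorem measurable_jb : Measurable (jb : Space d → ℝ) := continuous_jb.measurable

theorem jb_neg (ξ : Space d) : jb (-ξ) = jb ξ := by simp [jb]

theorem jb_le_add (ξ η : Space d) : jb ξ ≤ jb η + 2 * Real.pi * ‖ξ - η‖ := by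
  have h1 := sq_jb ξ
  have h2 := sq_jb η
  have h3 := two_pi_norm_le_jb η
  have h4 : ‖ξ‖ ≤ ‖η‖ + ‖ξ - η‖ := by
    calc ‖ξ‖ = ‖η + (ξ - η)‖ := by simp
      _ ≤ _ := norm_add_le _ _
  have hp := Real.pi_pos
  have h5 : 2 * Real.pi * ‖ξ‖ ≤ 2 * Real.pi * ‖η‖ + 2 * Real.pi * ‖ξ - η‖ := by
    nlinarith
  have h6 : 0 ≤ 2 * Real.pi * ‖ξ - η‖ := by positivity
  have h7 : 0 ≤ 2 * Real.pi * ‖ξ‖ := by positivity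
  refine le_of_sq_le_sq ?_ (by linarith [jb_pos η])
  nlinarith [mul_le_mul_of_nonneg_right h3 h6, mul_self_le_mul_self h7 h5]

theorem jb_le_add_jb (ξ η : Space d) : jb ξ ≤ jb (ξ - η) + jb η := by
  linarith [jb_le_add ξ η, two_pi_norm_le_jb (ξ - η)]

theorem abs_coord_le (ξ : Space d) (j : Fin d) : |ξ j| ≤ ‖ξ‖ := by
  simpa using PiLp.norm_apply_le ξ j

theorem measurable_jb_rpow (s : ℝ) : Measurable (fun ξ : Space d => jb ξ ^ s) :=
  continuous_jb.measurable.pow_const s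

end Weights

/-! ### Sobolev norms as weighted `L²` norms, and curves in Sobolev spaces. -/

section Sobolev

variable {d : ℕ}

theorem enorm_jb_rpow_sq (s : ℝ) (ξ : Space d) :
    ‖((jb ξ ^ s : ℝ) : ℂ)‖ₑ ^ 2 = ENNReal.ofReal ((1 + (2 * Real.pi * ‖ξ‖) ^ 2) ^ s) := by
  rw [← sq_jb, ← ofReal_norm, Complex.norm_real, Real.norm_of_nonneg
    (Real.rpow_nonneg (jb_pos ξ).le _), ← ENNReal.ofReal_pow (Real.rpow_nonneg (jb_pos ξ).le _)]
  congr 1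
  rw [← Real.rpow_natCast, ← Real.rpow_natCast, ← Real.rpow_mul (jb_pos ξ).le,
    ← Real.rpow_mul (jb_pos ξ).le, mul_comm]

/-- The function `k` times the Fourier transform of `f`. -/
def wfun (k : Space d → ℝ) (f : L2 d) (ξ : Space d) : ℂ := (k ξ : ℂ) * fourierL2 f ξ

theorem eLpNorm_two_sq (F : Space d → ℂ) : eLpNorm F 2 volume ^ 2 = ∫⁻ ξ, ‖F ξ‖ₑ ^ 2 := by
  have := eLpNorm_nnreal_pow_eq_lintegral (f := F) (μ := (volume : Measure (Space d)))
    (p := 2) two_ne_zero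
  simpa using this

theorem sobolevSq_eq (s : ℝ) (f : L2 d) :
    sobolevSq s f = eLpNorm (wfun (fun ξ => jb ξ ^ s) f) 2 volume ^ 2 := by
  rw [eLpNorm_two_sq, sobolevSq]
  refine lintegral_congr fun ξ => ?_
  rw [wfun, enorm_mul, mul_pow _ ‖fourierL2 f ξ‖ₑ, enorm_jb_rpow_sq]

theorem measurable_wfun {k : Space d → ℝ} (hk : Measurable k) (f : L2 d) :
    Measurable (wfun k f) :=
  (Complex.measurable_ofReal.comp hk).mul (Lp.stronglyMeasurable _).measurable

theorem memHs_iff (s : ℝ) (f : L2 d) : MemHs s f ↔ MemLp (wfun (fun ξ => jb ξ ^ s) f) 2 := by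
  rw [MemHs, sobolevSq_eq, MemLp]
  simp [(measurable_wfun (measurable_jb_rpow s) f).aestronglyMeasurable]

theorem hsNorm_eq (s : ℝ) (f : L2 d) :
    hsNorm s f = (eLpNorm (wfun (fun ξ => jb ξ ^ s) f) 2 volume).toReal := by
  rw [hsNorm, sobolevSq_eq, ENNReal.toReal_pow, Real.sqrt_sq ENNReal.toReal_nonneg]

theorem hsNorm_nonneg (s : ℝ) (f : L2 d) : 0 ≤ hsNorm s f := Real.sqrt_nonneg _

theorem wfun_bound {k : Space d → ℝ} {σ C : ℝ} (hC : ∀ ξ, |k ξ| ≤ C * jb ξ ^ σ) (f : L2 d)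
    (ξ : Space d) : ‖wfun k f ξ‖ ≤ C * ‖wfun (fun ξ => jb ξ ^ σ) f ξ‖ := by
  simp only [wfun, norm_mul, Complex.norm_real, Real.norm_eq_abs]
  rw [abs_of_nonneg (Real.rpow_nonneg (jb_pos ξ).le σ), ← mul_assoc]
  exact mul_le_mul_of_nonneg_right (hC ξ) (norm_nonneg _)

theorem MemHs.memLp {k : Space d → ℝ} (hk : Measurable k) {σ C : ℝ}
    (hC : ∀ ξ, |k ξ| ≤ C * jb ξ ^ σ) {f : L2 d} (hf : MemHs σ f) : MemLp (wfun k f) 2 :=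
  ((memHs_iff σ f).1 hf).of_le_mul (measurable_wfun hk f).aestronglyMeasurable
    (Eventually.of_forall (wfun_bound hC f))

/-- The weighted Fourier transform of `f` as an element of `L²`. -/
def wtd (k : Space d → ℝ) (f : L2 d) : Lp ℂ 2 (volume : Measure (Space d)) :=
  open Classical in if h : MemLp (wfun k f) 2 then h.toLp else 0

theorem wtd_of_memLp {k : Space d → ℝ} {f : L2 d} (h : MemLp (wfun k f) 2) :
    wtd k f = h.toLp := by rw [wtd, dif_pos h]

theorem coeFn_wtd {k : Space d → ℝ} {f : L2 d} (h : MemLp (wfun k f) 2) :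
    wtd k f =ᵐ[volume] wfun k f := by
  rw [wtd_of_memLp h]; exact h.coeFn_toLp

theorem norm_wtd_le {k : Space d → ℝ} (hk : Measurable k) {σ C : ℝ}
    (hC : ∀ ξ, |k ξ| ≤ C * jb ξ ^ σ) {f : L2 d} (hf : MemHs σ f) :
    ‖wtd k f‖ ≤ C * hsNorm σ f := by
  have hm := hf.memLp hk hC
  have hm' := (memHs_iff σ f).1 hf
  have : hsNorm σ f = ‖hm'.toLp‖ := by rw [hsNorm_eq, Lp.norm_toLp]
  rw [this]
  refine Lp.norm_le_mul_norm_of_ae_le_mul ?_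
  filter_upwards [coeFn_wtd hm, hm'.coeFn_toLp] with ξ h1 h2
  rw [h1, h2]
  exact wfun_bound hC f ξ

theorem hsNorm_eq_norm_wtd {σ : ℝ} {f : L2 d} (hf : MemHs σ f) :
    hsNorm σ f = ‖wtd (fun ξ => jb ξ ^ σ) f‖ := by
  rw [wtd_of_memLp ((memHs_iff σ f).1 hf), hsNorm_eq, Lp.norm_toLp]

theorem wfun_sub (k : Space d → ℝ) (f g : L2 d) :
    wfun k (f - g) =ᵐ[volume] wfun k f - wfun k g := by
  rw [show wfun k (f - g) = fun ξ => (k ξ : ℂ) * fourierL2 (f - g) ξ from rfl, fourierL2_sub]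
  filter_upwards [Lp.coeFn_sub (fourierL2 f) (fourierL2 g)] with ξ h
  simp only [h, Pi.sub_apply, wfun]; ring

theorem wfun_smul (k : Space d → ℝ) (c : ℝ) (f : L2 d) :
    wfun k (c • f) =ᵐ[volume] c • wfun k f := by
  rw [show wfun k (c • f) = fun ξ => (k ξ : ℂ) * fourierL2 (c • f) ξ from rfl, fourierL2_smul]
  filter_upwards [Lp.coeFn_smul (c : ℂ) (fourierL2 f)] with ξ h
  simp only [h, Pi.smul_apply, wfun, smul_eq_mul, Complex.real_smul]; ring

theorem MemHs.sub {σ : ℝ} {f g : L2 d} (hf : MemHs σ f) (hg : MemHs σ g) : MemHs σ (f - g) := by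
  rw [memHs_iff] at *
  exact (hf.sub hg).ae_eq (wfun_sub _ f g).symm

theorem MemHs.smul {σ : ℝ} (c : ℝ) {f : L2 d} (hf : MemHs σ f) : MemHs σ (c • f) := by
  rw [memHs_iff] at *
  exact (hf.const_smul c).ae_eq (wfun_smul _ c f).symm

theorem wtd_sub {k : Space d → ℝ} {f g : L2 d} (hf : MemLp (wfun k f) 2)
    (hg : MemLp (wfun k g) 2) : wtd k (f - g) = wtd k f - wtd k g := by
  have h : MemLp (wfun k (f - g)) 2 := (hf.sub hg).ae_eq (wfun_sub _ f g).symm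
  rw [wtd_of_memLp h, wtd_of_memLp hf, wtd_of_memLp hg, ← MemLp.toLp_sub]
  exact MemLp.toLp_congr _ _ (wfun_sub _ f g)

theorem wtd_smul {k : Space d → ℝ} (c : ℝ) {f : L2 d} (hf : MemLp (wfun k f) 2) :
    wtd k (c • f) = c • wtd k f := by
  have h : MemLp (wfun k (c • f)) 2 := (hf.const_smul c).ae_eq (wfun_smul _ c f).symm
  rw [wtd_of_memLp h, wtd_of_memLp hf, ← MemLp.toLp_const_smul]
  exact MemLp.toLp_congr _ _ (wfun_smul _ c f)

theorem MemHs.mono {σ τ : ℝ} (h : σ ≤ τ) {f : L2 d} (hf : MemHs τ f) : MemHs σ f := by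
  rw [memHs_iff]
  refine hf.memLp (measurable_jb_rpow σ) (C := 1) fun ξ => ?_
  rw [abs_of_nonneg (Real.rpow_nonneg (jb_pos ξ).le σ), one_mul]
  exact Real.rpow_le_rpow_of_exponent_le (one_le_jb ξ) h

theorem hsNorm_mono {σ τ : ℝ} (h : σ ≤ τ) {f : L2 d} (hf : MemHs τ f) :
    hsNorm σ f ≤ hsNorm τ f := by
  rw [hsNorm_eq_norm_wtd (hf.mono h)]
  simpa using norm_wtd_le (measurable_jb_rpow σ) (C := 1) (σ := τ) (fun ξ => by
    rw [abs_of_nonneg (Real.rpow_nonneg (jb_pos ξ).le σ), one_mul]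
    exact Real.rpow_le_rpow_of_exponent_le (one_le_jb ξ) h) hf

theorem continuousOn_wtd {k : Space d → ℝ} (hk : Measurable k) {σ C : ℝ}
    (hC : ∀ ξ, |k ξ| ≤ C * jb ξ ^ σ) {S : Set ℝ} {f : ℝ → L2 d} (hf : ∀ t ∈ S, MemHs σ (f t))
    (h : ∀ t ∈ S, Tendsto (fun r => hsNorm σ (f r - f t)) (𝓝[S] t) (𝓝 0)) :
    ContinuousOn (fun t => wtd k (f t)) S := by
  intro t ht
  rw [ContinuousWithinAt, tendsto_iff_norm_sub_tendsto_zero]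
  have h' := (h t ht).const_mul C
  rw [mul_zero] at h'
  refine squeeze_zero' (Eventually.of_forall fun _ => norm_nonneg _) ?_ h'
  filter_upwards [self_mem_nhdsWithin] with r hr
  rw [← wtd_sub ((hf r hr).memLp hk hC) ((hf t ht).memLp hk hC)]
  exact norm_wtd_le hk hC ((hf r hr).sub (hf t ht))

/-- A weight of order σ acts linearly and boundedly from `H^σ` to `L²`, so difference quotients
converging in `H^σ` give a derivative in the Hilbert space `L²`, where squared norms can be
differentiated. -/
theorem hasDerivWithinAt_wtd {k : Space d → ℝ} (hk : Measurable k) {σ C : ℝ}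
    (hC : ∀ ξ, |k ξ| ≤ C * jb ξ ^ σ) {S : Set ℝ} {f : ℝ → L2 d} {f' : L2 d} {t : ℝ}
    (hf : ∀ t ∈ S, MemHs σ (f t)) (hf' : MemHs σ f') (ht : t ∈ S)
    (h : Tendsto (fun r => hsNorm σ ((r - t)⁻¹ • (f r - f t) - f')) (𝓝[S \ {t}] t) (𝓝 0)) :
    HasDerivWithinAt (fun r => wtd k (f r)) (wtd k f') S t := by
  rw [hasDerivWithinAt_iff_tendsto_slope, tendsto_iff_norm_sub_tendsto_zero]
  have h' := h.const_mul C
  rw [mul_zero] at h'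
  refine squeeze_zero' (Eventually.of_forall fun _ => norm_nonneg _) ?_ h'
  filter_upwards [self_mem_nhdsWithin] with r hr
  have m1 := (hf r hr.1)
  have m2 := (hf t ht)
  have m3 := (m1.sub m2).smul (r - t)⁻¹
  rw [slope_def_module, ← wtd_sub (m1.memLp hk hC) (m2.memLp hk hC),
    ← wtd_smul _ ((m1.sub m2).memLp hk hC), ← wtd_sub (m3.memLp hk hC) (hf'.memLp hk hC)]
  exact norm_wtd_le hk hC (m3.sub hf')

theorem continuousOn_hsNorm {σ : ℝ} {S : Set ℝ} {f : ℝ → L2 d} (hf : ∀ t ∈ S, MemHs σ (f t))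
    (h : ∀ t ∈ S, Tendsto (fun r => hsNorm σ (f r - f t)) (𝓝[S] t) (𝓝 0)) :
    ContinuousOn (fun t => hsNorm σ (f t)) S := by
  have := (continuousOn_wtd (measurable_jb_rpow σ) (C := 1) (fun ξ => by
    rw [abs_of_nonneg (Real.rpow_nonneg (jb_pos ξ).le σ), one_mul]) hf h).norm
  exact this.congr fun t ht => hsNorm_eq_norm_wtd (hf t ht)

end Sobolev

/-! ### Trilinear convolution bounds and integrability of the transform for s > d/2. -/

section Young

variable {d : ℕ}

/-- The `L²` norm of a function with values in `[0, ∞]`. -/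
def n2 (f : Space d → ENNReal) : ENNReal := (∫⁻ ξ, f ξ ^ (2 : ℝ)) ^ (1 / 2 : ℝ)

theorem lintegral_mul_le_n2 {f g : Space d → ENNReal} (hf : Measurable f) (hg : Measurable g) :
    ∫⁻ ξ, f ξ * g ξ ≤ n2 f * n2 g :=
  ENNReal.lintegral_mul_le_Lp_mul_Lq volume Real.HolderConjugate.two_two
    hf.aemeasurable hg.aemeasurable

theorem n2_comp_sub (g : Space d → ENNReal) (η : Space d) :
    n2 (fun ξ => g (ξ - η)) = n2 g := by
  rw [n2, lintegral_sub_right_eq_self (fun ξ => g ξ ^ (2 : ℝ)) η, n2]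

/-- For fixed η this is Cauchy–Schwarz in ξ, and the norm of g is translation invariant. The two
variants below place the `L¹` norm on g or on f instead; having all three lets the factor carrying
the fewest derivatives be the one measured in `L¹`. -/
theorem lintegral_trilinear_le {f g h : Space d → ENNReal} (hf : Measurable f)
    (hg : Measurable g) (hh : Measurable h) :
    ∫⁻ ξ, ∫⁻ η, f ξ * g (ξ - η) * h η ≤ n2 f * n2 g * ∫⁻ η, h η := by
  rw [lintegral_lintegral_swap (by fun_prop)]
  rw [← lintegral_const_mul _ hh]
  refine lintegral_mono fun η => ?_
  rw [lintegral_mul_const _ (by fun_prop)]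
  gcongr
  refine (lintegral_mul_le_n2 hf (by fun_prop)).trans_eq ?_
  rw [n2_comp_sub]

theorem lintegral_trilinear_le' {f g h : Space d → ENNReal} (hf : Measurable f)
    (hg : Measurable g) (hh : Measurable h) :
    ∫⁻ ξ, ∫⁻ η, f ξ * g (ξ - η) * h η ≤ n2 f * (∫⁻ η, g η) * n2 h := by
  have : ∀ ξ, ∫⁻ η, f ξ * g (ξ - η) * h η = ∫⁻ η, f ξ * h (ξ - η) * g η := fun ξ => by
    rw [← lintegral_sub_left_eq_self _ ξ]
    refine lintegral_congr fun η => ?_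
    rw [sub_sub_cancel]; ring
  simp only [this]
  refine (lintegral_trilinear_le hf hh hg).trans_eq (by ring)

/-- The Cauchy-Schwarz constant of the embedding of `H^s` into the functions with integrable
Fourier transform. -/
def embConst (d : ℕ) (s : ℝ) : ENNReal := n2 (fun ξ : Space d => ENNReal.ofReal (jb ξ ^ (-s)))

theorem embConst_lt_top {s : ℝ} (hs : (d : ℝ) / 2 < s) : embConst d s < ⊤ := by
  have h1 : Integrable (fun ξ : Space d => (1 + ‖ξ‖ ^ 2) ^ (-(2 * s) / 2)) :=
    integrable_rpow_neg_one_add_norm_sq (by simp; linarith)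
  refine ENNReal.rpow_lt_top_of_nonneg (by norm_num) (ne_of_lt ?_)
  refine lt_of_le_of_lt (lintegral_mono fun ξ => ?_) h1.lintegral_lt_top
  rw [ENNReal.ofReal_rpow_of_nonneg (Real.rpow_nonneg (jb_pos ξ).le _) (by norm_num)]
  refine ENNReal.ofReal_le_ofReal ?_
  have h2 : (jb ξ ^ (-s)) ^ (2 : ℝ) = (jb ξ ^ 2) ^ (-(2 * s) / 2) := by
    rw [← Real.rpow_natCast, ← Real.rpow_mul (jb_pos ξ).le, ← Real.rpow_mul (jb_pos ξ).le]
    congr 1; push_cast; ring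
  rw [h2]
  have hd : (0 : ℝ) ≤ d := Nat.cast_nonneg d
  refine Real.rpow_le_rpow_of_nonpos (by positivity) ?_ (by linarith)
  rw [sq_jb, mul_pow]
  -- The factor 2π only improves the decay: ⟨2πξ⟩² ≥ 1 + |ξ|², and the power is negative.
  have : 1 ≤ (2 * Real.pi) ^ 2 := by nlinarith [Real.pi_gt_three]
  nlinarith [sq_nonneg ‖ξ‖]

theorem lintegral_le_embConst {f : Space d → ENNReal} (hf : Measurable f) (s : ℝ) :
    ∫⁻ ξ, f ξ ≤ embConst d s * n2 (fun ξ => ENNReal.ofReal (jb ξ ^ s) * f ξ) := by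
  have hm := measurable_jb_rpow (d := d)
  refine le_trans (le_of_eq ?_) (lintegral_mul_le_n2 (hm (-s)).ennreal_ofReal
    ((hm s).ennreal_ofReal.mul hf))
  refine lintegral_congr fun ξ => ?_
  rw [← mul_assoc, ← ENNReal.ofReal_mul (Real.rpow_nonneg (jb_pos ξ).le _),
    ← Real.rpow_add (jb_pos ξ)]
  simp

/-- The `H^s` norm of a function given by the modulus of its Fourier transform. -/
def nHs (s : ℝ) (f : Space d → ENNReal) : ENNReal :=
  n2 (fun ξ => ENNReal.ofReal (jb ξ ^ s) * f ξ)

theorem MemHs.nHs_eq {s : ℝ} {f : L2 d} (hf : MemHs s f) :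
    nHs s (fun ξ => ‖fourierL2 f ξ‖ₑ) = ENNReal.ofReal (hsNorm s f) := by
  have hm := (memHs_iff s f).1 hf
  rw [hsNorm_eq, ENNReal.ofReal_toReal hm.2.ne, nHs, n2]
  rw [eLpNorm_eq_lintegral_rpow_enorm_toReal two_ne_zero ENNReal.ofNat_ne_top]
  simp only [ENNReal.toReal_ofNat, wfun, enorm_mul]
  congr 1
  refine lintegral_congr fun ξ => ?_
  rw [← ofReal_norm ((jb ξ ^ s : ℝ) : ℂ), Complex.norm_real,
    Real.norm_of_nonneg (Real.rpow_nonneg (jb_pos ξ).le _)]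

end Young

/-! ### The product estimate and the commutator bound for the truncated weight. -/

section Products

variable {d : ℕ}

theorem add_rpow_le_two_rpow {s x y : ℝ} (hs : 0 ≤ s) (hx : 0 ≤ x) (hy : 0 ≤ y) :
    (x + y) ^ s ≤ 2 ^ s * (x ^ s + y ^ s) := by
  have h1 : x + y ≤ 2 * max x y := by linarith [le_max_left x y, le_max_right x y]
  calc (x + y) ^ s ≤ (2 * max x y) ^ s := Real.rpow_le_rpow (by positivity) h1 hs
    _ = 2 ^ s * (max x y) ^ s := Real.mul_rpow (by norm_num) (le_max_of_le_left hx)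
    _ ≤ 2 ^ s * (x ^ s + y ^ s) := by
      gcongr
      rcases max_choice x y with h | h <;> rw [h]
      · linarith [Real.rpow_nonneg hy s]
      · linarith [Real.rpow_nonneg hx s]

theorem jb_rpow_le {s : ℝ} (hs : 0 ≤ s) (ξ η : Space d) :
    jb ξ ^ s ≤ 2 ^ s * (jb (ξ - η) ^ s + jb η ^ s) :=
  (Real.rpow_le_rpow (jb_pos ξ).le (jb_le_add_jb ξ η) hs).trans
    (add_rpow_le_two_rpow hs (jb_pos _).le (jb_pos _).le)

theorem lintegral_trilinear_le'' {f g h : Space d → ENNReal} (hf : Measurable f)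
    (hg : Measurable g) (hh : Measurable h) :
    ∫⁻ ξ, ∫⁻ η, f ξ * g (ξ - η) * h η ≤ (∫⁻ ξ, f ξ) * n2 g * n2 h := by
  have h1 : ∀ ξ, n2 (fun η => g (ξ - η)) = n2 g := fun ξ => by
    rw [n2, lintegral_sub_left_eq_self (fun η => g η ^ (2 : ℝ)) ξ, n2]
  rw [mul_assoc, ← lintegral_mul_const _ hf]
  refine lintegral_mono fun ξ => ?_
  simp only [mul_assoc]
  rw [lintegral_const_mul _ (by fun_prop)]
  gcongr
  exact (lintegral_mul_le_n2 (by fun_prop) hh).trans_eq (by rw [h1])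

theorem measurable_ofReal_jb (s : ℝ) :
    Measurable (fun ξ : Space d => ENNReal.ofReal (jb ξ ^ s)) :=
  (measurable_jb_rpow s).ennreal_ofReal

theorem lintegral_lintegral_add {F G : Space d → Space d → ENNReal}
    (hF : Measurable (Function.uncurry F)) :
    ∫⁻ ξ, ∫⁻ η, (F ξ η + G ξ η) = (∫⁻ ξ, ∫⁻ η, F ξ η) + ∫⁻ ξ, ∫⁻ η, G ξ η := by
  exact (lintegral_congr fun ξ => lintegral_add_left (hF.comp measurable_prodMk_left) _).trans
    (lintegral_add_left hF.lintegral_prod_right' _)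

theorem lintegral_lintegral_const_mul {F : Space d → Space d → ENNReal} {c : ENNReal}
    (hF : Measurable (Function.uncurry F)) :
    ∫⁻ ξ, ∫⁻ η, c * F ξ η = c * ∫⁻ ξ, ∫⁻ η, F ξ η := by
  exact (lintegral_congr fun ξ => lintegral_const_mul _ (hF.comp measurable_prodMk_left)).trans
    (lintegral_const_mul _ hF.lintegral_prod_right')

theorem enorm_conv_le (A B : Space d → ℂ) (ξ : Space d) :
    ‖conv A B ξ‖ₑ ≤ ∫⁻ η, ‖B (ξ - η)‖ₑ * ‖A η‖ₑ := by
  refine (enorm_integral_le_lintegral_enorm _).trans_eq (lintegral_congr fun η => ?_)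
  rw [enorm_mul, mul_comm]

/-- The algebra property of `H^s` in dual form. The weight at ξ is shared between ξ - η and η; the
factor that receives it is measured in `L²`, the other in `L¹` through the embedding constant. -/
theorem lintegral_conv_le {s : ℝ} (hs : 0 ≤ s) {f : Space d → ENNReal} (hf : Measurable f)
    {A B : Space d → ℂ} (hA : Measurable A) (hB : Measurable B) :
    ∫⁻ ξ, f ξ * (ENNReal.ofReal (jb ξ ^ s) * ‖conv A B ξ‖ₑ)
      ≤ ENNReal.ofReal (2 ^ s * 2) * embConst d s * n2 f * nHs s (fun ξ => ‖A ξ‖ₑ)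
        * nHs s (fun ξ => ‖B ξ‖ₑ) := by
  have hw := measurable_ofReal_jb (d := d) s
  have hA' := hA.enorm
  have hB' := hB.enorm
  calc ∫⁻ ξ, f ξ * (ENNReal.ofReal (jb ξ ^ s) * ‖conv A B ξ‖ₑ)
      ≤ ∫⁻ ξ, ∫⁻ η, (ENNReal.ofReal (2 ^ s)
          * (f ξ * (ENNReal.ofReal (jb (ξ - η) ^ s) * ‖B (ξ - η)‖ₑ) * ‖A η‖ₑ)
        + ENNReal.ofReal (2 ^ s)
          * (f ξ * ‖B (ξ - η)‖ₑ * (ENNReal.ofReal (jb η ^ s) * ‖A η‖ₑ))) := by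
        refine lintegral_mono fun ξ => ?_
        calc f ξ * (ENNReal.ofReal (jb ξ ^ s) * ‖conv A B ξ‖ₑ)
            ≤ f ξ * (ENNReal.ofReal (jb ξ ^ s) * ∫⁻ η, ‖B (ξ - η)‖ₑ * ‖A η‖ₑ) := by
              gcongr; exact enorm_conv_le A B ξ
          _ = ∫⁻ η, f ξ * (ENNReal.ofReal (jb ξ ^ s) * (‖B (ξ - η)‖ₑ * ‖A η‖ₑ)) := by
              rw [lintegral_const_mul _ (by fun_prop), lintegral_const_mul _ (by fun_prop)]
          _ ≤ _ := by
              refine lintegral_mono fun η => ?_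
              calc _ ≤ f ξ * ((ENNReal.ofReal (2 ^ s) * (ENNReal.ofReal (jb (ξ - η) ^ s)
                    + ENNReal.ofReal (jb η ^ s))) * (‖B (ξ - η)‖ₑ * ‖A η‖ₑ)) := by
                    gcongr
                    rw [← ENNReal.ofReal_add (Real.rpow_nonneg (jb_pos _).le _)
                      (Real.rpow_nonneg (jb_pos _).le _), ← ENNReal.ofReal_mul (by positivity)]
                    exact ENNReal.ofReal_le_ofReal (jb_rpow_le hs ξ η)
                _ = _ := by ring
    _ = ENNReal.ofReal (2 ^ s) * (∫⁻ ξ, ∫⁻ η,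
          f ξ * (ENNReal.ofReal (jb (ξ - η) ^ s) * ‖B (ξ - η)‖ₑ) * ‖A η‖ₑ)
        + ENNReal.ofReal (2 ^ s) * (∫⁻ ξ, ∫⁻ η,
          f ξ * ‖B (ξ - η)‖ₑ * (ENNReal.ofReal (jb η ^ s) * ‖A η‖ₑ)) := by
        rw [lintegral_lintegral_add (by fun_prop),
          lintegral_lintegral_const_mul (by fun_prop),
          lintegral_lintegral_const_mul (by fun_prop)]
    _ ≤ ENNReal.ofReal (2 ^ s) * (n2 f * nHs s (fun ξ => ‖B ξ‖ₑ)
          * (embConst d s * nHs s (fun ξ => ‖A ξ‖ₑ)))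
        + ENNReal.ofReal (2 ^ s) * (n2 f * (embConst d s * nHs s (fun ξ => ‖B ξ‖ₑ))
          * nHs s (fun ξ => ‖A ξ‖ₑ)) := by
        gcongr
        · refine (lintegral_trilinear_le hf (hw.mul hB') hA').trans ?_
          gcongr
          · rfl
          · exact lintegral_le_embConst hA' s
        · refine (lintegral_trilinear_le' hf hB' (hw.mul hA')).trans ?_
          gcongr
          · exact lintegral_le_embConst hB' s
          · rfl
    _ = _ := by
        rw [ENNReal.ofReal_mul (by positivity)]
        simp only [ENNReal.ofReal_ofNat]
        ring

/-- The truncation at height `R` of the weight `⟨2πξ⟩^{2s}` of the energy. -/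
def trunc (s R : ℝ) (ξ : Space d) : ℝ := min (jb ξ) R ^ (2 * s)

theorem trunc_nonneg {s R : ℝ} (hR : 1 ≤ R) (ξ : Space d) : 0 ≤ trunc s R ξ :=
  Real.rpow_nonneg (le_min (jb_pos ξ).le (by linarith)) _

theorem trunc_le_rpow {s R : ℝ} (hs : 0 ≤ s) (hR : 1 ≤ R) (ξ : Space d) :
    trunc s R ξ ≤ jb ξ ^ (2 * s) :=
  Real.rpow_le_rpow (le_min (jb_pos ξ).le (by linarith)) (min_le_left _ _) (by linarith)

theorem trunc_le_const {s R : ℝ} (hs : 0 ≤ s) (hR : 1 ≤ R) (ξ : Space d) :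
    trunc s R ξ ≤ R ^ (2 * s) :=
  Real.rpow_le_rpow (le_min (jb_pos ξ).le (by linarith)) (min_le_right _ _) (by linarith)

theorem continuous_trunc {s R : ℝ} (hs : 0 ≤ s) : Continuous (trunc (d := d) s R) :=
  (continuous_jb.min continuous_const).rpow_const fun _ => Or.inr (by linarith)

/-- Bernoulli's inequality for (y/x)^p, followed by y ≤ x. The spare factor y will absorb the
coordinate in the commutator. -/
theorem rpow_sub_rpow_mul_le {p x y : ℝ} (hp : 1 ≤ p) (hy : 0 < y) (hxy : y ≤ x) :
    (x ^ p - y ^ p) * y ≤ p * x ^ p * (x - y) := by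
  have hx : 0 < x := hy.trans_le hxy
  have h := one_add_mul_self_le_rpow_one_add (s := y / x - 1)
    (by linarith [div_pos hy hx]) hp
  rw [add_sub_cancel, Real.div_rpow hy.le hx.le] at h
  have hxp := Real.rpow_pos_of_pos hx p
  have h1 : x ^ p - y ^ p ≤ p * x ^ p * (1 - y / x) := by
    have := mul_le_mul_of_nonneg_left h hxp.le
    rw [mul_div_cancel₀ _ hxp.ne'] at this
    linarith
  have h2 : 0 ≤ 1 - y / x := by rw [sub_nonneg, div_le_one hx]; exact hxy
  calc (x ^ p - y ^ p) * y ≤ p * x ^ p * (1 - y / x) * y := by gcongr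
    _ ≤ p * x ^ p * (1 - y / x) * x := by
      have : 0 ≤ p * x ^ p * (1 - y / x) := by positivity
      gcongr
    _ = _ := by field_simp

/-- A mean value estimate for the symbol m(ξ)ξ_j with m the truncated weight: the difference costs
⟨ξ - η⟩ m(ξ) rather than a full derivative. The constant must not depend on R, since R will tend to
infinity. -/
theorem abs_trunc_mul_sub_le_of_le {s R : ℝ} (hs : 1 ≤ s) (hR : 1 ≤ R) (ξ η : Space d)
    (j : Fin d) (h : jb η ≤ jb ξ) :
    |trunc s R ξ * ξ j - trunc s R η * η j|
      ≤ (1 + 2 * s) * 2 ^ s * (jb (ξ - η) * (jb ξ ^ s * (jb (ξ - η) ^ s + jb η ^ s))) := by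
  set a := ξ - η with ha
  have ha1 : |ξ j - η j| ≤ jb a := by
    have := abs_coord_le a j
    have h2 := two_pi_norm_le_jb a
    have : |a j| ≤ 2 * Real.pi * ‖a‖ := by nlinarith [Real.pi_gt_three, norm_nonneg a]
    simpa [ha] using this.trans h2
  have hη : |η j| ≤ jb η := by
    have := abs_coord_le η j
    have h2 := two_pi_norm_le_jb η
    nlinarith [Real.pi_gt_three, norm_nonneg η]
  have hjb : jb ξ - jb η ≤ jb a := by linarith [jb_le_add_jb ξ η]
  have hm := trunc_nonneg (s := s) hR ξ
  have hm' := trunc_nonneg (s := s) hR η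
  have hmm : trunc s R η ≤ trunc s R ξ :=
    Real.rpow_le_rpow (le_min (jb_pos η).le (by linarith)) (min_le_min_right _ h) (by linarith)
  have key : (trunc s R ξ - trunc s R η) * |η j| ≤ 2 * s * trunc s R ξ * jb a := by
    -- If both frequencies lie above the truncation the weights coincide. Otherwise η is not
    -- truncated, and the power inequality applies with x = min(⟨ξ⟩, R) and y = ⟨η⟩.
    rcases le_total R (jb η) with h1 | h1
    · have e1 : trunc s R ξ = trunc s R η := by
        rw [trunc, trunc, min_eq_right h1, min_eq_right (h1.trans h)]
      rw [e1, sub_self, zero_mul]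
      have := (jb_pos a).le
      positivity
    · have e1 : trunc s R η = jb η ^ (2 * s) := by rw [trunc, min_eq_left h1]
      have h2 := rpow_sub_rpow_mul_le (p := 2 * s) (by linarith) (jb_pos η) (le_min h h1)
      rw [e1] at hmm ⊢
      calc (trunc s R ξ - jb η ^ (2 * s)) * |η j| ≤ (trunc s R ξ - jb η ^ (2 * s)) * jb η :=
            mul_le_mul_of_nonneg_left hη (by linarith)
        _ ≤ 2 * s * trunc s R ξ * (min (jb ξ) R - jb η) := h2
        _ ≤ _ := by
            refine mul_le_mul_of_nonneg_left ?_ (by positivity)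
            linarith [min_le_left (jb ξ) R]
  have hρ : trunc s R ξ ≤ 2 ^ s * (jb ξ ^ s * (jb a ^ s + jb η ^ s)) := by
    calc trunc s R ξ ≤ jb ξ ^ (2 * s) := trunc_le_rpow (by linarith) hR ξ
      _ = jb ξ ^ s * jb ξ ^ s := by rw [two_mul, Real.rpow_add (jb_pos ξ)]
      _ ≤ jb ξ ^ s * (2 ^ s * (jb a ^ s + jb η ^ s)) :=
        mul_le_mul_of_nonneg_left (jb_rpow_le (by linarith) ξ η)
          (Real.rpow_nonneg (jb_pos ξ).le _)
      _ = _ := by ring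
  have hja := jb_pos a
  calc |trunc s R ξ * ξ j - trunc s R η * η j|
      = |trunc s R ξ * (ξ j - η j) + (trunc s R ξ - trunc s R η) * η j| := by congr 1; ring
    _ ≤ trunc s R ξ * |ξ j - η j| + (trunc s R ξ - trunc s R η) * |η j| := by
        refine (abs_add_le _ _).trans_eq ?_
        rw [abs_mul, abs_mul, abs_of_nonneg hm, abs_of_nonneg (sub_nonneg.2 hmm)]
    _ ≤ trunc s R ξ * jb a + 2 * s * trunc s R ξ * jb a := by gcongr
    _ = (1 + 2 * s) * jb a * trunc s R ξ := by ring
    _ ≤ (1 + 2 * s) * jb a * (2 ^ s * (jb ξ ^ s * (jb a ^ s + jb η ^ s))) := by gcongr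
    _ = _ := by ring

/-- The left side is symmetric in ξ and η, so the previous bound may be applied with the larger
frequency first. In each of the three resulting terms at most s derivatives fall on each copy of ζ
and at most s + 1 on the velocity. -/
theorem abs_trunc_mul_sub_le {s R : ℝ} (hs : 1 ≤ s) (hR : 1 ≤ R) (ξ η : Space d) (j : Fin d) :
    |trunc s R ξ * ξ j - trunc s R η * η j|
      ≤ (1 + 2 * s) * 2 ^ s * (jb ξ ^ s * jb (ξ - η) * jb η ^ s
        + jb ξ ^ s * jb (ξ - η) ^ (s + 1) + jb (ξ - η) ^ (s + 1) * jb η ^ s) := by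
  have p1 := Real.rpow_pos_of_pos (jb_pos ξ) s
  have p2 := Real.rpow_pos_of_pos (jb_pos η) s
  have p3 := Real.rpow_pos_of_pos (jb_pos (ξ - η)) s
  have p4 := jb_pos (ξ - η)
  rw [Real.rpow_add_one p4.ne']
  rcases le_total (jb η) (jb ξ) with h | h
  · refine (abs_trunc_mul_sub_le_of_le hs hR ξ η j h).trans ?_
    gcongr
    nlinarith [mul_pos (mul_pos p3 p4) p2]
  · rw [abs_sub_comm]
    refine (abs_trunc_mul_sub_le_of_le hs hR η ξ j h).trans ?_
    rw [← neg_sub ξ η, jb_neg]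
    gcongr
    nlinarith [mul_pos (mul_pos p3 p4) p1]

end Products

/-! ### The transport estimate. -/

section Transport

variable {d : ℕ}

theorem n2_mono {f g : Space d → ENNReal} (h : ∀ ξ, f ξ ≤ g ξ) : n2 f ≤ n2 g := by
  unfold n2
  gcongr with ξ
  exact h ξ

theorem nHs_mono {s t : ℝ} (h : s ≤ t) (f : Space d → ENNReal) : nHs s f ≤ nHs t f :=
  n2_mono fun ξ => by
    gcongr
    exact one_le_jb ξ

theorem nHs_zero (f : Space d → ENNReal) : nHs 0 f = n2 f := by simp [nHs]

theorem nHs_jb_mul (s : ℝ) (f : Space d → ENNReal) :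
    nHs s (fun ξ => ENNReal.ofReal (jb ξ) * f ξ) = nHs (s + 1) f := by
  unfold nHs
  congr 1
  ext ξ
  rw [← mul_assoc, ← ENNReal.ofReal_mul (Real.rpow_nonneg (jb_pos ξ).le _),
    Real.rpow_add_one (jb_pos ξ).ne']

theorem abs_coord_le_jb (ξ : Space d) (j : Fin d) : 2 * Real.pi * |ξ j| ≤ jb ξ := by
  have := two_pi_norm_le_jb ξ
  have := abs_coord_le ξ j
  nlinarith [Real.pi_pos]

theorem lintegral_commutator_le {s : ℝ} {z v : Space d → ENNReal} (hz : Measurable z)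
    (hv : Measurable v) :
    ∫⁻ ξ, ∫⁻ η, ENNReal.ofReal (jb ξ ^ s * jb (ξ - η) * jb η ^ s
        + jb ξ ^ s * jb (ξ - η) ^ (s + 1) + jb (ξ - η) ^ (s + 1) * jb η ^ s)
        * (z ξ * v (ξ - η) * z η)
      ≤ 3 * embConst d s * nHs s z ^ 2 * nHs (s + 1) v := by
  let F : Space d → ENNReal := fun ξ => ENNReal.ofReal (jb ξ ^ s) * z ξ
  let G : Space d → ENNReal := fun ξ => ENNReal.ofReal (jb ξ) * v ξ
  let H : Space d → ENNReal := fun ξ => ENNReal.ofReal (jb ξ ^ (s + 1)) * v ξ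
  have hF : Measurable F := by fun_prop
  have hG : Measurable G := by fun_prop
  have hH : Measurable H := by fun_prop
  have p (a : ℝ) (ξ : Space d) : 0 ≤ jb ξ ^ a := Real.rpow_nonneg (jb_pos ξ).le _
  have q (ξ : Space d) : 0 ≤ jb ξ := (jb_pos ξ).le
  calc _ = ∫⁻ ξ, ∫⁻ η, (F ξ * G (ξ - η) * F η
          + (F ξ * H (ξ - η) * z η + z ξ * H (ξ - η) * F η)) := by
        refine lintegral_congr fun ξ => lintegral_congr fun η => ?_
        have p1 := p s ξ
        have p2 := p s η
        have p3 := p (s + 1) (ξ - η)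
        have p4 := q (ξ - η)
        rw [ENNReal.ofReal_add (by positivity) (by positivity),
          ENNReal.ofReal_add (by positivity) (by positivity), ENNReal.ofReal_mul (by positivity),
          ENNReal.ofReal_mul p1, ENNReal.ofReal_mul p1, ENNReal.ofReal_mul p3]
        simp only [F, G, H]
        ring
    _ = (∫⁻ ξ, ∫⁻ η, F ξ * G (ξ - η) * F η) + ((∫⁻ ξ, ∫⁻ η, F ξ * H (ξ - η) * z η)
          + ∫⁻ ξ, ∫⁻ η, z ξ * H (ξ - η) * F η) := by
        rw [lintegral_lintegral_add (by fun_prop), lintegral_lintegral_add (by fun_prop)]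
    _ ≤ nHs s z * (embConst d s * nHs (s + 1) v) * nHs s z
        + (nHs s z * nHs (s + 1) v * (embConst d s * nHs s z)
          + embConst d s * nHs s z * nHs (s + 1) v * nHs s z) := by
        gcongr
        · refine (lintegral_trilinear_le' hF hG hF).trans ?_
          gcongr
          · rfl
          · refine (lintegral_le_embConst hG s).trans_eq ?_
            rw [← nHs_jb_mul]; rfl
          · rfl
        · refine (lintegral_trilinear_le hF hH hz).trans ?_
          gcongr
          · rfl
          · rfl
          · exact lintegral_le_embConst hz s
        · refine (lintegral_trilinear_le'' hz hH hF).trans ?_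
          gcongr
          · exact lintegral_le_embConst hz s
          · rfl
          · rfl
    _ = _ := by ring

theorem norm_le_toReal_of_enorm_le {x : ℂ} {b : ENNReal} (hb : b ≠ ⊤) (h : ‖x‖ₑ ≤ b) :
    ‖x‖ ≤ b.toReal := by
  rw [← toReal_enorm]
  exact ENNReal.toReal_mono hb h

/-- The integral is the real part of a double integral J. Conjugating and exchanging ξ and η gives
the same kernel up to sign, with the weight m(η)η_j in place of m(ξ)ξ_j, because v is the transform
of a real function. Hence J plus its conjugate carries the difference m(ξ)ξ_j - m(η)η_j, to which
the commutator bound applies. This replaces the integration by parts of the physical-space argument.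
-/
theorem transport_bound {s R : ℝ} (hs : 1 ≤ s) (hds : (d : ℝ) / 2 < s) (hR : 1 ≤ R)
    {z v : Space d → ℂ} (hz : Measurable z) (hv : Measurable v)
    (hvc : ∀ᵐ a, v (-a) = (starRingEnd ℂ) (v a))
    (hzs : nHs s (fun ξ => ‖z ξ‖ₑ) ≠ ⊤) (hvs : nHs (s + 1) (fun ξ => ‖v ξ‖ₑ) ≠ ⊤) (j : Fin d) :
    Integrable (fun ξ => trunc s R ξ
        * inner ℝ (z ξ) (-(2 * Real.pi * Complex.I * ((ξ j : ℝ) : ℂ)) * conv z v ξ)) ∧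
      |∫ ξ, trunc s R ξ
        * inner ℝ (z ξ) (-(2 * Real.pi * Complex.I * ((ξ j : ℝ) : ℂ)) * conv z v ξ)|
      ≤ (ENNReal.ofReal (2 * Real.pi * ((1 + 2 * s) * 2 ^ s))
          * (3 * embConst d s * nHs s (fun ξ => ‖z ξ‖ₑ) ^ 2
          * nHs (s + 1) (fun ξ => ‖v ξ‖ₑ))).toReal := by
  set Φ : Space d → Space d → ℂ := fun ξ η =>
    (starRingEnd ℂ) (z ξ) * (-(2 * Real.pi * Complex.I) * ((trunc s R ξ * ξ j : ℝ) : ℂ))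
      * (z η * v (ξ - η)) with hΦdef
  have hE := (embConst_lt_top hds).ne
  have hzm := hz.enorm
  have hvm := hv.enorm
  have hcoord : Measurable (fun ξ : Space d => ξ j) :=
    (EuclideanSpace.proj j : Space d →L[ℝ] ℝ).continuous.measurable
  have htr : Measurable (trunc (d := d) s R) := (continuous_trunc (by linarith)).measurable
  have hΦm : Measurable (Function.uncurry Φ) := by
    have hc : Measurable (starRingEnd ℂ : ℂ → ℂ) := Complex.continuous_conj.measurable
    have h1 : Measurable (fun p : Space d × Space d => (starRingEnd ℂ) (z p.1)) :=
      hc.comp (hz.comp measurable_fst)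
    have h2 : Measurable (fun p : Space d × Space d => ((trunc s R p.1 * p.1 j : ℝ) : ℂ)) :=
      Complex.measurable_ofReal.comp ((htr.mul hcoord).comp measurable_fst)
    have h3 : Measurable (fun p : Space d × Space d => z p.2 * v (p.1 - p.2)) := by fun_prop
    exact (h1.mul (h2.const_mul _)).mul h3
  -- Purely qualitative: the truncation bounds the weight by R^{2s}, so Fubini applies. The final
  -- bound does not involve R.
  have hΦ : Integrable (Function.uncurry Φ) (volume.prod volume) := by
    refine ⟨hΦm.aestronglyMeasurable, ?_⟩
    rw [HasFiniteIntegral, lintegral_prod _ hΦm.enorm.aemeasurable]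
    refine lt_of_le_of_lt (b := ENNReal.ofReal (R ^ (2 * s)) * (nHs s (fun ξ => ‖z ξ‖ₑ)
      * nHs (s + 1) (fun ξ => ‖v ξ‖ₑ) * (embConst d s * nHs s (fun ξ => ‖z ξ‖ₑ)))) ?_
      (by finiteness)
    have hF : Measurable (fun ξ => ENNReal.ofReal (jb ξ) * ‖z ξ‖ₑ) := by fun_prop
    calc _ ≤ ∫⁻ ξ, ∫⁻ η, ENNReal.ofReal (R ^ (2 * s)) *
          ((ENNReal.ofReal (jb ξ) * ‖z ξ‖ₑ) * ‖v (ξ - η)‖ₑ * ‖z η‖ₑ) := by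
          refine lintegral_mono fun ξ => lintegral_mono fun η => ?_
          have h0 : ‖-(2 * Real.pi * Complex.I) * ((trunc s R ξ * ξ j : ℝ) : ℂ)‖ₑ
              ≤ ENNReal.ofReal (R ^ (2 * s) * jb ξ) := by
            rw [← ofReal_norm]
            refine ENNReal.ofReal_le_ofReal ?_
            rw [norm_mul, Complex.norm_real, norm_mul, abs_of_nonneg (trunc_nonneg hR ξ) |>
              (Real.norm_eq_abs _).trans]
            simp only [norm_neg, norm_mul, Complex.norm_I, Complex.norm_ofNat, Complex.norm_real,
              Real.norm_eq_abs, abs_of_pos Real.pi_pos]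
            calc _ = trunc s R ξ * (2 * Real.pi * |ξ j|) := by ring
              _ ≤ _ := by
                gcongr
                · exact trunc_le_const (by linarith) hR ξ
                · exact abs_coord_le_jb ξ j
          simp only [Function.uncurry, hΦdef]
          rw [enorm_mul, enorm_mul, enorm_mul (z η), RCLike.enorm_conj]
          calc _ ≤ ‖z ξ‖ₑ * ENNReal.ofReal (R ^ (2 * s) * jb ξ) * (‖z η‖ₑ * ‖v (ξ - η)‖ₑ) := by
                gcongr
            _ = _ := by
              rw [ENNReal.ofReal_mul (Real.rpow_nonneg (by linarith) _)]; ring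
      _ = ENNReal.ofReal (R ^ (2 * s)) * ∫⁻ ξ, ∫⁻ η,
          ((ENNReal.ofReal (jb ξ) * ‖z ξ‖ₑ) * ‖v (ξ - η)‖ₑ * ‖z η‖ₑ) :=
          lintegral_lintegral_const_mul (by fun_prop)
      _ ≤ _ := by
          gcongr
          refine (lintegral_trilinear_le hF hvm hzm).trans ?_
          gcongr
          · refine le_trans (le_of_eq ?_) (nHs_mono hs _)
            simp [nHs]
          · rw [← nHs_zero]; exact nHs_mono (by linarith) _
          · exact lintegral_le_embConst hzm s
  have hD : ∀ ξ, trunc s R ξ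
        * inner ℝ (z ξ) (-(2 * Real.pi * Complex.I * ((ξ j : ℝ) : ℂ)) * conv z v ξ)
        = (∫ η, Φ ξ η).re := fun ξ => by
    simp only [hΦdef]
    rw [integral_const_mul, Complex.inner, ← Complex.re_ofReal_mul, conv]
    congr 1
    push_cast
    ring
  have hint := hΦ.integral_prod_left
  simp only [Function.uncurry] at hint
  have hDint := hint.re
  simp only [hD]
  refine ⟨hDint, ?_⟩
  have hre : ∫ ξ, (∫ η, Φ ξ η).re = (∫ ξ, ∫ η, Φ ξ η).re := integral_re hint
  rw [hre]
  set J := ∫ ξ, ∫ η, Φ ξ η with hJ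
  have hΦ' : Integrable (fun p : Space d × Space d => (starRingEnd ℂ) (Φ p.2 p.1))
      (volume.prod volume) :=
    (LinearIsometryEquiv.integrable_comp_iff Complex.conjLIE).2 hΦ.swap
  have hJ2 : (starRingEnd ℂ) J = ∫ ξ, ∫ η, (starRingEnd ℂ) (Φ η ξ) := by
    rw [hJ, integral_integral_swap hΦ, ← integral_conj]
    simp only [← integral_conj]
  have hJJ : J + (starRingEnd ℂ) J = ∫ ξ, ∫ η, (Φ ξ η + (starRingEnd ℂ) (Φ η ξ)) := by
    rw [hJ2, hJ]
    exact (integral_integral_add hΦ hΦ').symm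
  have hkey : ‖J + (starRingEnd ℂ) J‖ₑ ≤ ENNReal.ofReal (2 * Real.pi * ((1 + 2 * s) * 2 ^ s))
          * (3 * embConst d s * nHs s (fun ξ => ‖z ξ‖ₑ) ^ 2
          * nHs (s + 1) (fun ξ => ‖v ξ‖ₑ)) := by
    rw [hJJ]
    refine (enorm_integral_le_lintegral_enorm _).trans ?_
    refine (lintegral_mono fun ξ => enorm_integral_le_lintegral_enorm _).trans ?_
    calc _ ≤ ∫⁻ ξ, ∫⁻ η, ENNReal.ofReal (2 * Real.pi * ((1 + 2 * s) * 2 ^ s))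
          * (ENNReal.ofReal (jb ξ ^ s * jb (ξ - η) * jb η ^ s
        + jb ξ ^ s * jb (ξ - η) ^ (s + 1) + jb (ξ - η) ^ (s + 1) * jb η ^ s)
        * (‖z ξ‖ₑ * ‖v (ξ - η)‖ₑ * ‖z η‖ₑ)) := by
          refine lintegral_mono fun ξ => lintegral_mono_ae ?_
          -- The Hermitian symmetry of v is known only almost everywhere; it is transported to the
          -- variable ξ - η for fixed ξ.
          filter_upwards [(quasiMeasurePreserving_sub_left volume ξ).ae hvc] with η hη
          have e1 : Φ ξ η + (starRingEnd ℂ) (Φ η ξ)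
              = (-(2 * Real.pi * Complex.I) * ((trunc s R ξ * ξ j - trunc s R η * η j : ℝ) : ℂ))
                * ((starRingEnd ℂ) (z ξ) * v (ξ - η) * z η) := by
            have : v (η - ξ) = (starRingEnd ℂ) (v (ξ - η)) := by rw [← hη, neg_sub]
            simp only [hΦdef, this, map_mul, map_neg, Complex.conj_conj, Complex.conj_I,
              Complex.conj_ofReal, Complex.conj_ofNat]
            push_cast
            ring
          rw [e1, enorm_mul, enorm_mul _ (z η), enorm_mul _ (v _), RCLike.enorm_conj,
            ← mul_assoc (ENNReal.ofReal _)]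
          gcongr
          rw [← ENNReal.ofReal_mul (by positivity), ← ofReal_norm]
          refine ENNReal.ofReal_le_ofReal ?_
          rw [norm_mul, Complex.norm_real]
          simp only [norm_neg, norm_mul, Complex.norm_I, Complex.norm_ofNat, Complex.norm_real,
              Real.norm_eq_abs, abs_of_pos Real.pi_pos]
          refine (mul_le_mul_of_nonneg_left (abs_trunc_mul_sub_le hs hR ξ η j)
            (by positivity)).trans_eq ?_
          ring
      _ = ENNReal.ofReal (2 * Real.pi * ((1 + 2 * s) * 2 ^ s)) * ∫⁻ ξ, ∫⁻ η,
            (ENNReal.ofReal (jb ξ ^ s * jb (ξ - η) * jb η ^ s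
        + jb ξ ^ s * jb (ξ - η) ^ (s + 1) + jb (ξ - η) ^ (s + 1) * jb η ^ s)
        * (‖z ξ‖ₑ * ‖v (ξ - η)‖ₑ * ‖z η‖ₑ)) := lintegral_lintegral_const_mul (by fun_prop)
      _ ≤ _ := by
          gcongr
          exact lintegral_commutator_le hzm hvm
  refine le_trans ?_ (norm_le_toReal_of_enorm_le (by finiteness) hkey)
  have h2 : J + (starRingEnd ℂ) J = ((2 * J.re : ℝ) : ℂ) := by
    rw [Complex.add_conj]
  rw [h2, Complex.norm_real, Real.norm_eq_abs, abs_mul, abs_two]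
  linarith [abs_nonneg J.re]

end Transport

/-! ### The Fourier transform of the translated solid. -/

section SolidProfile

variable {d : ℕ}

/-- The profile of the solid as a Schwartz function. -/
def Solid.schwartz (b : Solid d) : 𝓢(Space d, ℝ) := b.compact.toSchwartzMap b.smooth

@[simp] theorem Solid.schwartz_apply (b : Solid d) (x : Space d) : b.schwartz x = b.shape x := rfl

/-- The solid translated by `Y`. -/
def Solid.translate (b : Solid d) (Y : Space d) : Solid d where
  shape x := b.shape (x - Y)
  smooth := b.smooth.comp (contDiff_id.sub contDiff_const)
  compact := b.compact.comp_homeomorph (Homeomorph.subRight Y)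

/-- The Fourier transform of the profile of the solid. -/
def Solid.hat (b : Solid d) : 𝓢(Space d, ℂ) := 𝓕 (toComplex b.schwartz)

theorem Solid.fourierL2_toL2 (b : Solid d) : fourierL2 b.toL2 =ᵐ[volume] b.hat := by
  have h1 : Complex.ofRealCLM.compLp b.toL2 = (toComplex b.schwartz).toLp 2 := by
    refine Lp.ext ?_
    filter_upwards [Complex.ofRealCLM.coeFn_compLp b.toL2, (toComplex b.schwartz).coeFn_toLp 2,
      MemLp.coeFn_toLp (b.smooth.continuous.memLp_of_hasCompactSupport b.compact :
        MemLp b.shape 2 volume)] with x h1 h2 h3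
    rw [h1, h2, Solid.toL2, h3]
    simp
  rw [fourierL2, h1, SchwartzMap.toLp_fourier_eq]
  exact (𝓕 (toComplex b.schwartz)).coeFn_toLp 2

/-- The factor of the Fourier transform of a translate. -/
def shiftChar (Y ξ : Space d) : ℂ := Complex.exp ((-(2 * Real.pi * inner ℝ ξ Y) : ℝ) * Complex.I)

theorem norm_shiftChar (Y ξ : Space d) : ‖shiftChar Y ξ‖ = 1 := Complex.norm_exp_ofReal_mul_I _

theorem Solid.hat_translate (b : Solid d) (Y ξ : Space d) :
    (b.translate Y).hat ξ = shiftChar Y ξ * b.hat ξ := by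
  rw [Solid.hat, Solid.hat, SchwartzMap.fourier_coe, SchwartzMap.fourier_coe,
    Real.fourier_eq', Real.fourier_eq', ← integral_const_mul,
    ← integral_add_right_eq_self _ Y]
  refine integral_congr_ae (Eventually.of_forall fun x => ?_)
  simp only [toComplex_apply, Solid.schwartz_apply, Solid.translate, add_sub_cancel_right,
    smul_eq_mul, shiftChar]
  rw [← mul_assoc, ← Complex.exp_add, inner_add_left, real_inner_comm ξ Y]
  congr 2
  push_cast
  ring

theorem Solid.inner_gradient (b : Solid d) (Y A x : Space d) :
    inner ℝ (gradient b.shape (x - Y)) A = (∂_{A} (b.translate Y).schwartz) x := by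
  rw [SchwartzMap.lineDerivOp_apply_eq_fderiv, inner_gradient_left]
  have : ⇑(b.translate Y).schwartz = fun x => b.shape (x - Y) := rfl
  rw [this, fderiv_comp_sub]

/-- Writing the bottom acceleration with line derivatives of a Schwartz function makes the Fourier
multiplier rules available. -/
theorem Solid.bottomAccel_eq (b : Solid d) (Y Z A : Space d) :
    bottomAccel b Y Z A = ⇑(∂_{Z} (∂_{Z} (b.translate Y).schwartz)
      - ∂_{A} (b.translate Y).schwartz) := by
  ext x
  rw [bottomAccel, _root_.sub_apply, Solid.inner_gradient]
  congr 1
  have hg : Differentiable ℝ (gradient b.shape) := by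
    have : gradient b.shape = fun x => (InnerProductSpace.toDual ℝ (Space d)).symm
      (fderiv ℝ b.shape x) := rfl
    rw [this]
    exact (InnerProductSpace.toDual ℝ (Space d)).symm.toContinuousLinearEquiv.differentiable.comp
      ((b.smooth.fderiv_right (m := 1) (by norm_cast)).differentiable one_ne_zero)
  rw [SchwartzMap.lineDerivOp_apply_eq_fderiv]
  have h1 : ((∂_{Z} (b.translate Y).schwartz : 𝓢(Space d, ℝ)) : Space d → ℝ)
      = fun x => inner ℝ (gradient b.shape (x - Y)) Z := by
    ext x; rw [Solid.inner_gradient]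
  rw [h1, fderiv_comp_sub (f := fun x => inner ℝ (gradient b.shape x) Z)]
  have h2 := ((hg (x - Y)).hasFDerivAt.inner ℝ (hasFDerivAt_const Z (x - Y))).fderiv
  rw [h2]
  simp

theorem ofReal_integral_schwartz (g φ : 𝓢(Space d, ℝ)) :
    ((∫ x, g x * φ x : ℝ) : ℂ) = ∫ ξ, 𝓕 (toComplex g) ξ * 𝓕⁻ (toComplex φ) ξ := by
  rw [SchwartzMap.integral_fourier_mul_eq, FourierTransform.fourier_fourierInv_eq,
    ← integral_complex_ofReal]
  simp

end SolidProfile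

/-! ### The fluid equations on the Fourier side. -/

section Equations

variable {d : ℕ}

/-- The symbol `2πi ξ_j` of the partial derivative `∂_j`. -/
def sym (j : Fin d) (ξ : Space d) : ℂ := 2 * Real.pi * Complex.I * ((ξ j : ℝ) : ℂ)

/-- The pairing of a function with a test function. -/
def pair (G : Space d → ℂ) (ψ : 𝓢(Space d, ℂ)) : ℂ := ∫ ξ, G ξ * ψ ξ

theorem Testable.pair_add {G H : Space d → ℂ} (hG : Testable G) (hH : Testable H)
    (ψ : 𝓢(Space d, ℂ)) : pair (fun ξ => G ξ + H ξ) ψ = pair G ψ + pair H ψ := by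
  simp only [pair, add_mul]
  exact integral_add (hG ψ) (hH ψ)

theorem Testable.pair_sub {G H : Space d → ℂ} (hG : Testable G) (hH : Testable H)
    (ψ : 𝓢(Space d, ℂ)) : pair (fun ξ => G ξ - H ξ) ψ = pair G ψ - pair H ψ := by
  simp only [pair, sub_mul]
  exact integral_sub (hG ψ) (hH ψ)

theorem pair_const_mul (c : ℂ) (G : Space d → ℂ) (ψ : 𝓢(Space d, ℂ)) :
    pair (fun ξ => c * G ξ) ψ = c * pair G ψ := by
  simp only [pair, mul_assoc]
  exact integral_const_mul _ _

theorem pair_sum {ι : Type*} {s : Finset ι} {G : ι → Space d → ℂ}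
    (hG : ∀ i ∈ s, Testable (G i)) (ψ : 𝓢(Space d, ℂ)) :
    pair (fun ξ => ∑ i ∈ s, G i ξ) ψ = ∑ i ∈ s, pair (G i) ψ := by
  simp only [pair, Finset.sum_mul]
  exact integral_finsetSum s fun i hi => hG i hi ψ

theorem pair_lineDeriv (G : Space d → ℂ) (φ : 𝓢(Space d, ℝ)) (j : Fin d) :
    pair G (𝓕⁻ (toComplex (∂_{coord j} φ)))
      = -pair (fun ξ => sym j ξ * G ξ) (𝓕⁻ (toComplex φ)) := by
  rw [pair, pair, ← integral_neg]
  refine integral_congr_ae (Eventually.of_forall fun ξ => ?_)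
  simp only [toComplex_lineDeriv, fourierInv_lineDeriv_apply, inner_coord, sym]
  ring

theorem Testable.sym_mul {G : Space d → ℂ} (hG : Testable G) (j : Fin d) :
    Testable (fun ξ => sym j ξ * G ξ) := hG.temperate_mul (temperate_symbol j)

theorem integrable_of_nHs {s : ℝ} (hs : (d : ℝ) / 2 < s) {F : Space d → ℂ} (hF : Measurable F)
    (h : nHs s (fun ξ => ‖F ξ‖ₑ) ≠ ⊤) : Integrable F :=
  ⟨hF.aestronglyMeasurable, (lintegral_le_embConst hF.enorm s).trans_lt
    (ENNReal.mul_lt_top (embConst_lt_top hs) h.lt_top)⟩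

theorem measurable_fourierL2 (f : L2 d) : Measurable (fourierL2 f) :=
  (Lp.stronglyMeasurable _).measurable

theorem MemHs.nHs_ne_top {s : ℝ} {f : L2 d} (hf : MemHs s f) :
    nHs s (fun ξ => ‖fourierL2 f ξ‖ₑ) ≠ ⊤ := by
  rw [hf.nHs_eq]; exact ENNReal.ofReal_ne_top

theorem MemHs.integrable {s : ℝ} (hs : (d : ℝ) / 2 < s) {f : L2 d} (hf : MemHs s f) :
    Integrable (fourierL2 f) :=
  integrable_of_nHs hs (measurable_fourierL2 f) hf.nHs_ne_top

theorem norm_sym_le (j : Fin d) (ξ : Space d) : ‖sym j ξ‖ ≤ jb ξ := by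
  refine le_trans (le_of_eq ?_) (abs_coord_le_jb ξ j)
  simp [sym, abs_of_pos Real.pi_pos]

theorem measurable_sym (j : Fin d) : Measurable (sym j) :=
  (temperate_symbol j).1.continuous.measurable

theorem nHs_sym_mul_le (s : ℝ) (j : Fin d) (F : Space d → ℂ) :
    nHs s (fun ξ => ‖sym j ξ * F ξ‖ₑ) ≤ nHs (s + 1) (fun ξ => ‖F ξ‖ₑ) := by
  rw [← nHs_jb_mul]
  refine n2_mono fun ξ => ?_
  beta_reduce
  rw [enorm_mul, ← ofReal_norm (sym j ξ)]
  gcongr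
  exact norm_sym_le j ξ

theorem integrable_sym_mul {s : ℝ} (hs : (d : ℝ) / 2 < s) {f : L2 d} (hf : MemHs (s + 1) f)
    (j : Fin d) : Integrable (fun ξ => sym j ξ * fourierL2 f ξ) :=
  integrable_of_nHs hs ((measurable_sym j).mul (measurable_fourierL2 f))
    ((nHs_sym_mul_le s j _).trans_lt hf.nHs_ne_top.lt_top).ne

theorem conv_congr {F F' G G' : Space d → ℂ} (hF : F =ᵐ[volume] F') (hG : G =ᵐ[volume] G') :
    conv F G = conv F' G' := by
  ext ξ
  refine integral_congr_ae ?_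
  filter_upwards [hF, (quasiMeasurePreserving_sub_left volume ξ).ae hG] with η h1 h2
  rw [h1, h2]

theorem integrable_mul_mul (u w : L2 d) (φ : 𝓢(Space d, ℝ)) :
    Integrable (fun x => u x * w x * φ x) := by
  have h := ((Lp.memLp u).integrable_mul (Lp.memLp w)).bdd_mul
    (c := SchwartzMap.seminorm ℝ 0 0 φ) φ.continuous.aestronglyMeasurable
    (Eventually.of_forall (φ.norm_le_seminorm ℝ))
  refine h.congr (Eventually.of_forall fun x => ?_)
  simp [mul_comm]

theorem integrable_L2_mul (u : L2 d) (φ : 𝓢(Space d, ℝ)) : Integrable (fun x => u x * φ x) :=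
  (Lp.memLp u).integrable_mul (φ.memLp 2)

theorem Solid.toL2_ae (b : Solid d) : b.toL2 =ᵐ[volume] b.shape :=
  MemLp.coeFn_toLp (b.smooth.continuous.memLp_of_hasCompactSupport b.compact :
    MemLp b.shape 2 volume)

theorem Solid.integrable_fourierL2 (b : Solid d) : Integrable (fourierL2 b.toL2) :=
  b.hat.integrable.congr b.fourierL2_toL2.symm

/-- The flux `h V_j` on the Fourier side, for the solid `b` in its actual position. -/
def flux (p : Params) (b : Solid d) (U : State d) (j : Fin d) (ξ : Space d) : ℂ :=
  fourierL2 (U.2 j) ξ + p.ε * (conv (fourierL2 U.1) (fourierL2 (U.2 j)) ξ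
    - conv b.hat (fourierL2 (U.2 j)) ξ)

theorem testable_flux (p : Params) (b : Solid d) (U : State d) (j : Fin d)
    (h1 : Integrable (fourierL2 U.1)) (h2 : Integrable (fourierL2 (U.2 j))) :
    Testable (flux p b U j) :=
  (testable_fourierL2 _).add (((testable_of_integrable (integrable_conv h1 h2)).sub
    (testable_of_integrable (integrable_conv b.hat.integrable h2))).const_mul _)

theorem ofReal_integral_flux (p : Params) (b : Solid d) (U : State d) (j : Fin d) (Y : Space d)
    (h1 : Integrable (fourierL2 U.1)) (h2 : Integrable (fourierL2 (U.2 j)))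
    (φ : 𝓢(Space d, ℝ)) :
    ((∫ x, height p b U.1 Y x * U.2 j x * φ x : ℝ) : ℂ)
      = pair (flux p (b.translate Y) U j) (𝓕⁻ (toComplex φ)) := by
  set g := (b.translate Y).toL2 with hg
  have e1 : ∫ x, height p b U.1 Y x * U.2 j x * φ x
      = (∫ x, U.2 j x * φ x) + p.ε * ((∫ x, U.1 x * U.2 j x * φ x)
        - ∫ x, g x * U.2 j x * φ x) := by
    have i1 : Integrable (fun x => p.ε * (U.1 x * U.2 j x * φ x - g x * U.2 j x * φ x)) :=
      ((integrable_mul_mul _ _ _).sub (integrable_mul_mul _ _ _)).const_mul _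
    rw [← integral_sub (integrable_mul_mul _ _ _) (integrable_mul_mul _ _ _),
      ← integral_const_mul, ← integral_add (integrable_L2_mul _ _) i1]
    refine integral_congr_ae ?_
    filter_upwards [(b.translate Y).toL2_ae] with x hx
    rw [hg, hx, height]
    simp only [Solid.translate]
    ring
  have h3 : conv (fourierL2 g) (fourierL2 (U.2 j))
      = conv (b.translate Y).hat (fourierL2 (U.2 j)) :=
    conv_congr (b.translate Y).fourierL2_toL2 (ae_eq_refl _)
  have t1 := testable_of_integrable (integrable_conv h1 h2)
  have t2 := testable_of_integrable (integrable_conv (b.translate Y).hat.integrable h2)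
  rw [e1]
  push_cast
  rw [ofReal_integral_mul, ofReal_integral_mul_mul _ _ h1 h2,
    ofReal_integral_mul_mul _ _ (b.translate Y).integrable_fourierL2 h2, h3]
  unfold flux
  rw [(testable_fourierL2 _).pair_add ((t1.sub t2).const_mul _), pair_const_mul, t1.pair_sub t2]
  rfl

theorem fourier_lineDeriv_toComplex (g : 𝓢(Space d, ℝ)) (A ξ : Space d) :
    𝓕 (toComplex (∂_{A} g)) ξ = 2 * Real.pi * Complex.I * (inner ℝ ξ A : ℝ) * 𝓕 (toComplex g) ξ := by
  rw [toComplex_lineDeriv, fourier_lineDeriv_apply]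

theorem testable_schwartz (g : 𝓢(Space d, ℂ)) : Testable g := testable_of_integrable g.integrable

/-- The mass equation on the Fourier side. -/
theorem MassEq.fourier {p : Params} {b : Solid d} {U U' : State d} {Y Z : Space d}
    (h : MassEq p b U U' Y Z) (h1 : Integrable (fourierL2 U.1))
    (h2 : ∀ j, Integrable (fourierL2 (U.2 j))) :
    ∀ᵐ ξ, fourierL2 U'.1 ξ = -(∑ j, sym j ξ * flux p (b.translate Y) U j ξ)
      - 2 * Real.pi * Complex.I * (inner ℝ ξ Z : ℝ) * (b.translate Y).hat ξ := by
  set g := (b.translate Y).schwartz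
  have tf : ∀ j ∈ Finset.univ, Testable (fun ξ => sym j ξ * flux p (b.translate Y) U j ξ) :=
    fun j _ => (testable_flux p _ U j h1 (h2 j)).sym_mul j
  have ts := testable_schwartz (𝓕 (toComplex (∂_{Z} g)))
  have hT := ((testable_fourierL2 U'.1).add (Testable.sum tf)).add ts
  -- Each term of the weak equation is rewritten as a pairing with 𝓕⁻φ; derivatives on φ become
  -- symbols with the opposite sign, so the pairing of the full combination vanishes.
  have h0 := hT.ae_eq_zero fun φ => by
    have e := congrArg (fun r : ℝ => (r : ℂ)) (h φ)
    simp only [Solid.inner_gradient] at e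
    push_cast at e
    rw [ofReal_integral_mul, ofReal_integral_schwartz] at e
    simp only [fun j => ofReal_integral_flux p b U j Y h1 (h2 j), pair_lineDeriv,
      Finset.sum_neg_distrib] at e
    rw [← pair, ((testable_fourierL2 U'.1).add (Testable.sum tf)).pair_add ts,
      (testable_fourierL2 U'.1).pair_add (Testable.sum tf), pair_sum tf]
    rw [← pair, ← pair, sub_neg_eq_add] at e
    rw [e, neg_add_cancel]
  filter_upwards [h0] with ξ hξ
  rw [fourier_lineDeriv_toComplex] at hξ
  rw [Solid.hat]
  linear_combination hξ

/-- The advection term `(V·∇) V_i` on the Fourier side. -/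
def advection (U : State d) (i : Fin d) (ξ : Space d) : ℂ :=
  ∑ j, conv (fourierL2 (U.2 j)) (fun η => sym j η * fourierL2 (U.2 i) η) ξ

/-- The momentum equation on the Fourier side. -/
theorem MomentumEq.fourier {p : Params} {b : Solid d} {U U' : State d} {Y Z A : Space d}
    (h : MomentumEq p b U U' Y Z A) (h2 : ∀ j, Integrable (fourierL2 (U.2 j)))
    (h3 : ∀ i j, Integrable (fun ξ => sym j ξ * fourierL2 (U.2 i) ξ)) (i : Fin d) :
    ∀ᵐ ξ, ((1 + p.μ / 3 * (2 * Real.pi * ‖ξ‖) ^ 2 : ℝ) : ℂ) * fourierL2 (U'.2 i) ξ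
      = -(sym i ξ * fourierL2 U.1 ξ) - p.ε * advection U i ξ
        - p.μ / 2 * (sym i ξ * ((2 * Real.pi * Complex.I * (inner ℝ ξ Z : ℝ)) ^ 2
          - 2 * Real.pi * Complex.I * (inner ℝ ξ A : ℝ)) * (b.translate Y).hat ξ) := by
  obtain ⟨DV, hDV, h⟩ := h
  set g := (b.translate Y).schwartz with hg
  set G : 𝓢(Space d, ℝ) := ∂_{coord i} (∂_{Z} (∂_{Z} g) - ∂_{A} g) with hG
  -- The unknown weak derivatives are replaced by the explicit multiplier, so the advection term no
  -- longer depends on the choice of `DV`.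
  have hD : ∀ i j, fourierL2 (DV i j) =ᵐ[volume] fun ξ => sym j ξ * fourierL2 (U.2 i) ξ :=
    fun i j => (hDV i j).fourierL2_ae
  have hDi : ∀ j, Integrable (fourierL2 (DV i j)) := fun j => (h3 i j).congr (hD i j).symm
  have hc : ∀ j, conv (fourierL2 (U.2 j)) (fourierL2 (DV i j))
      = conv (fourierL2 (U.2 j)) (fun η => sym j η * fourierL2 (U.2 i) η) :=
    fun j => conv_congr (ae_eq_refl _) (hD i j)
  have ta : ∀ j ∈ Finset.univ,
      Testable (conv (fourierL2 (U.2 j)) (fun η => sym j η * fourierL2 (U.2 i) η)) :=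
    fun j _ => testable_of_integrable (integrable_conv (h2 j) (h3 i j))
  have tJ : Testable (fun ξ => ((1 + p.μ / 3 * (2 * Real.pi * ‖ξ‖) ^ 2 : ℝ) : ℂ)
      * fourierL2 (U'.2 i) ξ) := by
    refine (testable_fourierL2 _).temperate_mul ?_
    have : (fun ξ : Space d => (1 + p.μ / 3 * (2 * Real.pi * ‖ξ‖) ^ 2 : ℝ)).HasTemperateGrowth := by
      simp only [mul_pow]
      fun_prop
    exact Complex.ofRealCLM.hasTemperateGrowth.comp this
  have t1 := (testable_fourierL2 U.1).sym_mul i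
  have t2 := (Testable.sum ta).const_mul p.ε
  have t3 := (testable_schwartz (𝓕 (toComplex G))).const_mul (p.μ / 2)
  have hT := ((tJ.add t1).add t2).add t3
  have h0 := hT.ae_eq_zero fun φ => by
    have e := congrArg (fun r : ℝ => (r : ℂ)) (h i φ)
    have eG : ∀ x, fderiv ℝ (bottomAccel b Y Z A) x (coord i) = G x := fun x => by
      rw [Solid.bottomAccel_eq, hG, SchwartzMap.lineDerivOp_apply_eq_fderiv]
    obtain ⟨Φ, hΦ⟩ : ∃ Φ : 𝓢(Space d, ℝ), Φ = φ - (p.μ / 3) • Δ φ := ⟨_, rfl⟩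
    have eJ : ∫ x, U'.2 i x * (φ x - p.μ / 3 * (Δ φ) x) = ∫ x, U'.2 i x * Φ x := by
      refine integral_congr_ae (Eventually.of_forall fun x => ?_)
      simp [hΦ]
    have eA : ∫ x, (∑ j, U.2 j x * DV i j x) * φ x = ∑ j, ∫ x, U.2 j x * DV i j x * φ x := by
      simp only [Finset.sum_mul]
      exact integral_finsetSum _ fun j _ => integrable_mul_mul _ _ _
    simp only [eG, eJ, eA] at e
    push_cast at e
    rw [ofReal_integral_mul, ofReal_integral_mul, ofReal_integral_schwartz] at e
    simp only [fun j => ofReal_integral_mul_mul (U.2 j) (DV i j) (h2 j) (hDi j) φ, hc] at e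
    have eJ' : ∫ ξ, fourierL2 (U'.2 i) ξ * 𝓕⁻ (toComplex Φ) ξ
        = pair (fun ξ => ((1 + p.μ / 3 * (2 * Real.pi * ‖ξ‖) ^ 2 : ℝ) : ℂ)
          * fourierL2 (U'.2 i) ξ) (𝓕⁻ (toComplex φ)) := by
      refine integral_congr_ae (Eventually.of_forall fun ξ => ?_)
      have : toComplex Φ = toComplex φ - ((p.μ / 3 : ℝ) : ℂ) • Δ (toComplex φ) := by
        rw [← toComplex_laplacian, hΦ]
        ext x
        simp
      simp only [this]
      rw [sub_eq_add_neg, ← neg_smul, FourierTransform.fourierInv_add,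
        FourierTransform.fourierInv_smul, _root_.add_apply, _root_.smul_apply,
        fourierInv_laplacian_apply]
      push_cast
      simp only [smul_eq_mul]
      ring
    rw [eJ', ← pair, pair_lineDeriv] at e
    rw [← pair, ((tJ.add t1).add t2).pair_add t3, (tJ.add t1).pair_add t2, tJ.pair_add t1,
      pair_const_mul, pair_const_mul, pair_sum ta]
    simp only [fun j => show ∫ ξ, conv (fourierL2 (U.2 j))
      (fun η => sym j η * fourierL2 (U.2 i) η) ξ * 𝓕⁻ (toComplex φ) ξ = pair _ _ from rfl] at e
    rw [← pair] at e
    linear_combination e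
  filter_upwards [h0] with ξ hξ
  have eG : 𝓕 (toComplex G) ξ = sym i ξ * ((2 * Real.pi * Complex.I * (inner ℝ ξ Z : ℝ)) ^ 2
          - 2 * Real.pi * Complex.I * (inner ℝ ξ A : ℝ)) * (b.translate Y).hat ξ := by
    rw [hG, fourier_lineDeriv_toComplex, inner_coord]
    have : toComplex (∂_{Z} (∂_{Z} g) - ∂_{A} g)
        = toComplex (∂_{Z} (∂_{Z} g)) + (-1 : ℂ) • toComplex (∂_{A} g) := by
      ext x; simp [sub_eq_add_neg]
    rw [this, FourierTransform.fourier_add, FourierTransform.fourier_smul, _root_.add_apply,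
      _root_.smul_apply, fourier_lineDeriv_toComplex, fourier_lineDeriv_toComplex,
      fourier_lineDeriv_toComplex, Solid.hat, sym]
    simp only [smul_eq_mul]
    ring
  rw [eG] at hξ
  rw [advection]
  linear_combination hξ

end Equations

/-! ### Bounds for weighted pairings and multipliers. -/

section Estimates

variable {d : ℕ}

theorem integrable_and_abs_integral_le {G : Space d → ℝ} (hG : AEStronglyMeasurable G)
    {B : ENNReal} (hB : B ≠ ⊤) (h : ∫⁻ ξ, ‖G ξ‖ₑ ≤ B) :
    Integrable G ∧ |∫ ξ, G ξ| ≤ B.toReal := by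
  refine ⟨⟨hG, h.trans_lt hB.lt_top⟩, ?_⟩
  have := (enorm_integral_le_lintegral_enorm G).trans h
  rw [← Real.norm_eq_abs, ← toReal_enorm]
  exact ENNReal.toReal_mono hB this

theorem lintegral_weight_le {s : ℝ} {G : Space d → ℝ} {f h : Space d → ENNReal}
    (hf : Measurable f) (hh : Measurable h)
    (hG : ∀ᵐ ξ, ‖G ξ‖ₑ ≤ (ENNReal.ofReal (jb ξ ^ s) * f ξ) * (ENNReal.ofReal (jb ξ ^ s) * h ξ)) :
    ∫⁻ ξ, ‖G ξ‖ₑ ≤ nHs s f * nHs s h :=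
  (lintegral_mono_ae hG).trans (lintegral_mul_le_n2 (by fun_prop) (by fun_prop))

theorem enorm_trunc_mul_inner_le {s R τ : ℝ} (hs : 0 ≤ s) (hR : 1 ≤ R) (ξ : Space d)
    (x k y : ℂ) (hk : ‖k‖ ≤ jb ξ ^ τ) :
    ‖trunc s R ξ * inner ℝ x (k * y)‖ₑ
      ≤ (ENNReal.ofReal (jb ξ ^ s) * ‖x‖ₑ) * (ENNReal.ofReal (jb ξ ^ (s + τ)) * ‖y‖ₑ) := by
  have h1 := Real.rpow_nonneg (jb_pos ξ).le s
  have h2 := Real.rpow_nonneg (jb_pos ξ).le (s + τ)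
  rw [← ofReal_norm, ← ofReal_norm x, ← ofReal_norm y, ← ENNReal.ofReal_mul h1,
    ← ENNReal.ofReal_mul h2, ← ENNReal.ofReal_mul (by positivity)]
  refine ENNReal.ofReal_le_ofReal ?_
  rw [norm_mul, Real.norm_of_nonneg (trunc_nonneg hR ξ)]
  have h3 := trunc_le_rpow hs hR ξ
  have h4 : ‖inner ℝ x (k * y)‖ ≤ ‖x‖ * (‖k‖ * ‖y‖) :=
    (norm_inner_le_norm x (k * y)).trans_eq (by rw [norm_mul])
  calc trunc s R ξ * ‖inner ℝ x (k * y)‖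
      ≤ jb ξ ^ (2 * s) * (‖x‖ * (jb ξ ^ τ * ‖y‖)) := by
        gcongr
        · exact Real.rpow_nonneg (jb_pos ξ).le _
        · exact h4.trans (by gcongr)
    _ = jb ξ ^ s * ‖x‖ * (jb ξ ^ (s + τ) * ‖y‖) := by
        rw [two_mul, Real.rpow_add (jb_pos ξ), Real.rpow_add (jb_pos ξ)]
        ring

/-- The constant of the product estimate in `H^s`. -/
def prodConst (d : ℕ) (s : ℝ) : ENNReal := ENNReal.ofReal (2 ^ s * 2) * embConst d s

theorem prodConst_ne_top {s : ℝ} (hs : (d : ℝ) / 2 < s) : prodConst d s ≠ ⊤ :=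
  (ENNReal.mul_lt_top ENNReal.ofReal_lt_top (embConst_lt_top hs)).ne

/-- The multiplier k of order τ is put on the convolution, whose `H^{s+τ}` norm the algebra property
controls. It is used with τ = 1 for the flux of the bottom and with τ = 0 for advection. -/
theorem inner_conv_bound {s R τ : ℝ} (hs : 0 ≤ s) (hτ : 0 ≤ τ) (hds : (d : ℝ) / 2 < s)
    (hR : 1 ≤ R) {F k A B : Space d → ℂ} (hF : Measurable F) (hk : Measurable k)
    (hkb : ∀ ξ, ‖k ξ‖ ≤ jb ξ ^ τ) (hA : Measurable A) (hB : Measurable B)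
    {α a β : ℝ} (ha : 0 ≤ a) (hβ : 0 ≤ β)
    (hFn : nHs s (fun ξ => ‖F ξ‖ₑ) ≤ ENNReal.ofReal α)
    (hAn : nHs (s + τ) (fun ξ => ‖A ξ‖ₑ) ≤ ENNReal.ofReal a)
    (hBn : nHs (s + τ) (fun ξ => ‖B ξ‖ₑ) ≤ ENNReal.ofReal β) (hα : 0 ≤ α) :
    Integrable (fun ξ => trunc s R ξ * inner ℝ (F ξ) (k ξ * conv A B ξ)) ∧
      |∫ ξ, trunc s R ξ * inner ℝ (F ξ) (k ξ * conv A B ξ)|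
        ≤ (prodConst d (s + τ)).toReal * α * a * β := by
  have hds' : (d : ℝ) / 2 < s + τ := by linarith
  have hC := prodConst_ne_top hds'
  have hAi := integrable_of_nHs hds' hA (hAn.trans_lt ENNReal.ofReal_lt_top).ne
  have hBi := integrable_of_nHs hds' hB (hBn.trans_lt ENNReal.ofReal_lt_top).ne
  have hm : AEStronglyMeasurable (fun ξ => trunc s R ξ * inner ℝ (F ξ) (k ξ * conv A B ξ)) :=
    (continuous_trunc hs).aestronglyMeasurable.mul (hF.aestronglyMeasurable.inner
      (hk.aestronglyMeasurable.mul (integrable_conv hAi hBi).aestronglyMeasurable))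
  have hle : ∫⁻ ξ, ‖trunc s R ξ * inner ℝ (F ξ) (k ξ * conv A B ξ)‖ₑ
      ≤ ENNReal.ofReal ((prodConst d (s + τ)).toReal * α * a * β) := by
    have hf : Measurable (fun ξ => ENNReal.ofReal (jb ξ ^ s) * ‖F ξ‖ₑ) := by fun_prop
    calc _ ≤ ∫⁻ ξ, (ENNReal.ofReal (jb ξ ^ s) * ‖F ξ‖ₑ)
          * (ENNReal.ofReal (jb ξ ^ (s + τ)) * ‖conv A B ξ‖ₑ) :=
          lintegral_mono fun ξ => enorm_trunc_mul_inner_le hs hR ξ _ _ _ (hkb ξ)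
      _ ≤ prodConst d (s + τ) * nHs s (fun ξ => ‖F ξ‖ₑ) * nHs (s + τ) (fun ξ => ‖A ξ‖ₑ)
          * nHs (s + τ) (fun ξ => ‖B ξ‖ₑ) := lintegral_conv_le (by linarith) hf hA hB
      _ ≤ prodConst d (s + τ) * ENNReal.ofReal α * ENNReal.ofReal a * ENNReal.ofReal β := by
          gcongr
      _ = _ := by
          rw [ENNReal.ofReal_mul (by positivity), ENNReal.ofReal_mul (by positivity),
            ENNReal.ofReal_mul (by positivity), ENNReal.ofReal_toReal hC]
  have := integrable_and_abs_integral_le hm ENNReal.ofReal_ne_top hle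
  rwa [ENNReal.toReal_ofReal (by positivity)] at this

theorem inner_mul_bound {s R : ℝ} (hs : 0 ≤ s) (hR : 1 ≤ R) {F k G : Space d → ℂ}
    (hF : Measurable F) (hk : Measurable k) (hG : Measurable G) {α β : ℝ} (hα : 0 ≤ α)
    (hβ : 0 ≤ β) (hFn : nHs s (fun ξ => ‖F ξ‖ₑ) ≤ ENNReal.ofReal α)
    (hGn : nHs s (fun ξ => ‖k ξ * G ξ‖ₑ) ≤ ENNReal.ofReal β) :
    Integrable (fun ξ => trunc s R ξ * inner ℝ (F ξ) (k ξ * G ξ)) ∧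
      |∫ ξ, trunc s R ξ * inner ℝ (F ξ) (k ξ * G ξ)| ≤ α * β := by
  have hm : AEStronglyMeasurable (fun ξ => trunc s R ξ * inner ℝ (F ξ) (k ξ * G ξ)) :=
    (continuous_trunc hs).aestronglyMeasurable.mul (hF.aestronglyMeasurable.inner
      (hk.aestronglyMeasurable.mul hG.aestronglyMeasurable))
  have hle : ∫⁻ ξ, ‖trunc s R ξ * inner ℝ (F ξ) (k ξ * G ξ)‖ₑ ≤ ENNReal.ofReal (α * β) := by
    refine (lintegral_weight_le (s := s) hF.enorm (hk.mul hG).enorm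
      (Eventually.of_forall fun ξ => ?_)).trans ?_
    · have := enorm_trunc_mul_inner_le (τ := 0) hs hR ξ (F ξ) 1 (k ξ * G ξ) (by simp)
      simpa using this
    · rw [ENNReal.ofReal_mul hα]
      gcongr
      exact hGn
  have := integrable_and_abs_integral_le hm ENNReal.ofReal_ne_top hle
  rwa [ENNReal.toReal_ofReal (by positivity)] at this

theorem nHs_congr {s : ℝ} {f g : Space d → ENNReal} (h : f =ᵐ[volume] g) : nHs s f = nHs s g := by
  unfold nHs n2
  congr 1
  refine lintegral_congr_ae ?_
  filter_upwards [h] with ξ hξ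
  rw [hξ]

theorem nHs_ofReal_mul (s c : ℝ) (f : Space d → ENNReal) (hf : Measurable f) :
    nHs s (fun ξ => ENNReal.ofReal c * f ξ) = ENNReal.ofReal c * nHs s f := by
  unfold nHs n2
  have h : ∀ ξ : Space d, (ENNReal.ofReal (jb ξ ^ s) * (ENNReal.ofReal c * f ξ)) ^ (2 : ℝ)
      = ENNReal.ofReal c ^ (2 : ℝ) * (ENNReal.ofReal (jb ξ ^ s) * f ξ) ^ (2 : ℝ) := fun ξ => by
    rw [← ENNReal.mul_rpow_of_nonneg _ _ (by norm_num)]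
    ring_nf
  simp only [h]
  rw [lintegral_const_mul _ (by fun_prop), ENNReal.mul_rpow_of_nonneg _ _ (by norm_num),
    ← ENNReal.rpow_mul]
  norm_num

theorem nHs_jb_pow_mul (s : ℝ) (n : ℕ) (f : Space d → ENNReal) :
    nHs s (fun ξ => ENNReal.ofReal (jb ξ ^ n) * f ξ) = nHs (s + n) f := by
  unfold nHs
  congr 1
  ext ξ
  rw [← mul_assoc, ← ENNReal.ofReal_mul (Real.rpow_nonneg (jb_pos ξ).le _),
    Real.rpow_add_natCast (jb_pos ξ).ne']

/-- The bound of a Fourier multiplier of order `n`. -/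
theorem nHs_multiplier_le (s : ℝ) (n : ℕ) {c : ℝ} (hc : 0 ≤ c) {F G : Space d → ℂ}
    (hG : Measurable G) (h : ∀ ξ, ‖F ξ‖ ≤ c * jb ξ ^ n * ‖G ξ‖) :
    nHs s (fun ξ => ‖F ξ‖ₑ) ≤ ENNReal.ofReal c * nHs (s + n) (fun ξ => ‖G ξ‖ₑ) := by
  rw [← nHs_jb_pow_mul, ← nHs_ofReal_mul _ _ _ (by fun_prop)]
  refine n2_mono fun ξ => ?_
  gcongr
  beta_reduce
  rw [← ofReal_norm, ← ofReal_norm, ← mul_assoc, ← ENNReal.ofReal_mul hc,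
    ← ENNReal.ofReal_mul (by have := jb_pos ξ; positivity)]
  exact ENNReal.ofReal_le_ofReal (h ξ)

theorem Solid.memHs (b : Solid d) (s : ℝ) : MemHs s b.toL2 := by
  rw [memHs_iff]
  have h1 : MemLp (fun ξ => ((jb ξ ^ s : ℝ) : ℂ) * b.hat ξ) 2 := by
    have hg : (fun ξ : Space d =>
        (((1 + ‖(2 * Real.pi) • ξ‖ ^ 2) ^ (s / 2) : ℝ) : ℂ)).HasTemperateGrowth := by
      have h2 : (fun ξ : Space d => ((1 + ‖ξ‖ ^ 2) ^ (s / 2) : ℝ)).HasTemperateGrowth := by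
        fun_prop
      exact Complex.ofRealCLM.hasTemperateGrowth.comp
        (h2.comp ((2 * Real.pi) • ContinuousLinearMap.id ℝ (Space d)).hasTemperateGrowth)
    have := (SchwartzMap.smulLeftCLM ℂ
      (fun ξ : Space d => (((1 + ‖(2 * Real.pi) • ξ‖ ^ 2) ^ (s / 2) : ℝ) : ℂ)) b.hat).memLp 2
    refine this.ae_eq (Eventually.of_forall fun ξ => ?_)
    simp only [SchwartzMap.smulLeftCLM_apply_apply hg, smul_eq_mul]
    congr 2
    rw [jb, Real.sqrt_eq_rpow, ← Real.rpow_mul (by positivity), norm_smul, Real.norm_of_nonneg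
      (by positivity)]
    congr 1
    ring
  refine h1.ae_eq ?_
  filter_upwards [b.fourierL2_toL2] with ξ hξ
  rw [wfun, hξ]

/-- Translation multiplies the transform by a factor of modulus one, so no estimate depends on the
position of the solid. -/
theorem Solid.nHs_hat (b : Solid d) (s : ℝ) (Y : Space d) :
    nHs s (fun ξ => ‖(b.translate Y).hat ξ‖ₑ) = ENNReal.ofReal (hsNorm s b.toL2) := by
  rw [← (b.memHs s).nHs_eq]
  refine nHs_congr ?_
  filter_upwards [b.fourierL2_toL2] with ξ hξ
  rw [hξ, Solid.hat_translate, enorm_mul, ← ofReal_norm (shiftChar Y ξ), norm_shiftChar]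
  simp

theorem Solid.hsNorm_mono (b : Solid d) {s t : ℝ} (h : s ≤ t) :
    hsNorm s b.toL2 ≤ hsNorm t b.toL2 := BoussinesqSolid.hsNorm_mono h (b.memHs t)

theorem hsNorm_le_vec (s : ℝ) (V : Fin d → L2 d) (i : Fin d) : hsNorm s (V i) ≤ hsNormVec s V :=
  Real.le_sqrt_of_sq_le (Finset.single_le_sum (f := fun i => hsNorm s (V i) ^ 2)
    (fun _ _ => sq_nonneg _) (Finset.mem_univ i))

theorem hsNormVec_nonneg (s : ℝ) (V : Fin d → L2 d) : 0 ≤ hsNormVec s V := Real.sqrt_nonneg _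

theorem hsNormVec_sq (s : ℝ) (V : Fin d → L2 d) :
    hsNormVec s V ^ 2 = ∑ i, hsNorm s (V i) ^ 2 :=
  Real.sq_sqrt (Finset.sum_nonneg fun _ _ => sq_nonneg _)

end Estimates

/-! ### The rate of change of the fluid energy. -/

section EnergyRate

variable {d : ℕ}

/-- The symbol of `1 - (μ/3) Δ`. -/
def dispSym (μ : ℝ) (ξ : Space d) : ℝ := 1 + μ / 3 * (2 * Real.pi * ‖ξ‖) ^ 2

theorem one_le_dispSym {μ : ℝ} (hμ : 0 ≤ μ) (ξ : Space d) : 1 ≤ dispSym μ ξ := by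
  have : 0 ≤ μ / 3 * (2 * Real.pi * ‖ξ‖) ^ 2 := by positivity
  rw [dispSym]; linarith

theorem continuous_dispSym (μ : ℝ) : Continuous (dispSym (d := d) μ) := by
  unfold dispSym; fun_prop

/-- The symbol `2πi ξ·Z` of the derivative in the direction `Z`. -/
def dirSym (Z ξ : Space d) : ℂ := 2 * Real.pi * Complex.I * (inner ℝ ξ Z : ℝ)

theorem norm_dirSym_le (Z ξ : Space d) : ‖dirSym Z ξ‖ ≤ ‖Z‖ * jb ξ := by
  have h1 := abs_real_inner_le_norm ξ Z
  have h2 := two_pi_norm_le_jb ξ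
  have : ‖dirSym Z ξ‖ = 2 * Real.pi * |inner ℝ ξ Z| := by
    simp [dirSym, abs_of_pos Real.pi_pos]
  rw [this]
  calc 2 * Real.pi * |inner ℝ ξ Z| ≤ 2 * Real.pi * (‖ξ‖ * ‖Z‖) := by gcongr
    _ = (2 * Real.pi * ‖ξ‖) * ‖Z‖ := by ring
    _ ≤ jb ξ * ‖Z‖ := by gcongr
    _ = _ := mul_comm _ _

theorem measurable_dirSym (Z : Space d) : Measurable (dirSym Z) := by
  have : Continuous (dirSym Z) := by unfold dirSym; fun_prop
  exact this.measurable

/-- The correction `(1 - (μ/3) Δ)⁻¹ (-(μ/2) ∂_i ∂_Z b)` of the velocity, on the Fourier side. -/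
def correction (μ : ℝ) (b : Solid d) (Z : Space d) (i : Fin d) (ξ : Space d) : ℂ :=
  ((dispSym μ ξ)⁻¹ : ℝ) * (-(μ / 2) * (sym i ξ * dirSym Z ξ * b.hat ξ))

theorem measurable_correction (μ : ℝ) (b : Solid d) (Z : Space d) (i : Fin d) :
    Measurable (correction μ b Z i) := by
  have h1 : Measurable (fun ξ : Space d => (((dispSym μ ξ)⁻¹ : ℝ) : ℂ)) :=
    Complex.measurable_ofReal.comp (continuous_dispSym μ).measurable.inv
  exact h1.mul ((((measurable_sym i).mul (measurable_dirSym Z)).mul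
    b.hat.continuous.measurable).const_mul _)

theorem norm_correction_le {μ : ℝ} (hμ : 0 ≤ μ) (b : Solid d) (Z : Space d) (i : Fin d)
    (ξ : Space d) : ‖correction μ b Z i ξ‖ ≤ μ / 2 * ‖Z‖ * jb ξ ^ 2 * ‖b.hat ξ‖ := by
  have h1 := one_le_dispSym hμ ξ
  have h2 : (dispSym μ ξ)⁻¹ ≤ 1 := inv_le_one_of_one_le₀ h1
  have h3 := norm_sym_le i ξ
  have h4 := norm_dirSym_le Z ξ
  have hj := (jb_pos ξ).le
  have h5 : ‖(-(μ / 2) : ℂ)‖ = μ / 2 := by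
    rw [norm_neg, norm_div, Complex.norm_real, Real.norm_of_nonneg hμ, Complex.norm_ofNat]
  rw [correction, norm_mul, norm_mul, norm_mul, norm_mul, Complex.norm_real, h5,
    Real.norm_of_nonneg (inv_nonneg.2 (by linarith))]
  calc _ ≤ 1 * (μ / 2 * (jb ξ * (‖Z‖ * jb ξ) * ‖b.hat ξ‖)) := by gcongr
    _ = _ := by ring

/-- The symbol is purely imaginary, hence skew-adjoint: integration by parts at a single frequency.
-/
theorem inner_sym_mul (j : Fin d) (ξ : Space d) (x y : ℂ) :
    inner ℝ x (sym j ξ * y) = -inner ℝ y (sym j ξ * x) := by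
  simp only [Complex.inner, sym]
  simp
  ring

theorem inner_ofReal_mul (c : ℝ) (x y : ℂ) : inner ℝ x ((c : ℂ) * y) = c * inner ℝ x y := by
  rw [← Complex.real_smul, real_inner_smul_right]

/-- The constant of the transport estimate. -/
def transportConst (d : ℕ) (s : ℝ) : ℝ :=
  2 * Real.pi * ((1 + 2 * s) * 2 ^ s) * (3 * (embConst d s).toReal)

/-- By skew-adjointness the pairing of ζ with the divergence of V cancels that of V with ∇ζ,
frequency by frequency. What remains, in order: the transport of ζ, the flux of the bottom, the
source of the mass equation, ∇ζ against the correction, and advection against the velocity and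
against the correction. -/
theorem rate_pointwise (p : Params) (b : Solid d) (U : State d) (Z : Space d) (m : ℝ)
    (ξ : Space d) :
    m * inner ℝ (fourierL2 U.1 ξ) (-(∑ j, sym j ξ * flux p b U j ξ) - dirSym Z ξ * b.hat ξ)
      + ∑ i, m * inner ℝ (fourierL2 (U.2 i) ξ + correction p.μ b Z i ξ)
        (-(sym i ξ * fourierL2 U.1 ξ) - p.ε * advection U i ξ)
    = ∑ j, p.ε * (m * inner ℝ (fourierL2 U.1 ξ)
          (-sym j ξ * conv (fourierL2 U.1) (fourierL2 (U.2 j)) ξ))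
      + ∑ j, p.ε * (m * inner ℝ (fourierL2 U.1 ξ)
          (sym j ξ * conv b.hat (fourierL2 (U.2 j)) ξ))
      - m * inner ℝ (fourierL2 U.1 ξ) (dirSym Z ξ * b.hat ξ)
      + ∑ i, m * inner ℝ (fourierL2 U.1 ξ) (sym i ξ * correction p.μ b Z i ξ)
      - ∑ i, ∑ j, p.ε * (m * inner ℝ (fourierL2 (U.2 i) ξ) (1 *
          conv (fourierL2 (U.2 j)) (fun η => sym j η * fourierL2 (U.2 i) η) ξ))
      - ∑ i, ∑ j, p.ε * (m * inner ℝ (correction p.μ b Z i ξ) (1 *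
          conv (fourierL2 (U.2 j)) (fun η => sym j η * fourierL2 (U.2 i) η) ξ)) := by
  have e1 : inner ℝ (fourierL2 U.1 ξ)
      (-(∑ j, sym j ξ * flux p b U j ξ) - dirSym Z ξ * b.hat ξ)
      = -(∑ j, inner ℝ (fourierL2 U.1 ξ) (sym j ξ * fourierL2 (U.2 j) ξ))
        + (∑ j, p.ε * inner ℝ (fourierL2 U.1 ξ)
          (-sym j ξ * conv (fourierL2 U.1) (fourierL2 (U.2 j)) ξ))
        + (∑ j, p.ε * inner ℝ (fourierL2 U.1 ξ)
          (sym j ξ * conv b.hat (fourierL2 (U.2 j)) ξ))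
        - inner ℝ (fourierL2 U.1 ξ) (dirSym Z ξ * b.hat ξ) := by
    rw [inner_sub_right, inner_neg_right, inner_sum, ← Finset.sum_neg_distrib,
      ← Finset.sum_neg_distrib, ← Finset.sum_add_distrib, ← Finset.sum_add_distrib]
    congr 1
    refine Finset.sum_congr rfl fun j _ => ?_
    have : sym j ξ * flux p b U j ξ = sym j ξ * fourierL2 (U.2 j) ξ
        - p.ε * (-sym j ξ * conv (fourierL2 U.1) (fourierL2 (U.2 j)) ξ)
        - p.ε * (sym j ξ * conv b.hat (fourierL2 (U.2 j)) ξ) := by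
      rw [flux]; ring
    rw [this, inner_sub_right, inner_sub_right, inner_ofReal_mul, inner_ofReal_mul]
    ring
  have e2 : ∀ i, inner ℝ (fourierL2 (U.2 i) ξ + correction p.μ b Z i ξ)
        (-(sym i ξ * fourierL2 U.1 ξ) - p.ε * advection U i ξ)
      = inner ℝ (fourierL2 U.1 ξ) (sym i ξ * fourierL2 (U.2 i) ξ)
        + inner ℝ (fourierL2 U.1 ξ) (sym i ξ * correction p.μ b Z i ξ)
        - (∑ j, p.ε * inner ℝ (fourierL2 (U.2 i) ξ) (1 *
          conv (fourierL2 (U.2 j)) (fun η => sym j η * fourierL2 (U.2 i) η) ξ))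
        - ∑ j, p.ε * inner ℝ (correction p.μ b Z i ξ) (1 *
          conv (fourierL2 (U.2 j)) (fun η => sym j η * fourierL2 (U.2 i) η) ξ) := fun i => by
    rw [inner_sub_right, inner_neg_right, inner_ofReal_mul, inner_add_left, inner_add_left,
      inner_sym_mul, inner_sym_mul i ξ (correction p.μ b Z i ξ), advection, inner_sum, inner_sum]
    simp only [one_mul, ← Finset.mul_sum]
    ring
  rw [e1]
  simp only [e2]
  simp only [mul_add, mul_sub, mul_neg, Finset.mul_sum, Finset.sum_add_distrib,
    Finset.sum_sub_distrib, mul_left_comm m]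
  ring

theorem integral_combination {f₁ f₂ f₃ f₄ f₅ f₆ : Space d → ℝ} (h₁ : Integrable f₁)
    (h₂ : Integrable f₂) (h₃ : Integrable f₃) (h₄ : Integrable f₄) (h₅ : Integrable f₅)
    (h₆ : Integrable f₆) :
    ∫ ξ, (f₁ ξ + f₂ ξ - f₃ ξ + f₄ ξ - f₅ ξ - f₆ ξ) = (∫ ξ, f₁ ξ) + (∫ ξ, f₂ ξ) - (∫ ξ, f₃ ξ)
      + (∫ ξ, f₄ ξ) - (∫ ξ, f₅ ξ) - ∫ ξ, f₆ ξ := by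
  have e1 := integral_add h₁ h₂
  have e2 := integral_sub (h₁.add h₂) h₃
  have e3 := integral_add ((h₁.add h₂).sub h₃) h₄
  have e4 := integral_sub (((h₁.add h₂).sub h₃).add h₄) h₅
  have e5 := integral_sub ((((h₁.add h₂).sub h₃).add h₄).sub h₅) h₆
  simp only [Pi.add_apply, Pi.sub_apply] at e1 e2 e3 e4 e5
  rw [e5, e4, e3, e2, e1]

/-- Only the transport of ζ needs the commutator. Advection is bounded directly, since V has one
more derivative than ζ; the price, its `H^{s+1}` norm, is paid later with ε ≤ κμ. -/
theorem integral_rate_le {s R : ℝ} (hs : 1 ≤ s) (hds : (d : ℝ) / 2 < s) (hR : 1 ≤ R)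
    (p : Params) (b : Solid d) (Y Z : Space d) {U : State d} (hU : MemX s U) :
    ∫ ξ, (trunc s R ξ * inner ℝ (fourierL2 U.1 ξ)
        (-(∑ j, sym j ξ * flux p (b.translate Y) U j ξ) - dirSym Z ξ * (b.translate Y).hat ξ)
      + ∑ i, trunc s R ξ * inner ℝ (fourierL2 (U.2 i) ξ + correction p.μ (b.translate Y) Z i ξ)
        (-(sym i ξ * fourierL2 U.1 ξ) - p.ε * advection U i ξ))
    ≤ d * (p.ε * (transportConst d s * hsNorm s U.1 ^ 2 * hsNormVec (s + 1) U.2))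
      + d * (p.ε * ((prodConst d (s + 1)).toReal * hsNorm s U.1 * hsNorm (s + 3) b.toL2
          * hsNormVec (s + 1) U.2))
      + hsNorm s U.1 * (‖Z‖ * hsNorm (s + 3) b.toL2)
      + d * (hsNorm s U.1 * (p.μ / 2 * ‖Z‖ * hsNorm (s + 3) b.toL2))
      + d * (d * (p.ε * ((prodConst d s).toReal * hsNormVec s U.2 * hsNormVec s U.2
          * hsNormVec (s + 1) U.2)))
      + d * (d * (p.ε * ((prodConst d s).toReal * (p.μ / 2 * ‖Z‖ * hsNorm (s + 3) b.toL2)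
          * hsNormVec s U.2 * hsNormVec (s + 1) U.2))) := by
  set a := hsNorm s U.1 with ha
  set v0 := hsNormVec s U.2 with hv0
  set v1 := hsNormVec (s + 1) U.2 with hv1
  set β := hsNorm (s + 3) b.toL2 with hβ
  have ha0 : 0 ≤ a := hsNorm_nonneg _ _
  have hv00 : 0 ≤ v0 := hsNormVec_nonneg _ _
  have hv10 : 0 ≤ v1 := hsNormVec_nonneg _ _
  have hβ0 : 0 ≤ β := hsNorm_nonneg _ _
  have hs0 : 0 ≤ s := by linarith
  have hμ := p.μ_pos.le
  have hε := p.ε_pos.le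
  have mz := measurable_fourierL2 U.1
  have mv := fun i => measurable_fourierL2 (U.2 i)
  have mb : Measurable (b.translate Y).hat := (b.translate Y).hat.continuous.measurable
  have ms := fun i : Fin d => measurable_sym i
  have mc := fun i => measurable_correction p.μ (b.translate Y) Z i
  have nz : nHs s (fun ξ => ‖fourierL2 U.1 ξ‖ₑ) = ENNReal.ofReal a := hU.1.nHs_eq
  have nv0 : ∀ i, nHs s (fun ξ => ‖fourierL2 (U.2 i) ξ‖ₑ) ≤ ENNReal.ofReal v0 := fun i => by
    rw [(hU.2 i).1.nHs_eq]
    exact ENNReal.ofReal_le_ofReal (hsNorm_le_vec s U.2 i)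
  have nv1 : ∀ i, nHs (s + 1) (fun ξ => ‖fourierL2 (U.2 i) ξ‖ₑ) ≤ ENNReal.ofReal v1 := fun i => by
    rw [(hU.2 i).2.nHs_eq]
    exact ENNReal.ofReal_le_ofReal (hsNorm_le_vec (s + 1) U.2 i)
  have nb : ∀ τ ≤ 3, nHs (s + τ) (fun ξ => ‖(b.translate Y).hat ξ‖ₑ) ≤ ENNReal.ofReal β :=
    fun τ hτ => by
      rw [b.nHs_hat]
      exact ENNReal.ofReal_le_ofReal (b.hsNorm_mono (by linarith))
  have nc : ∀ i, nHs s (fun ξ => ‖correction p.μ (b.translate Y) Z i ξ‖ₑ)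
      ≤ ENNReal.ofReal (p.μ / 2 * ‖Z‖ * β) := fun i => by
    refine (nHs_multiplier_le s 2 (by positivity) mb (norm_correction_le hμ _ Z i)).trans ?_
    rw [ENNReal.ofReal_mul (q := β) (by positivity)]
    gcongr
    exact nb _ (by norm_num)
  -- This is where three derivatives fall on the profile: two are in the correction and one comes
  -- from ∇ζ. The inverse of 1 - (μ/3)Δ is used only as a contraction.
  have nsc : ∀ i, nHs s (fun ξ => ‖sym i ξ * correction p.μ (b.translate Y) Z i ξ‖ₑ)
      ≤ ENNReal.ofReal (p.μ / 2 * ‖Z‖ * β) := fun i => by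
    refine (nHs_multiplier_le s 3 (c := p.μ / 2 * ‖Z‖) (by positivity) mb fun ξ => ?_).trans ?_
    · rw [norm_mul]
      calc _ ≤ jb ξ * (p.μ / 2 * ‖Z‖ * jb ξ ^ 2 * ‖(b.translate Y).hat ξ‖) := by
            gcongr
            · exact (jb_pos ξ).le
            · exact norm_sym_le i ξ
            · exact norm_correction_le hμ _ Z i ξ
        _ = _ := by ring
    · rw [ENNReal.ofReal_mul (q := β) (by positivity)]
      gcongr
      exact nb _ (by norm_num)
  have nd : nHs s (fun ξ => ‖dirSym Z ξ * (b.translate Y).hat ξ‖ₑ)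
      ≤ ENNReal.ofReal (‖Z‖ * β) := by
    refine (nHs_multiplier_le s 1 (c := ‖Z‖) (by positivity) mb fun ξ => ?_).trans ?_
    · rw [norm_mul, pow_one]
      gcongr
      exact norm_dirSym_le Z ξ
    · rw [ENNReal.ofReal_mul (q := β) (by positivity)]
      gcongr
      exact nb _ (by norm_num)
  have nsv : ∀ i j, nHs s (fun ξ => ‖sym j ξ * fourierL2 (U.2 i) ξ‖ₑ) ≤ ENNReal.ofReal v1 :=
    fun i j => (nHs_sym_mul_le s j _).trans (nv1 i)
  have b1 : ∀ j, Integrable (fun ξ => trunc s R ξ * inner ℝ (fourierL2 U.1 ξ)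
        (-sym j ξ * conv (fourierL2 U.1) (fourierL2 (U.2 j)) ξ)) ∧
      |∫ ξ, trunc s R ξ * inner ℝ (fourierL2 U.1 ξ)
        (-sym j ξ * conv (fourierL2 U.1) (fourierL2 (U.2 j)) ξ)|
      ≤ transportConst d s * a ^ 2 * v1 := fun j => by
    obtain ⟨h1, h2⟩ := transport_bound hs hds hR mz (mv j) (fourierL2_neg_ae (U.2 j))
      hU.1.nHs_ne_top (hU.2 j).2.nHs_ne_top j
    refine ⟨h1, h2.trans ?_⟩
    rw [nz, (hU.2 j).2.nHs_eq]
    have hE := (embConst d s).toReal_nonneg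
    simp only [ENNReal.toReal_mul, ENNReal.toReal_pow, ENNReal.toReal_ofNat]
    rw [ENNReal.toReal_ofReal (by positivity), ENNReal.toReal_ofReal ha0,
      ENNReal.toReal_ofReal (hsNorm_nonneg _ _), transportConst]
    have := hsNorm_le_vec (s + 1) U.2 j
    calc _ = 2 * Real.pi * ((1 + 2 * s) * 2 ^ s) * (3 * (embConst d s).toReal) * a ^ 2
          * hsNorm (s + 1) (U.2 j) := by ring
      _ ≤ _ := by gcongr
  have b2 : ∀ j, _ := fun j => inner_conv_bound (τ := 1) hs0 zero_le_one hds hR mz (ms j)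
    (fun ξ => by rw [Real.rpow_one]; exact norm_sym_le j ξ) mb (mv j) hβ0 hv10 nz.le
    (nb 1 (by norm_num)) (nv1 j) ha0
  have b3 := inner_mul_bound hs0 hR mz (measurable_dirSym Z) mb ha0 (by positivity) nz.le nd
  have b4 : ∀ i, _ := fun i => inner_mul_bound hs0 hR mz (ms i) (mc i) ha0
    (by positivity) nz.le (nsc i)
  have b5 : ∀ i j, _ := fun i j => inner_conv_bound (τ := 0) (k := fun _ => 1)
    (B := fun η => sym j η * fourierL2 (U.2 i) η) hs0 le_rfl hds hR
    (mv i) measurable_const (fun ξ => by simp) (mv j) ((ms j).mul (mv i)) hv00 hv10 (nv0 i)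
    (by rw [add_zero]; exact nv0 j) (by rw [add_zero]; exact nsv i j) hv00
  have b6 : ∀ i j, _ := fun i j => inner_conv_bound (τ := 0) (k := fun _ => 1)
    (B := fun η => sym j η * fourierL2 (U.2 i) η) hs0 le_rfl hds hR
    (mc i) measurable_const (fun ξ => by simp) (mv j) ((ms j).mul (mv i)) hv00 hv10 (nc i)
    (by rw [add_zero]; exact nv0 j) (by rw [add_zero]; exact nsv i j) (by positivity)
  simp only [rate_pointwise]
  have i1 := integrable_finsetSum (μ := volume) Finset.univ fun j _ => (b1 j).1.const_mul p.ε
  have i2 := integrable_finsetSum (μ := volume) Finset.univ fun j _ => (b2 j).1.const_mul p.ε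
  have i4 := integrable_finsetSum (μ := volume) Finset.univ fun j _ => (b4 j).1
  have i5 := integrable_finsetSum (μ := volume) Finset.univ fun i _ =>
    integrable_finsetSum (μ := volume) Finset.univ fun j _ => (b5 i j).1.const_mul p.ε
  have i6 := integrable_finsetSum (μ := volume) Finset.univ fun i _ =>
    integrable_finsetSum (μ := volume) Finset.univ fun j _ => (b6 i j).1.const_mul p.ε
  rw [integral_combination i1 i2 b3.1 i4 i5 i6]
  have sumle : ∀ (f : Fin d → ℝ) (c : ℝ), (∀ j, |f j| ≤ c) → |∑ j, f j| ≤ d * c := by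
    intro f c h
    refine (Finset.abs_sum_le_sum_abs _ _).trans ((Finset.sum_le_sum fun j _ => h j).trans_eq ?_)
    simp
  rw [integral_finsetSum _ fun j _ => (b1 j).1.const_mul p.ε,
    integral_finsetSum _ fun j _ => (b2 j).1.const_mul p.ε,
    integral_finsetSum _ fun j _ => (b4 j).1,
    integral_finsetSum _ fun i _ => integrable_finsetSum _ fun j _ => (b5 i j).1.const_mul p.ε,
    integral_finsetSum _ fun i _ => integrable_finsetSum _ fun j _ => (b6 i j).1.const_mul p.ε]
  simp only [fun i => integral_finsetSum (μ := volume) Finset.univ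
      fun j _ => (b5 i j).1.const_mul p.ε,
    fun i => integral_finsetSum (μ := volume) Finset.univ fun j _ => (b6 i j).1.const_mul p.ε,
    integral_const_mul]
  have emul : ∀ x c : ℝ, |x| ≤ c → |p.ε * x| ≤ p.ε * c := fun x c h => by
    rw [abs_mul, abs_of_nonneg hε]; gcongr
  have r1 := sumle _ _ fun j => emul _ _ (b1 j).2
  have r2 := sumle _ _ fun j => emul _ _ (b2 j).2
  have r4 := sumle _ _ fun j => (b4 j).2
  have r5 := sumle _ _ fun i => sumle _ _ fun j => emul _ _ (b5 i j).2
  have r6 := sumle _ _ fun i => sumle _ _ fun j => emul _ _ (b6 i j).2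
  simp only [add_zero] at r5 r6
  have r3 := b3.2
  rw [abs_le] at r1 r2 r3 r4 r5 r6
  linarith [r1.2, r2.2, r3.1, r4.2, r5.1, r6.1]

end EnergyRate

/-! ### Friction and fluid pressure on the solid. -/

section Friction

variable {d : ℕ}

/-- Cauchy–Schwarz on the Fourier side; the derivative of the profile costs one power of ⟨2πξ⟩. It
controls the power of the pressure force. -/
theorem abs_integral_mul_lineDeriv_le (ζ : L2 d) {s : ℝ} (hs : 0 ≤ s) (hζ : MemHs s ζ)
    (b : Solid d) (Y Z : Space d) :
    |∫ x, ζ x * (∂_{Z} (b.translate Y).schwartz) x|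
      ≤ hsNorm s ζ * (‖Z‖ * hsNorm (s + 3) b.toL2) := by
  set φ : 𝓢(Space d, ℝ) := ∂_{Z} (b.translate Y).schwartz with hφ
  have h1 := ofReal_integral_mul ζ φ
  have mb : Measurable (b.translate Y).hat := (b.translate Y).hat.continuous.measurable
  have hn : n2 (fun ξ => ‖𝓕⁻ (toComplex φ) ξ‖ₑ) ≤ ENNReal.ofReal (‖Z‖ * hsNorm (s + 3) b.toL2) := by
    have e1 : n2 (fun ξ => ‖𝓕⁻ (toComplex φ) ξ‖ₑ) = n2 (fun ξ => ‖𝓕 (toComplex φ) ξ‖ₑ) := by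
      have : ∀ ξ, 𝓕⁻ (toComplex φ) ξ = 𝓕 (toComplex φ) (-ξ) := fun ξ => by
        rw [SchwartzMap.fourierInv_coe, SchwartzMap.fourier_coe, Real.fourierInv_eq_fourier_neg]
      simp only [this]
      rw [n2, n2]
      congr 1
      exact lintegral_neg_eq_self (fun ξ => ‖𝓕 (toComplex φ) ξ‖ₑ ^ (2 : ℝ))
    rw [e1, ← nHs_zero]
    refine (nHs_multiplier_le 0 1 (c := ‖Z‖) (norm_nonneg Z) mb fun ξ => ?_).trans ?_
    · rw [hφ, fourier_lineDeriv_toComplex, norm_mul, pow_one]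
      exact mul_le_mul_of_nonneg_right (norm_dirSym_le Z ξ) (norm_nonneg _)
    · rw [b.nHs_hat, ENNReal.ofReal_mul (norm_nonneg _)]
      gcongr
      exact b.hsNorm_mono (by push_cast; linarith)
  have hz : n2 (fun ξ => ‖fourierL2 ζ ξ‖ₑ) ≤ ENNReal.ofReal (hsNorm s ζ) := by
    rw [← nHs_zero, ← hζ.nHs_eq]
    exact nHs_mono hs _
  have h2 : ‖∫ ξ, fourierL2 ζ ξ * 𝓕⁻ (toComplex φ) ξ‖ₑ
      ≤ ENNReal.ofReal (hsNorm s ζ * (‖Z‖ * hsNorm (s + 3) b.toL2)) := by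
    refine (enorm_integral_le_lintegral_enorm _).trans ?_
    simp only [enorm_mul]
    refine (lintegral_mul_le_n2 (measurable_fourierL2 ζ).enorm
      (𝓕⁻ (toComplex φ)).continuous.measurable.enorm).trans ?_
    rw [ENNReal.ofReal_mul (hsNorm_nonneg _ _)]
    gcongr
  have h3 := norm_le_toReal_of_enorm_le ENNReal.ofReal_ne_top h2
  rw [← h1, Complex.norm_real, Real.norm_eq_abs, ENNReal.toReal_ofReal (mul_nonneg
    (hsNorm_nonneg _ _) (mul_nonneg (norm_nonneg _) (hsNorm_nonneg _ _)))] at h3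
  exact h3

theorem inner_integral_gradient (ζ : L2 d) (b : Solid d) (Y Z : Space d) :
    inner ℝ Z (∫ x, ζ x • gradient b.shape (x - Y))
      = ∫ x, ζ x * (∂_{Z} (b.translate Y).schwartz) x := by
  have hcont : Continuous (gradient b.shape) := by
    have : gradient b.shape = fun x => (InnerProductSpace.toDual ℝ (Space d)).symm
      (fderiv ℝ b.shape x) := rfl
    rw [this]
    exact (LinearIsometryEquiv.continuous _).comp (b.smooth.continuous_fderiv (by simp))
  have hsupp : HasCompactSupport (gradient b.shape) :=
    b.compact.fderiv (𝕜 := ℝ) |>.comp_left (map_zero (InnerProductSpace.toDual ℝ (Space d)).symm)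
  have hm : MemLp (fun x => gradient b.shape (x - Y)) 2 :=
    (hcont.comp (continuous_id.sub continuous_const)).memLp_of_hasCompactSupport
      (hsupp.comp_homeomorph (Homeomorph.subRight Y))
  have hi : Integrable (fun x => ζ x • gradient b.shape (x - Y)) :=
    memLp_one_iff_integrable.1 (hm.smul (Lp.memLp ζ))
  rw [← integral_inner hi]
  refine integral_congr_ae (Eventually.of_forall fun x => ?_)
  simp only
  rw [real_inner_smul_right, real_inner_comm, b.inner_gradient]

/-- The coefficient equals 1 plus an atmospheric term plus the integral of the water height over the
displaced support, divided by Mε: the constant of the solid is designed so that the integral of ζ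
completes that of the height. -/
theorem friction_coefficient_nonneg (p : Params) (b : Solid d) (ζ : L2 d) (Y : Space d)
    (h : ∀ᵐ x, 0 ≤ height p b ζ Y x) :
    0 ≤ 1 / p.ε * solidConst p b
        + 1 / p.M * ∫ x in (fun y => y + Y) '' tsupport b.shape, ζ x := by
  set S := (fun y => y + Y) '' tsupport b.shape with hS
  have hSeq : S = (fun x => x - Y) ⁻¹' tsupport b.shape := by
    ext x
    simp only [hS, mem_image, mem_preimage]
    exact ⟨by rintro ⟨y, hy, rfl⟩; simpa using hy, fun hx => ⟨x - Y, hx, by simp⟩⟩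
  have hc : IsCompact S := b.compact.isCompact.image (by fun_prop)
  have hms : MeasurableSet S := hc.measurableSet
  have hvol : volume S = volume (tsupport b.shape) := by
    rw [hSeq]
    exact (measurePreserving_sub_right volume Y).measure_preimage
      b.compact.isCompact.measurableSet.nullMeasurableSet
  have : IsFiniteMeasure (volume.restrict S) := ⟨by simpa using hc.measure_lt_top⟩
  have hζ : Integrable ζ (volume.restrict S) :=
    ((Lp.memLp ζ).restrict S).integrable one_le_two
  have hbc : Continuous (fun x => b.shape (x - Y)) :=
    b.smooth.continuous.comp (continuous_id.sub continuous_const)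
  have hb : Integrable (fun x => b.shape (x - Y)) (volume.restrict S) :=
    hbc.continuousOn.integrableOn_compact hc
  have hbint : ∫ x in S, b.shape (x - Y) = ∫ x, b.shape x := by
    rw [← integral_sub_right_eq_self b.shape Y]
    refine setIntegral_eq_integral_of_forall_compl_eq_zero fun x hx => ?_
    rw [hSeq, mem_preimage] at hx
    exact image_eq_zero_of_notMem_tsupport hx
  have hh : ∫ x in S, height p b ζ Y x
      = (volume (tsupport b.shape)).toReal + p.ε * ((∫ x in S, ζ x) - ∫ x, b.shape x) := by
    unfold height
    have i1 : Integrable (fun x => p.ε * (ζ x - b.shape (x - Y))) (volume.restrict S) :=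
      (hζ.sub hb).const_mul _
    rw [integral_add (integrable_const _) i1, integral_const_mul, integral_sub hζ hb, hbint]
    simp [Measure.real, hvol]
  have hpos : 0 ≤ ∫ x in S, height p b ζ Y x :=
    integral_nonneg_of_ae (ae_restrict_of_ae h)
  rw [hh] at hpos
  have hε := p.ε_pos
  have hM := p.M_pos
  have : 1 / p.ε * solidConst p b + 1 / p.M * ∫ x in S, ζ x
      = 1 + (volume (tsupport b.shape)).toReal * p.patm / (p.M * p.ε)
        + ((volume (tsupport b.shape)).toReal
          + p.ε * ((∫ x in S, ζ x) - ∫ x, b.shape x)) / (p.M * p.ε) := by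
    rw [solidConst]
    field_simp
    ring
  rw [this]
  have := p.patm_nonneg
  positivity

/-- The power of the forces acting on the solid: friction dissipates energy. -/
theorem inner_solidForce_le (p : Params) (b : Solid d) {ζ : L2 d} {s : ℝ} (hs : 0 ≤ s)
    (hζ : MemHs s ζ) (Y Z : Space d) (h : ∀ᵐ x, 0 ≤ height p b ζ Y x) :
    inner ℝ Z (solidForce p b ζ Y Z) / p.ε
      ≤ p.M⁻¹ * (hsNorm s ζ * (‖Z‖ * hsNorm (s + 3) b.toL2)) := by
  have h1 := friction_coefficient_nonneg p b ζ Y h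
  have h2 := abs_integral_mul_lineDeriv_le ζ hs hζ b Y Z
  have hε := p.ε_pos
  have hM := p.M_pos
  have hμ := p.μ_pos
  have hc := p.cfric_pos
  have hδ := p.δ_pos
  rw [solidForce, inner_add_right, inner_neg_right, real_inner_smul_right, real_inner_smul_right,
    real_inner_smul_right, inner_integral_gradient, real_inner_self_eq_norm_sq]
  set F := 1 / p.ε * solidConst p b
        + 1 / p.M * ∫ x in (fun y => y + Y) '' tsupport b.shape, ζ x
  set I := ∫ x, ζ x * (∂_{Z} (b.translate Y).schwartz) x
  -- The power of friction is minus this quantity and is discarded; hence neither the friction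
  -- coefficient nor the factor 1/√μ reaches the final constant.
  have h3 : 0 ≤ p.cfric / √p.μ * F * (1 / (‖Z‖ + p.δ) * ‖Z‖ ^ 2) := by
    have := norm_nonneg Z
    positivity
  have h4 : (-(p.cfric / √p.μ * F * (1 / (‖Z‖ + p.δ) * ‖Z‖ ^ 2)) + p.ε / p.M * I) / p.ε
      ≤ p.M⁻¹ * I := by
    rw [div_le_iff₀ hε]
    have : p.M⁻¹ * I * p.ε = p.ε / p.M * I := by field_simp
    linarith
  refine h4.trans ?_
  gcongr
  exact (le_abs_self I).trans h2

end Friction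

/-! ### First order expansion in time of the moving bottom. -/

section TimeDerivative

variable {d : ℕ}

/-- For |x| ≤ 1 this is the Taylor remainder; for larger x both the increment of the exponential and
its linear part are at most |x| ≤ x². No restriction on x is allowed, since x grows with the
frequency. -/
theorem norm_exp_mul_I_sub_le (x : ℝ) :
    ‖Complex.exp (x * Complex.I) - 1 - x * Complex.I‖ ≤ 2 * x ^ 2 := by
  have hx : ‖(x : ℂ) * Complex.I‖ = |x| := by simp
  rcases le_total |x| 1 with h | h
  · refine (Complex.norm_exp_sub_one_sub_id_le (by rw [hx]; exact h)).trans ?_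
    rw [hx, sq_abs]
    nlinarith [sq_nonneg x]
  · refine (norm_sub_le _ _).trans ?_
    have h1 : ‖Complex.exp (x * Complex.I) - 1‖ ≤ |x| := by
      have := Real.norm_exp_I_mul_ofReal_sub_one_le (x := x)
      rwa [mul_comm, Real.norm_eq_abs] at this
    rw [hx]
    nlinarith [sq_abs x]

theorem shiftChar_sub_le (Y Y' ξ : Space d) :
    ‖shiftChar Y' ξ - shiftChar Y ξ + dirSym (Y' - Y) ξ * shiftChar Y ξ‖
      ≤ 2 * (‖Y' - Y‖ * jb ξ) ^ 2 := by
  set x : ℝ := -(2 * Real.pi * inner ℝ ξ (Y' - Y)) with hx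
  have e1 : shiftChar Y' ξ = Complex.exp (x * Complex.I) * shiftChar Y ξ := by
    rw [shiftChar, shiftChar, ← Complex.exp_add, hx, inner_sub_right]
    congr 1
    push_cast
    ring
  have e2 : dirSym (Y' - Y) ξ = -(x * Complex.I) := by
    rw [dirSym, hx]; push_cast; ring
  have e3 : shiftChar Y' ξ - shiftChar Y ξ + dirSym (Y' - Y) ξ * shiftChar Y ξ
      = (Complex.exp (x * Complex.I) - 1 - x * Complex.I) * shiftChar Y ξ := by
    rw [e1, e2]; ring
  rw [e3, norm_mul, norm_shiftChar, mul_one]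
  refine (norm_exp_mul_I_sub_le x).trans ?_
  have h2 : |x| ≤ ‖Y' - Y‖ * jb ξ := by
    have := norm_dirSym_le (Y' - Y) ξ
    rwa [e2, norm_neg, norm_mul, Complex.norm_I, mul_one, Complex.norm_real,
      Real.norm_eq_abs] at this
  rw [← sq_abs x]
  gcongr

theorem dirSym_sub (Y Z ξ : Space d) : dirSym (Y - Z) ξ = dirSym Y ξ - dirSym Z ξ := by
  simp only [dirSym, inner_sub_right]; push_cast; ring

theorem dirSym_smul (c : ℝ) (Z ξ : Space d) : dirSym (c • Z) ξ = c * dirSym Z ξ := by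
  simp only [dirSym, real_inner_smul_right]; push_cast; ring

/-- The remainder of the first order expansion of the bottom source on the Fourier side. -/
theorem source_remainder_le (Y Z A Y' Z' ξ : Space d) (h : ℝ) :
    ‖dirSym Z' ξ * shiftChar Y' ξ - dirSym Z ξ * shiftChar Y ξ
        - h * ((dirSym A ξ - dirSym Z ξ ^ 2) * shiftChar Y ξ)‖
      ≤ (‖Z' - Z - h • A‖ + 2 * ‖Z'‖ * ‖Y' - Y‖ ^ 2 + ‖Z'‖ * ‖Y' - Y - h • Z‖
        + |h| * ‖Z' - Z‖ * ‖Z‖) * jb ξ ^ 3 := by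
  have hj := one_le_jb ξ
  have hj0 := (jb_pos ξ).le
  have e : dirSym Z' ξ * shiftChar Y' ξ - dirSym Z ξ * shiftChar Y ξ
        - h * ((dirSym A ξ - dirSym Z ξ ^ 2) * shiftChar Y ξ)
      = dirSym (Z' - Z - h • A) ξ * shiftChar Y ξ
        + dirSym Z' ξ * (shiftChar Y' ξ - shiftChar Y ξ + dirSym (Y' - Y) ξ * shiftChar Y ξ)
        - dirSym Z' ξ * dirSym (Y' - Y - h • Z) ξ * shiftChar Y ξ
        - h * dirSym (Z' - Z) ξ * dirSym Z ξ * shiftChar Y ξ := by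
    simp only [dirSym_sub, dirSym_smul]
    ring
  rw [e]
  have b1 : ‖dirSym (Z' - Z - h • A) ξ * shiftChar Y ξ‖ ≤ ‖Z' - Z - h • A‖ * jb ξ ^ 3 := by
    rw [norm_mul, norm_shiftChar, mul_one]
    refine (norm_dirSym_le _ ξ).trans ?_
    gcongr
    exact le_self_pow₀ hj (by norm_num)
  have b2 : ‖dirSym Z' ξ * (shiftChar Y' ξ - shiftChar Y ξ
      + dirSym (Y' - Y) ξ * shiftChar Y ξ)‖ ≤ 2 * ‖Z'‖ * ‖Y' - Y‖ ^ 2 * jb ξ ^ 3 := by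
    rw [norm_mul]
    calc _ ≤ (‖Z'‖ * jb ξ) * (2 * (‖Y' - Y‖ * jb ξ) ^ 2) := by
          gcongr
          · exact norm_dirSym_le _ ξ
          · exact shiftChar_sub_le Y Y' ξ
      _ = _ := by ring
  have b3 : ‖dirSym Z' ξ * dirSym (Y' - Y - h • Z) ξ * shiftChar Y ξ‖
      ≤ ‖Z'‖ * ‖Y' - Y - h • Z‖ * jb ξ ^ 3 := by
    rw [norm_mul, norm_mul, norm_shiftChar, mul_one]
    calc _ ≤ (‖Z'‖ * jb ξ) * (‖Y' - Y - h • Z‖ * jb ξ) := by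
          gcongr <;> exact norm_dirSym_le _ ξ
      _ = ‖Z'‖ * ‖Y' - Y - h • Z‖ * jb ξ ^ 2 := by ring
      _ ≤ _ := by
          gcongr
          norm_num
  have b4 : ‖(h : ℂ) * dirSym (Z' - Z) ξ * dirSym Z ξ * shiftChar Y ξ‖
      ≤ |h| * ‖Z' - Z‖ * ‖Z‖ * jb ξ ^ 3 := by
    rw [norm_mul, norm_mul, norm_mul, norm_shiftChar, mul_one, Complex.norm_real, Real.norm_eq_abs]
    calc _ ≤ |h| * (‖Z' - Z‖ * jb ξ) * (‖Z‖ * jb ξ) := by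
          gcongr <;> exact norm_dirSym_le _ ξ
      _ = |h| * ‖Z' - Z‖ * ‖Z‖ * jb ξ ^ 2 := by ring
      _ ≤ _ := by
          gcongr
          norm_num
  refine (norm_sub_le _ _).trans ?_
  refine (add_le_add ((norm_sub_le _ _).trans (add_le_add ((norm_add_le _ _).trans
    (add_le_add b1 b2)) b3)) b4).trans_eq ?_
  ring

/-- A curve of `L²` functions is differentiable when the remainder of its pointwise first order
expansion is dominated. -/
theorem hasDerivWithinAt_toLp {F : ℝ → Space d → ℂ} (hF : ∀ r, MemLp (F r) 2)
    {F' H : Space d → ℂ} (hF' : MemLp F' 2) (hH : MemLp H 2) {S : Set ℝ} {t : ℝ} {θ : ℝ → ℝ}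
    (hθ : θ =o[𝓝[S] t] fun r => r - t)
    (h : ∀ r ξ, ‖F r ξ - F t ξ - (r - t : ℝ) * F' ξ‖ ≤ |θ r| * ‖H ξ‖) :
    HasDerivWithinAt (fun r => (hF r).toLp) hF'.toLp S t := by
  rw [hasDerivWithinAt_iff_isLittleO]
  have h1 : (fun r => (hF r).toLp - (hF t).toLp - (r - t) • hF'.toLp)
      =O[𝓝[S] t] θ := by
    refine Asymptotics.IsBigO.of_bound ‖hH.toLp‖ (Eventually.of_forall fun r => ?_)
    rw [mul_comm, Real.norm_eq_abs]
    refine Lp.norm_le_mul_norm_of_ae_le_mul ?_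
    filter_upwards [Lp.coeFn_sub ((hF r).toLp - (hF t).toLp) ((r - t) • hF'.toLp),
      Lp.coeFn_sub (hF r).toLp (hF t).toLp, Lp.coeFn_smul (r - t) hF'.toLp,
      (hF r).coeFn_toLp, (hF t).coeFn_toLp, hF'.coeFn_toLp, hH.coeFn_toLp]
      with ξ e1 e2 e3 e4 e5 e6 e7
    rw [e1, Pi.sub_apply, e2, Pi.sub_apply, e3, Pi.smul_apply, e4, e5, e6, e7,
      Complex.real_smul]
    exact h r ξ
  exact h1.trans_isLittleO hθ

end TimeDerivative

/-! ### The weights of the truncated energy. -/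

section Weights

variable {d : ℕ}

theorem sqrt_jb_rpow (s : ℝ) (ξ : Space d) : √(jb ξ ^ (2 * s)) = jb ξ ^ s := by
  rw [mul_comm, Real.rpow_mul (jb_pos ξ).le, Real.rpow_two, Real.sqrt_sq
    (Real.rpow_nonneg (jb_pos ξ).le _)]

theorem sqrt_trunc_le_rpow {s R : ℝ} (hs : 0 ≤ s) (hR : 1 ≤ R) (ξ : Space d) :
    √(trunc s R ξ) ≤ jb ξ ^ s := by
  rw [← sqrt_jb_rpow]
  exact Real.sqrt_le_sqrt (trunc_le_rpow hs hR ξ)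

theorem abs_sqrt_trunc_le {s R : ℝ} (hs : 1 ≤ s) (hR : 1 ≤ R) (ξ : Space d) :
    |√(trunc s R ξ)| ≤ √(R ^ (2 * s)) * jb ξ ^ (s - 1) := by
  rw [abs_of_nonneg (Real.sqrt_nonneg _)]
  refine (Real.sqrt_le_sqrt (trunc_le_const (by linarith) hR ξ)).trans ?_
  exact le_mul_of_one_le_right (Real.sqrt_nonneg _)
    (Real.one_le_rpow (one_le_jb ξ) (by linarith))

theorem sqrt_dispSym_le {μ : ℝ} (hμ : 0 ≤ μ) (ξ : Space d) : √(dispSym μ ξ) ≤ (1 + μ) * jb ξ := by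
  have hj := (jb_pos ξ).le
  refine Real.sqrt_le_iff.2 ⟨by positivity, ?_⟩
  rw [mul_pow, sq_jb, dispSym]
  nlinarith [sq_nonneg (2 * Real.pi * ‖ξ‖), mul_nonneg hμ (sq_nonneg (2 * Real.pi * ‖ξ‖)),
    mul_nonneg (mul_nonneg hμ hμ) (sq_nonneg (2 * Real.pi * ‖ξ‖))]

/-- The weight of the energy of the velocity. -/
def dispWeight (μ s R : ℝ) (ξ : Space d) : ℝ := √(trunc s R ξ) * √(dispSym μ ξ)

theorem dispWeight_nonneg (μ s R : ℝ) (ξ : Space d) : 0 ≤ dispWeight μ s R ξ :=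
  mul_nonneg (Real.sqrt_nonneg _) (Real.sqrt_nonneg _)

theorem dispWeight_sq {μ s R : ℝ} (hμ : 0 ≤ μ) (hR : 1 ≤ R) (ξ : Space d) :
    dispWeight μ s R ξ ^ 2 = trunc s R ξ * dispSym μ ξ := by
  rw [dispWeight, mul_pow, Real.sq_sqrt (trunc_nonneg hR ξ),
    Real.sq_sqrt (by linarith [one_le_dispSym hμ ξ])]

theorem measurable_sqrt_trunc {s R : ℝ} (hs : 0 ≤ s) :
    Measurable (fun ξ : Space d => √(trunc s R ξ)) :=
  (continuous_trunc hs).sqrt.measurable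

theorem measurable_dispWeight (μ : ℝ) {s R : ℝ} (hs : 0 ≤ s) :
    Measurable (dispWeight (d := d) μ s R) :=
  (measurable_sqrt_trunc hs).mul (continuous_dispSym μ).sqrt.measurable

theorem abs_dispWeight_le {μ s R : ℝ} (hμ : 0 ≤ μ) (hs : 0 ≤ s) (hR : 1 ≤ R) (ξ : Space d) :
    |dispWeight μ s R ξ| ≤ √(R ^ (2 * s)) * (1 + μ) * jb ξ := by
  rw [abs_of_nonneg (dispWeight_nonneg μ s R ξ), dispWeight, mul_assoc]
  gcongr
  · exact trunc_le_const hs hR ξ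
  · exact sqrt_dispSym_le hμ ξ

theorem abs_dispWeight_le_rpow {μ s R : ℝ} (hμ : 0 ≤ μ) (hs : 1 ≤ s) (hR : 1 ≤ R) (ξ : Space d) :
    |dispWeight μ s R ξ| ≤ √(R ^ (2 * s)) * (1 + μ) * jb ξ ^ s := by
  refine (abs_dispWeight_le hμ (by linarith) hR ξ).trans ?_
  gcongr
  exact Real.self_le_rpow_of_one_le (one_le_jb ξ) hs

end Weights

/-! ### Differentiability in time of the velocity correction. -/

section CorrectionCurve

variable {d : ℕ}

theorem Solid.memLp_hat (b : Solid d) (n : ℕ) :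
    MemLp (fun ξ => ((jb ξ ^ n : ℝ) : ℂ) * b.hat ξ) 2 := by
  refine ((memHs_iff n b.toL2).1 (b.memHs n)).ae_eq ?_
  filter_upwards [b.fourierL2_toL2] with ξ h
  rw [wfun, h, Real.rpow_natCast]

/-- The time derivative of the correction of the velocity, for a solid with displacement `Y`,
velocity `Z` and acceleration `A`. -/
def correctionRate (μ : ℝ) (b : Solid d) (Y Z A : Space d) (i : Fin d) (ξ : Space d) : ℂ :=
  ((dispSym μ ξ)⁻¹ : ℝ) * (-(μ / 2) * (sym i ξ *
    ((dirSym A ξ - dirSym Z ξ ^ 2) * shiftChar Y ξ * b.hat ξ)))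

theorem norm_disp_source_le {μ : ℝ} (hμ : 0 ≤ μ) (i : Fin d) (ξ : Space d) (z : ℂ) :
    ‖(((dispSym μ ξ)⁻¹ : ℝ) : ℂ) * (-(μ / 2) * (sym i ξ * z))‖ ≤ μ / 2 * jb ξ * ‖z‖ := by
  have h2 : (dispSym μ ξ)⁻¹ ≤ 1 := inv_le_one_of_one_le₀ (one_le_dispSym hμ ξ)
  have h3 := norm_sym_le i ξ
  have h5 : ‖(-(μ / 2) : ℂ)‖ = μ / 2 := by
    rw [norm_neg, norm_div, Complex.norm_real, Real.norm_of_nonneg hμ, Complex.norm_ofNat]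
  rw [norm_mul, norm_mul, norm_mul, Complex.norm_real, h5,
    Real.norm_of_nonneg (inv_nonneg.2 (by linarith [one_le_dispSym hμ ξ]))]
  calc _ ≤ 1 * (μ / 2 * (jb ξ * ‖z‖)) := by gcongr
    _ = _ := by ring

theorem measurable_shiftChar (Y : Space d) : Measurable (shiftChar Y) := by
  have : Continuous (shiftChar Y) := by unfold shiftChar; fun_prop
  exact this.measurable

theorem measurable_correctionRate (μ : ℝ) (b : Solid d) (Y Z A : Space d) (i : Fin d) :
    Measurable (correctionRate μ b Y Z A i) := by
  have h1 : Measurable (fun ξ : Space d => (((dispSym μ ξ)⁻¹ : ℝ) : ℂ)) :=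
    Complex.measurable_ofReal.comp (continuous_dispSym μ).measurable.inv
  have h2 := measurable_dirSym (d := d)
  have h3 := b.hat.continuous.measurable
  exact h1.mul (((measurable_sym i).mul ((((h2 A).sub ((h2 Z).pow_const 2)).mul
    (measurable_shiftChar Y)).mul h3)).const_mul _)

variable {k : Space d → ℝ} {C : ℝ}

theorem memLp_mul_correction (hk : Measurable k) (hC : ∀ ξ, |k ξ| ≤ C * jb ξ) {μ : ℝ} (hμ : 0 ≤ μ)
    (b : Solid d) (Y Z : Space d) (i : Fin d) :
    MemLp (fun ξ => (k ξ : ℂ) * correction μ (b.translate Y) Z i ξ) 2 := by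
  refine (b.memLp_hat 3).of_le_mul (c := C * (μ / 2 * ‖Z‖)) ((Complex.measurable_ofReal.comp
    hk).mul (measurable_correction μ _ Z i)).aestronglyMeasurable (Eventually.of_forall fun ξ => ?_)
  have hj := (jb_pos ξ).le
  rw [norm_mul, Complex.norm_real, norm_mul, Complex.norm_real, Real.norm_eq_abs,
    Real.norm_of_nonneg (pow_nonneg hj 3)]
  have h1 := norm_correction_le hμ (b.translate Y) Z i ξ
  rw [Solid.hat_translate, norm_mul, norm_shiftChar, one_mul] at h1
  calc _ ≤ (C * jb ξ) * (μ / 2 * ‖Z‖ * jb ξ ^ 2 * ‖b.hat ξ‖) :=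
        mul_le_mul (hC ξ) h1 (norm_nonneg _) ((abs_nonneg _).trans (hC ξ))
    _ = _ := by ring

theorem memLp_mul_correctionRate (hk : Measurable k) (hC : ∀ ξ, |k ξ| ≤ C * jb ξ) {μ : ℝ}
    (hμ : 0 ≤ μ) (b : Solid d) (Y Z A : Space d) (i : Fin d) :
    MemLp (fun ξ => (k ξ : ℂ) * correctionRate μ b Y Z A i ξ) 2 := by
  refine (b.memLp_hat 4).of_le_mul (c := C * (μ / 2 * (‖A‖ + ‖Z‖ ^ 2)))
    ((Complex.measurable_ofReal.comp hk).mul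
      (measurable_correctionRate μ b Y Z A i)).aestronglyMeasurable
    (Eventually.of_forall fun ξ => ?_)
  have hj := (jb_pos ξ).le
  have hj1 := one_le_jb ξ
  have h1 : ‖correctionRate μ b Y Z A i ξ‖
      ≤ μ / 2 * jb ξ * ((‖A‖ + ‖Z‖ ^ 2) * jb ξ ^ 2 * ‖b.hat ξ‖) := by
    refine (norm_disp_source_le hμ i ξ _).trans ?_
    rw [norm_mul, norm_mul, norm_shiftChar, mul_one]
    gcongr
    refine (norm_sub_le _ _).trans ?_
    rw [norm_pow, add_mul]
    refine add_le_add ?_ ?_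
    · refine (norm_dirSym_le A ξ).trans ?_
      gcongr
      exact le_self_pow₀ hj1 (by norm_num)
    · rw [← mul_pow]
      gcongr
      exact norm_dirSym_le Z ξ
  rw [norm_mul, Complex.norm_real, norm_mul, Complex.norm_real, Real.norm_eq_abs,
    Real.norm_of_nonneg (pow_nonneg hj 4)]
  calc _ ≤ (C * jb ξ) * (μ / 2 * jb ξ * ((‖A‖ + ‖Z‖ ^ 2) * jb ξ ^ 2 * ‖b.hat ξ‖)) :=
        mul_le_mul (hC ξ) h1 (norm_nonneg _) ((abs_nonneg _).trans (hC ξ))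
    _ = _ := by ring

theorem isLittleO_source_remainder {Y Z : ℝ → Space d} {A : Space d} {S : Set ℝ} {t : ℝ}
    (hY : HasDerivWithinAt Y (Z t) S t) (hZ : HasDerivWithinAt Z A S t) :
    (fun r => ‖Z r - Z t - (r - t) • A‖ + 2 * ‖Z r‖ * ‖Y r - Y t‖ ^ 2
      + ‖Z r‖ * ‖Y r - Y t - (r - t) • Z t‖ + |r - t| * ‖Z r - Z t‖ * ‖Z t‖)
      =o[𝓝[S] t] fun r => r - t := by
  have o1 := (hasDerivWithinAt_iff_isLittleO.1 hZ).norm_left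
  have o2 := (hasDerivWithinAt_iff_isLittleO.1 hY).norm_left
  have c1 : (fun r => ‖Z r‖) =O[𝓝[S] t] fun _ => (1 : ℝ) :=
    (hZ.continuousWithinAt.norm : Tendsto _ _ _).isBigO_one ℝ
  have c2 : (fun r => ‖Z r - Z t‖) =o[𝓝[S] t] fun _ => (1 : ℝ) := by
    rw [Asymptotics.isLittleO_one_iff]
    simpa using (hZ.continuousWithinAt.tendsto.sub_const (Z t)).norm
  have c3 : (fun r => ‖Y r - Y t‖) =o[𝓝[S] t] fun _ => (1 : ℝ) := by
    rw [Asymptotics.isLittleO_one_iff]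
    simpa using (hY.continuousWithinAt.tendsto.sub_const (Y t)).norm
  have c4 : (fun r => ‖Y r - Y t‖) =O[𝓝[S] t] fun r => r - t :=
    hY.hasFDerivWithinAt.isBigO_sub.norm_left
  refine ((o1.add ?_).add ?_).add ?_
  · have := (c1.const_mul_left 2).mul_isLittleO (c4.mul_isLittleO c3)
    simpa [sq] using this
  · simpa using c1.mul_isLittleO o2
  · have := ((Asymptotics.isBigO_refl (fun r => r - t) (𝓝[S] t)).abs_left.mul_isLittleO
      c2).mul_isBigO (Asymptotics.isBigO_const_const ‖Z t‖ (one_ne_zero (α := ℝ)) (𝓝[S] t))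
    simpa using this

/-- The remainder is o(r - t) times five powers of ⟨2πξ⟩ times the transform of the profile: one
from the weight, one from the gradient, three from the expansion of the source. This dominating
function is square integrable because the profile is smooth with compact support. -/
theorem hasDerivWithinAt_correction (hk : Measurable k) (hC : ∀ ξ, |k ξ| ≤ C * jb ξ) {μ : ℝ}
    (hμ : 0 ≤ μ) (b : Solid d) (i : Fin d) {Y Z : ℝ → Space d} {A : Space d} {S : Set ℝ} {t : ℝ}
    (hY : HasDerivWithinAt Y (Z t) S t) (hZ : HasDerivWithinAt Z A S t) :
    HasDerivWithinAt (fun r => (memLp_mul_correction hk hC hμ b (Y r) (Z r) i).toLp)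
      (memLp_mul_correctionRate hk hC hμ b (Y t) (Z t) A i).toLp S t := by
  refine hasDerivWithinAt_toLp (H := fun ξ => ((C * (μ / 2) : ℝ) : ℂ) *
    (((jb ξ ^ 5 : ℝ) : ℂ) * b.hat ξ)) _ _ ((b.memLp_hat 5).const_mul _)
    (isLittleO_source_remainder hY hZ) fun r ξ => ?_
  have hj := (jb_pos ξ).le
  have e : (k ξ : ℂ) * correction μ (b.translate (Y r)) (Z r) i ξ
      - (k ξ : ℂ) * correction μ (b.translate (Y t)) (Z t) i ξ
      - ((r - t : ℝ) : ℂ) * ((k ξ : ℂ) * correctionRate μ b (Y t) (Z t) A i ξ)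
      = (k ξ : ℂ) * ((((dispSym μ ξ)⁻¹ : ℝ) : ℂ) * (-(μ / 2) * (sym i ξ *
        ((dirSym (Z r) ξ * shiftChar (Y r) ξ - dirSym (Z t) ξ * shiftChar (Y t) ξ
          - ((r - t : ℝ) : ℂ) * ((dirSym A ξ - dirSym (Z t) ξ ^ 2) * shiftChar (Y t) ξ))
          * b.hat ξ)))) := by
    simp only [correction, correctionRate, Solid.hat_translate]
    ring
  have hC0 : 0 ≤ C := nonneg_of_mul_nonneg_left ((abs_nonneg _).trans (hC ξ)) (jb_pos ξ)
  rw [e, norm_mul, Complex.norm_real, Real.norm_eq_abs]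
  refine (mul_le_mul (hC ξ) (norm_disp_source_le hμ i ξ _) (norm_nonneg _)
    (by positivity)).trans ?_
  rw [norm_mul, norm_mul, norm_mul, Complex.norm_real, Complex.norm_real,
    Real.norm_of_nonneg (by positivity), Real.norm_of_nonneg (by positivity)]
  have h1 := source_remainder_le (Y t) (Z t) A (Y r) (Z r) ξ (r - t)
  rw [abs_of_nonneg (by positivity)]
  refine (mul_le_mul_of_nonneg_left (mul_le_mul_of_nonneg_left (mul_le_mul_of_nonneg_right h1
    (norm_nonneg (b.hat ξ))) (mul_nonneg (div_nonneg hμ zero_le_two) hj))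
    (mul_nonneg hC0 hj)).trans_eq ?_
  ring

end CorrectionCurve

/-! ### The time derivative of the truncated energy. -/

section EnergyDerivative

variable {d : ℕ}

theorem hsNorm_le_xNorm (μ s : ℝ) (U : State d) : hsNorm s U.1 ≤ xNorm μ s U := by
  have h1 := hsNormVec_nonneg s U.2
  have h2 := hsNormVec_nonneg (s + 1) U.2
  have h3 := Real.sqrt_nonneg μ
  rw [xNorm]
  nlinarith [mul_nonneg h3 h2]

theorem hsNorm_vec_le_xNorm (μ s : ℝ) (U : State d) (i : Fin d) :
    hsNorm s (U.2 i) ≤ xNorm μ s U := by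
  have h1 := hsNorm_le_vec s U.2 i
  have h2 := hsNormVec_nonneg (s + 1) U.2
  have h3 := Real.sqrt_nonneg μ
  have h4 := hsNorm_nonneg s U.1
  rw [xNorm]
  nlinarith [mul_nonneg h3 h2]

theorem hsNorm_vec_succ_le_xNorm {μ : ℝ} (hμ : 0 < μ) (s : ℝ) (U : State d) (i : Fin d) :
    hsNorm (s + 1) (U.2 i) ≤ (√μ)⁻¹ * xNorm μ s U := by
  have h1 := hsNorm_le_vec (s + 1) U.2 i
  have h2 := hsNormVec_nonneg s U.2
  have h3 := Real.sqrt_pos.2 hμ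
  have h4 := hsNorm_nonneg s U.1
  rw [inv_mul_eq_div, le_div_iff₀ h3, xNorm]
  nlinarith

theorem inner_ofReal_mul_mul (k : ℝ) (x y : ℂ) :
    inner ℝ ((k : ℂ) * x) ((k : ℂ) * y) = k ^ 2 * inner ℝ x y := by
  simp only [Complex.inner, map_mul, Complex.conj_ofReal]
  rw [show (k : ℂ) * y * (k * (starRingEnd ℂ) x) = ((k ^ 2 : ℝ) : ℂ) * (y * (starRingEnd ℂ) x) by
    push_cast; ring, Complex.re_ofReal_mul]

theorem inner_wtd {k : Space d → ℝ} {f g : L2 d} (hf : MemLp (wfun k f) 2)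
    (hg : MemLp (wfun k g) 2) :
    (fun ξ => inner ℝ (wtd k f ξ) (wtd k g ξ))
      =ᵐ[volume] fun ξ => k ξ ^ 2 * inner ℝ (fourierL2 f ξ) (fourierL2 g ξ) := by
  filter_upwards [coeFn_wtd hf, coeFn_wtd hg] with ξ h1 h2
  rw [h1, h2, wfun, wfun, inner_ofReal_mul_mul]

/-- The correction of the velocity, with the weight of the energy, on the Fourier side. -/
def wtdCorrection (p : Params) {s R : ℝ} (hs : 0 ≤ s) (hR : 1 ≤ R) (b : Solid d) (Y Z : Space d)
    (i : Fin d) : Lp ℂ 2 (volume : Measure (Space d)) :=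
  (memLp_mul_correction (measurable_dispWeight p.μ hs) (abs_dispWeight_le p.μ_pos.le hs hR)
    p.μ_pos.le b Y Z i).toLp

/-- The truncated energy, in terms of the corrected velocity. -/
def truncEnergy (p : Params) {s R : ℝ} (hs : 0 ≤ s) (hR : 1 ≤ R) (b : Solid d) (U : State d)
    (Y Z : Space d) : ℝ :=
  1 / 2 * (‖wtd (fun ξ => √(trunc s R ξ)) U.1‖ ^ 2
    + ∑ i, ‖wtd (dispWeight p.μ s R) (U.2 i) + wtdCorrection p hs hR b Y Z i‖ ^ 2
    + ‖Z‖ ^ 2 / p.ε)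

/-- The integrand of the rate of change of the energy. -/
def rateIntegrand (p : Params) (s R : ℝ) (b : Solid d) (U : State d) (Y Z : Space d)
    (ξ : Space d) : ℝ :=
  trunc s R ξ * inner ℝ (fourierL2 U.1 ξ)
        (-(∑ j, sym j ξ * flux p (b.translate Y) U j ξ) - dirSym Z ξ * (b.translate Y).hat ξ)
      + ∑ i, trunc s R ξ * inner ℝ (fourierL2 (U.2 i) ξ + correction p.μ (b.translate Y) Z i ξ)
        (-(sym i ξ * fourierL2 U.1 ξ) - p.ε * advection U i ξ)

variable {p : Params} {b : Solid d} {s T : ℝ} {U U' : ℝ → State d} {X X' X'' : ℝ → Space d}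

theorem IsSolution.hasDerivWithinAt_elevation (h : IsSolution p b s T U U' X X' X'') (hs : 1 ≤ s)
    {R : ℝ} (hR : 1 ≤ R) {t : ℝ} (ht : t ∈ Icc 0 T) :
    HasDerivWithinAt (fun r => wtd (fun ξ => √(trunc s R ξ)) (U r).1)
      (wtd (fun ξ => √(trunc s R ξ)) (U' t).1) (Icc 0 T) t := by
  refine hasDerivWithinAt_wtd (measurable_sqrt_trunc (by linarith)) (abs_sqrt_trunc_le hs hR)
    (fun r hr => (h.continuous r hr).1.1.mono (by linarith)) (h.continuous_deriv t ht).1.1 ht ?_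
  exact squeeze_zero (fun _ => hsNorm_nonneg _ _)
    (fun r => hsNorm_le_xNorm p.μ (s - 1) ((r - t)⁻¹ • (U r - U t) - U' t)) (h.hasTimeDeriv t ht)

theorem IsSolution.hasDerivWithinAt_velocity (h : IsSolution p b s T U U' X X' X'') (hs : 1 ≤ s)
    {R : ℝ} (hR : 1 ≤ R) (i : Fin d) {t : ℝ} (ht : t ∈ Icc 0 T) :
    HasDerivWithinAt (fun r => wtd (dispWeight p.μ s R) ((U r).2 i))
      (wtd (dispWeight p.μ s R) ((U' t).2 i)) (Icc 0 T) t := by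
  have h1 := ((h.continuous_deriv t ht).1.2 i).2
  rw [sub_add_cancel] at h1
  refine hasDerivWithinAt_wtd (measurable_dispWeight p.μ (by linarith))
    (abs_dispWeight_le_rpow p.μ_pos.le hs hR)
    (fun r hr => ((h.continuous r hr).1.2 i).1) h1 ht ?_
  -- The norm of `X^{s-1}` contains √μ times the `H^s` norm of the velocity, so V is differentiable
  -- in `H^s` although ζ is differentiable only in `H^{s-1}`.
  have h2 := (h.hasTimeDeriv t ht).const_mul (√p.μ)⁻¹
  rw [mul_zero] at h2
  refine squeeze_zero (fun _ => hsNorm_nonneg _ _) (fun r => ?_) h2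
  have := hsNorm_vec_succ_le_xNorm p.μ_pos (s - 1) ((r - t)⁻¹ • (U r - U t) - U' t) i
  rwa [sub_add_cancel] at this

/-- The momentum equation for the corrected velocity. -/
theorem IsSolution.momentum_corrected (h : IsSolution p b s T U U' X X' X'')
    (hs : (d : ℝ) / 2 + 1 < s) (i : Fin d) {t : ℝ} (ht : t ∈ Icc 0 T) :
    ∀ᵐ ξ, (dispSym p.μ ξ : ℂ) * (fourierL2 ((U' t).2 i) ξ
        + correctionRate p.μ b (X t) (X' t) (X'' t) i ξ)
      = -(sym i ξ * fourierL2 (U t).1 ξ) - p.ε * advection (U t) i ξ := by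
  have hU := (h.continuous t ht).1
  have h2 : ∀ j, Integrable (fourierL2 ((U t).2 j)) := fun j =>
    (hU.2 j).1.integrable (by linarith)
  have h3 : ∀ i j, Integrable (fun ξ => sym j ξ * fourierL2 ((U t).2 i) ξ) := fun i j =>
    integrable_sym_mul (by linarith) (hU.2 i).2 j
  filter_upwards [(h.momentum t ht).fourier h2 h3 i] with ξ e
  have hJ : ((dispSym p.μ ξ : ℝ) : ℂ) ≠ 0 := by
    exact_mod_cast (by linarith [one_le_dispSym p.μ_pos.le ξ] : dispSym p.μ ξ ≠ 0)
  change ((dispSym p.μ ξ : ℝ) : ℂ) * _ = _ at e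
  rw [mul_add, e, correctionRate, Complex.ofReal_inv, mul_inv_cancel_left₀ hJ,
    Solid.hat_translate, dirSym, dirSym]
  ring

/-- The squared weight of the velocity is the truncated weight times the symbol of 1 - (μ/3)Δ; this
symbol meets the derivative of the corrected velocity and turns it into the right side of the
momentum equation. The acceleration is left only in the kinetic energy of the solid. -/
theorem IsSolution.hasDerivWithinAt_truncEnergy (h : IsSolution p b s T U U' X X' X'')
    (hs0 : 0 ≤ s) (hs1 : 1 ≤ s) (hs : (d : ℝ) / 2 + 1 < s) {R : ℝ} (hR : 1 ≤ R) {t : ℝ}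
    (ht : t ∈ Icc 0 T) :
    HasDerivWithinAt (fun r => truncEnergy p hs0 hR b (U r) (X r) (X' r))
      ((∫ ξ, rateIntegrand p s R b (U t) (X t) (X' t) ξ) + inner ℝ (X' t) (X'' t) / p.ε)
      (Icc 0 T) t := by
  have hμ := p.μ_pos.le
  have hU := (h.continuous t ht).1
  have hU' := (h.continuous_deriv t ht).1
  have hU'2 : ∀ i, MemHs s ((U' t).2 i) := fun i => by simpa using (hU'.2 i).2
  have mζ : MemLp (wfun (fun ξ => √(trunc s R ξ)) (U t).1) 2 :=
    (hU.1.mono (by linarith)).memLp (measurable_sqrt_trunc hs0) (abs_sqrt_trunc_le hs1 hR)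
  have mζ' : MemLp (wfun (fun ξ => √(trunc s R ξ)) (U' t).1) 2 :=
    hU'.1.memLp (measurable_sqrt_trunc hs0) (abs_sqrt_trunc_le hs1 hR)
  have mV : ∀ i, MemLp (wfun (dispWeight p.μ s R) ((U t).2 i)) 2 := fun i =>
    (hU.2 i).1.memLp (measurable_dispWeight p.μ hs0) (abs_dispWeight_le_rpow hμ hs1 hR)
  have mV' : ∀ i, MemLp (wfun (dispWeight p.μ s R) ((U' t).2 i)) 2 := fun i =>
    (hU'2 i).memLp (measurable_dispWeight p.μ hs0) (abs_dispWeight_le_rpow hμ hs1 hR)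
  have d1 := (h.hasDerivWithinAt_elevation hs1 hR ht).norm_sq
  have mQ := fun r i => memLp_mul_correction (measurable_dispWeight p.μ hs0)
    (abs_dispWeight_le hμ hs0 hR) hμ b (X r) (X' r) i
  have mQ' := memLp_mul_correctionRate (measurable_dispWeight p.μ hs0)
    (abs_dispWeight_le hμ hs0 hR) hμ b (X t) (X' t) (X'' t)
  have d2 : ∀ i, HasDerivWithinAt (fun r => ‖wtd (dispWeight p.μ s R) ((U r).2 i)
      + wtdCorrection p hs0 hR b (X r) (X' r) i‖ ^ 2)
      (2 * inner ℝ (wtd (dispWeight p.μ s R) ((U t).2 i)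
        + wtdCorrection p hs0 hR b (X t) (X' t) i)
        (wtd (dispWeight p.μ s R) ((U' t).2 i) + (mQ' i).toLp)) (Icc 0 T) t := fun i =>
    ((h.hasDerivWithinAt_velocity hs1 hR i ht).add (hasDerivWithinAt_correction
      (measurable_dispWeight p.μ hs0) (abs_dispWeight_le hμ hs0 hR) hμ b i
      (h.hasDeriv_X t ht) (h.hasDeriv_X' t ht))).norm_sq
  have d3 := ((h.hasDeriv_X' t ht).norm_sq).div_const p.ε
  have key := ((d1.add (HasDerivWithinAt.fun_sum (u := Finset.univ) fun i _ => d2 i)).add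
    d3).const_mul (1 / 2)
  refine key.congr_deriv ?_
  have i1 : (fun ξ => inner ℝ (wtd (fun ξ => √(trunc s R ξ)) (U t).1 ξ)
      (wtd (fun ξ => √(trunc s R ξ)) (U' t).1 ξ)) =ᵐ[volume] fun ξ =>
      trunc s R ξ * inner ℝ (fourierL2 (U t).1 ξ)
        (-(∑ j, sym j ξ * flux p (b.translate (X t)) (U t) j ξ)
          - dirSym (X' t) ξ * (b.translate (X t)).hat ξ) := by
    have h2 : ∀ j, Integrable (fourierL2 ((U t).2 j)) := fun j =>
      (hU.2 j).1.integrable (by linarith)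
    filter_upwards [inner_wtd mζ mζ', (h.mass t ht).fourier (hU.1.integrable (by linarith)) h2]
      with ξ e1 e2
    rw [e1, Real.sq_sqrt (trunc_nonneg hR ξ), e2]
    rfl
  have i2 : ∀ i, (fun ξ => inner ℝ ((wtd (dispWeight p.μ s R) ((U t).2 i)
        + wtdCorrection p hs0 hR b (X t) (X' t) i) ξ)
        ((wtd (dispWeight p.μ s R) ((U' t).2 i) + (mQ' i).toLp) ξ)) =ᵐ[volume] fun ξ =>
      trunc s R ξ * inner ℝ (fourierL2 ((U t).2 i) ξ
          + correction p.μ (b.translate (X t)) (X' t) i ξ)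
        (-(sym i ξ * fourierL2 (U t).1 ξ) - p.ε * advection (U t) i ξ) := fun i => by
    filter_upwards [Lp.coeFn_add (wtd (dispWeight p.μ s R) ((U t).2 i))
      (wtdCorrection p hs0 hR b (X t) (X' t) i),
      Lp.coeFn_add (wtd (dispWeight p.μ s R) ((U' t).2 i)) (mQ' i).toLp, coeFn_wtd (mV i),
      coeFn_wtd (mV' i), (mQ t i).coeFn_toLp, (mQ' i).coeFn_toLp,
      h.momentum_corrected hs i ht] with ξ e1 e2 e3 e4 e5 e6 e7
    rw [e1, e2, Pi.add_apply, Pi.add_apply, e3, e4, wtdCorrection, e5, e6, wfun, wfun, ← mul_add,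
      ← mul_add, inner_ofReal_mul_mul, dispWeight_sq hμ hR, mul_assoc, ← e7, inner_ofReal_mul]
  have j1 := (L2.integrable_inner (𝕜 := ℝ) (wtd (fun ξ => √(trunc s R ξ)) (U t).1)
    (wtd (fun ξ => √(trunc s R ξ)) (U' t).1)).congr i1
  have j2 := fun i => (L2.integrable_inner (𝕜 := ℝ) (wtd (dispWeight p.μ s R) ((U t).2 i)
        + wtdCorrection p hs0 hR b (X t) (X' t) i)
        (wtd (dispWeight p.μ s R) ((U' t).2 i) + (mQ' i).toLp)).congr (i2 i)
  unfold rateIntegrand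
  rw [integral_add j1 (integrable_finsetSum _ fun i _ => j2 i),
    integral_finsetSum _ fun i _ => j2 i, ← integral_congr_ae i1]
  simp only [← integral_congr_ae (i2 _), ← L2.inner_def, ← Finset.mul_sum]
  ring

end EnergyDerivative

/-! ### Absorption of the rate into √ε times the energy. -/

section Absorption

variable {d : ℕ}

/-- The quadratic form `‖ζ‖²_{H^s} + (1 - μ/3) ‖V‖²_{H^s} + (μ/3) ‖V‖²_{H^{s+1}}`, plus the
kinetic energy of the solid. -/
def energy (p : Params) (s : ℝ) (U : State d) (Z : Space d) : ℝ :=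
  1 / 2 * (hsNorm s U.1 ^ 2 + ((1 - p.μ / 3) * hsNormVec s U.2 ^ 2
    + p.μ / 3 * hsNormVec (s + 1) U.2 ^ 2) + ‖Z‖ ^ 2 / p.ε)

theorem mul_le_of_sq_le {x y X Y : ℝ} (hx : x ^ 2 ≤ X) (hy : y ^ 2 ≤ Y) :
    x * y ≤ (X + Y) / 2 := by
  nlinarith [sq_nonneg (x - y)]

/-- Here e = √ε, m = √μ, k = √κ and q = |Z|/√ε. In each term one product of two quantities
controlled by the energy is isolated, one factor e is kept in front, and the rest is bounded by the
constant. -/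
theorem rate_terms_le {n CT P₁ P₀ a v₀ v₁ β q e m k M₀ Mi E : ℝ} (hn : 0 ≤ n) (hCT : 0 ≤ CT)
    (hP₁ : 0 ≤ P₁) (hP₀ : 0 ≤ P₀) (ha : 0 ≤ a) (hv₀ : 0 ≤ v₀) (hv₁ : 0 ≤ v₁) (hβ : 0 ≤ β)
    (hq : 0 ≤ q) (he : 0 ≤ e) (hm : 0 ≤ m) (hk : 0 ≤ k) (hMi : 0 ≤ Mi) (hem : e ≤ k * m)
    (hm1 : m ≤ 1) (haM : a ≤ M₀) (hvM : v₀ ≤ M₀) (h1 : a ^ 2 ≤ 2 * E) (h2 : v₀ ^ 2 ≤ 3 * E)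
    (h3 : (m * v₁) ^ 2 ≤ 6 * E) (h4 : q ^ 2 ≤ 2 * E) :
    n * (e ^ 2 * (CT * a ^ 2 * v₁)) + n * (e ^ 2 * (P₁ * a * β * v₁)) + a * (e * q * β)
      + n * (a * (m ^ 2 / 2 * (e * q) * β)) + n * (n * (e ^ 2 * (P₀ * v₀ * v₀ * v₁)))
      + n * (n * (e ^ 2 * (P₀ * (m ^ 2 / 2 * (e * q) * β) * v₀ * v₁)))
      + Mi * (a * (e * q * β))
    ≤ e * ((4 * n * CT * k + 4 * n * P₁ * k + 4 + n + 5 * n ^ 2 * P₀ * k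
        + 2 * n ^ 2 * P₀ * k ^ 2) * ((1 + Mi) * (1 + M₀) * (1 + β))) * E := by
  have hE : 0 ≤ E := by nlinarith [sq_nonneg a]
  have hM₀ : 0 ≤ M₀ := ha.trans haM
  set y := m * v₁ with hy
  have hy0 : 0 ≤ y := mul_nonneg hm hv₁
  have hw : e ^ 2 * v₁ ≤ e * k * y := by
    calc e ^ 2 * v₁ = e * e * v₁ := by ring
      _ ≤ e * (k * m) * v₁ := by gcongr
      _ = _ := by rw [hy]; ring
  have hay : a * y ≤ 4 * E := (mul_le_of_sq_le h1 h3).trans_eq (by ring)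
  have haq : a * q ≤ 2 * E := (mul_le_of_sq_le h1 h4).trans_eq (by ring)
  have hvy : v₀ * y ≤ 5 * E := (mul_le_of_sq_le h2 h3).trans (by linarith)
  have hqy : q * y ≤ 4 * E := (mul_le_of_sq_le h4 h3).trans_eq (by ring)
  have hm2 : m ^ 2 ≤ 1 := by nlinarith
  have hek : e ≤ k := hem.trans (mul_le_of_le_one_right hk hm1)
  -- Its expansion contains each of the monomials in Mi, M₀ and β that occur below, so a single
  -- factor dominates them all.
  set G := (1 + Mi) * (1 + M₀) * (1 + β) with hG
  have g0 : G = 1 + Mi + M₀ + β + Mi * M₀ + Mi * β + M₀ * β + Mi * M₀ * β := by rw [hG]; ring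
  have p1 := mul_nonneg hMi hM₀
  have p2 := mul_nonneg hMi hβ
  have p3 := mul_nonneg hM₀ hβ
  have p4 := mul_nonneg p1 hβ
  have gM : M₀ ≤ G := by linarith
  have gβ : β ≤ G := by linarith
  have gMβ : M₀ * β ≤ G := by linarith
  have gMi : Mi * β ≤ G := by linarith
  have t1 : n * (e ^ 2 * (CT * a ^ 2 * v₁)) ≤ e * (4 * n * CT * k * G) * E := by
    calc _ = n * CT * a * a * (e ^ 2 * v₁) := by ring
      _ ≤ n * CT * M₀ * a * (e * k * y) := by gcongr
      _ = n * CT * M₀ * e * k * (a * y) := by ring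
      _ ≤ n * CT * G * e * k * (4 * E) := by gcongr
      _ = _ := by ring
  have t2 : n * (e ^ 2 * (P₁ * a * β * v₁)) ≤ e * (4 * n * P₁ * k * G) * E := by
    calc _ = n * P₁ * β * a * (e ^ 2 * v₁) := by ring
      _ ≤ n * P₁ * β * a * (e * k * y) := by gcongr
      _ = n * P₁ * β * e * k * (a * y) := by ring
      _ ≤ n * P₁ * G * e * k * (4 * E) := by gcongr
      _ = _ := by ring
  have t3 : a * (e * q * β) ≤ e * (2 * G) * E := by
    calc _ = e * β * (a * q) := by ring
      _ ≤ e * G * (2 * E) := by gcongr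
      _ = _ := by ring
  have t4 : n * (a * (m ^ 2 / 2 * (e * q) * β)) ≤ e * (n * G) * E := by
    calc _ = n * e * (m ^ 2 / 2) * β * (a * q) := by ring
      _ ≤ n * e * (1 / 2) * G * (2 * E) := by gcongr
      _ = _ := by ring
  have t5 : n * (n * (e ^ 2 * (P₀ * v₀ * v₀ * v₁))) ≤ e * (5 * n ^ 2 * P₀ * k * G) * E := by
    calc _ = n * n * P₀ * v₀ * v₀ * (e ^ 2 * v₁) := by ring
      _ ≤ n * n * P₀ * M₀ * v₀ * (e * k * y) := by gcongr
      _ = n * n * P₀ * M₀ * e * k * (v₀ * y) := by ring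
      _ ≤ n * n * P₀ * G * e * k * (5 * E) := by gcongr
      _ = _ := by ring
  have t6 : n * (n * (e ^ 2 * (P₀ * (m ^ 2 / 2 * (e * q) * β) * v₀ * v₁)))
      ≤ e * (2 * n ^ 2 * P₀ * k ^ 2 * G) * E := by
    calc _ = n * n * P₀ * (m ^ 2 / 2) * q * β * e * v₀ * (e ^ 2 * v₁) := by ring
      _ ≤ n * n * P₀ * (1 / 2) * q * β * k * M₀ * (e * k * y) := by gcongr
      _ = n * n * P₀ * (1 / 2) * e * k * k * (M₀ * β) * (q * y) := by ring
      _ ≤ n * n * P₀ * (1 / 2) * e * k * k * G * (4 * E) := by gcongr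
      _ = _ := by ring
  have t7 : Mi * (a * (e * q * β)) ≤ e * (2 * G) * E := by
    calc _ = e * (Mi * β) * (a * q) := by ring
      _ ≤ e * G * (2 * E) := by gcongr
      _ = _ := by ring
  refine (add_le_add (add_le_add (add_le_add (add_le_add (add_le_add (add_le_add t1 t2) t3) t4)
    t5) t6) t7).trans_eq ?_
  ring

/-- The constant of the energy estimate. -/
def rateConst (d : ℕ) (s κ : ℝ) : ℝ :=
  4 * d * transportConst d s * √κ + 4 * d * (prodConst d (s + 1)).toReal * √κ + 4 + d
    + 5 * (d : ℝ) ^ 2 * (prodConst d s).toReal * √κ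
    + 2 * (d : ℝ) ^ 2 * (prodConst d s).toReal * √κ ^ 2

theorem transportConst_nonneg {s : ℝ} (hs : 0 ≤ s) : 0 ≤ transportConst d s := by
  have := Real.pi_pos
  unfold transportConst
  positivity

theorem rateConst_nonneg {s : ℝ} (hs : 0 ≤ s) (κ : ℝ) : 0 ≤ rateConst d s κ := by
  have := transportConst_nonneg (d := d) hs
  unfold rateConst
  positivity

theorem energy_bounds (p : Params) (hμ : p.μ ≤ 1) (s : ℝ) (U : State d) (Z : Space d) :
    hsNorm s U.1 ^ 2 ≤ 2 * energy p s U Z ∧ hsNormVec s U.2 ^ 2 ≤ 3 * energy p s U Z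
      ∧ p.μ * hsNormVec (s + 1) U.2 ^ 2 ≤ 6 * energy p s U Z
      ∧ ‖Z‖ ^ 2 / p.ε ≤ 2 * energy p s U Z := by
  have h1 := sq_nonneg (hsNorm s U.1)
  have h2 := sq_nonneg (hsNormVec s U.2)
  have h3 := mul_nonneg p.μ_pos.le (sq_nonneg (hsNormVec (s + 1) U.2))
  have h4 := div_nonneg (sq_nonneg ‖Z‖) p.ε_pos.le
  have h5 : 2 / 3 * hsNormVec s U.2 ^ 2 ≤ (1 - p.μ / 3) * hsNormVec s U.2 ^ 2 := by
    gcongr; linarith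
  unfold energy
  refine ⟨?_, ?_, ?_, ?_⟩ <;> linarith

/-- The bound is by the full energy, not the truncated one, since the product estimates see the
whole `H^s` norm. Its constant is independent of R. -/
theorem rate_le_energy {s κ : ℝ} (hs : 1 ≤ s) (hds : (d : ℝ) / 2 < s) {R : ℝ} (hR : 1 ≤ R)
    (p : Params) (hμ : p.μ ≤ 1) (hε : p.ε ≤ κ * p.μ) (b : Solid d) (Y Z : Space d) {U : State d}
    (hU : MemX s U) (h : ∀ᵐ x, 0 ≤ height p b U.1 Y x) {M₀ : ℝ} (hM : hsNormState s U ≤ M₀) :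
    (∫ ξ, rateIntegrand p s R b U Y Z ξ) + inner ℝ Z (solidForce p b U.1 Y Z) / p.ε
      ≤ √p.ε * (rateConst d s κ * ((1 + p.M⁻¹) * (1 + M₀) * (1 + hsNorm (s + 3) b.toL2)))
        * energy p s U Z := by
  have r1 := integral_rate_le hs hds hR p b Y Z hU
  have r2 := inner_solidForce_le p b (by linarith) hU.1 Y Z h
  have hs0 : 0 ≤ s := by linarith
  obtain ⟨b1, b2, b3, b4⟩ := energy_bounds p hμ s U Z
  have e0 := Real.sqrt_pos.2 p.ε_pos
  have e2 := Real.sq_sqrt p.ε_pos.le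
  have m2 := Real.sq_sqrt p.μ_pos.le
  have hZ : √p.ε * (‖Z‖ / √p.ε) = ‖Z‖ := by field_simp
  have key := rate_terms_le (n := d) (CT := transportConst d s)
    (P₁ := (prodConst d (s + 1)).toReal) (P₀ := (prodConst d s).toReal) (a := hsNorm s U.1)
    (v₀ := hsNormVec s U.2) (v₁ := hsNormVec (s + 1) U.2) (β := hsNorm (s + 3) b.toL2)
    (q := ‖Z‖ / √p.ε) (e := √p.ε) (m := √p.μ) (k := √κ) (M₀ := M₀) (Mi := p.M⁻¹)
    (E := energy p s U Z) (by positivity) (transportConst_nonneg hs0) ENNReal.toReal_nonneg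
    ENNReal.toReal_nonneg (hsNorm_nonneg _ _) (hsNormVec_nonneg _ _) (hsNormVec_nonneg _ _)
    (hsNorm_nonneg _ _) (by positivity) e0.le (Real.sqrt_nonneg _) (Real.sqrt_nonneg _)
    (inv_nonneg.2 p.M_pos.le)
    (by rw [← Real.sqrt_mul' κ p.μ_pos.le]; exact Real.sqrt_le_sqrt hε)
    (Real.sqrt_le_one.2 hμ)
    (le_trans (Real.le_sqrt_of_sq_le (by linarith [sq_nonneg (hsNormVec s U.2)])) hM)
    (le_trans (Real.le_sqrt_of_sq_le (by linarith [sq_nonneg (hsNorm s U.1)])) hM)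
    b1 b2 (by rw [mul_pow, m2]; exact b3) (by rw [div_pow, e2]; exact b4)
  rw [hZ, e2, m2] at key
  unfold rateIntegrand
  unfold rateConst
  linarith

end Absorption

/-! ### Grönwall's inequality. -/

section Gronwall

/-- The integral form of Grönwall's inequality, for continuous functions. -/
theorem le_mul_exp_of_le_integral {f : ℝ → ℝ} {A C T : ℝ} (hC : 0 ≤ C)
    (hf : ContinuousOn f (Icc 0 T))
    (h : ∀ t ∈ Icc 0 T, f t ≤ A + C * ∫ r in (0 : ℝ)..t, f r) {t : ℝ} (ht : t ∈ Icc 0 T) :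
    f t ≤ A * Real.exp (C * t) := by
  have hT : 0 ≤ T := ht.1.trans ht.2
  -- A globally continuous extension, so that its primitive is differentiable at every point,
  -- endpoints included.
  set g : ℝ → ℝ := IccExtend hT ((Icc 0 T).domRestrict f) with hg
  have gc : Continuous g := hf.domRestrict.Icc_extend'
  have gf : ∀ r ∈ Icc 0 T, g r = f r := fun r hr => IccExtend_of_mem hT _ hr
  have gi : ∀ r ∈ Icc 0 T, ∫ x in (0 : ℝ)..r, f x = ∫ x in (0 : ℝ)..r, g x := fun r hr => by
    refine intervalIntegral.integral_congr fun x hx => ?_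
    rw [uIcc_of_le hr.1] at hx
    exact (gf x ⟨hx.1, hx.2.trans hr.2⟩).symm
  set F : ℝ → ℝ := fun t => (A + C * ∫ x in (0 : ℝ)..t, g x) * Real.exp (-(C * t)) with hF
  have dF : ∀ r, HasDerivAt F (C * g r * Real.exp (-(C * r))
      + (A + C * ∫ x in (0 : ℝ)..r, g x) * (Real.exp (-(C * r)) * -C)) r := fun r => by
    have h1 : HasDerivAt (fun t => ∫ x in (0 : ℝ)..t, g x) (g r) r :=
      intervalIntegral.integral_hasDerivAt_right (gc.intervalIntegrable _ _)
        (gc.stronglyMeasurableAtFilter _ _) gc.continuousAt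
    have h2 : HasDerivAt (fun t => -(C * t)) (-C) r := by
      simpa using ((hasDerivAt_id r).const_mul (-C)).congr_of_eventuallyEq
        (Eventually.of_forall fun t => by simp)
    exact ((h1.const_mul C).const_add A).mul h2.exp
  have anti : AntitoneOn F (Icc 0 T) := by
    refine antitoneOn_of_deriv_nonpos (convex_Icc 0 T)
      (fun r _ => (dF r).continuousAt.continuousWithinAt)
      (fun r _ => (dF r).differentiableAt.differentiableWithinAt) fun r hr => ?_
    rw [interior_Icc] at hr
    have hr' := Ioo_subset_Icc_self hr
    have h1 := h r hr'
    rw [gi r hr', ← gf r hr'] at h1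
    rw [(dF r).deriv]
    have h2 := mul_nonneg (mul_nonneg hC (Real.exp_pos (-(C * r))).le) (sub_nonneg.2 h1)
    linarith
  have h1 := anti ⟨le_rfl, hT⟩ ht ht.1
  simp only [hF, intervalIntegral.integral_same, mul_zero, add_zero, neg_zero, Real.exp_zero,
    mul_one] at h1
  refine (h t ht).trans ?_
  rw [gi t ht]
  rwa [Real.exp_neg, ← div_eq_mul_inv, div_le_iff₀ (Real.exp_pos _)] at h1

end Gronwall

/-! ### Removal of the truncation and smallness of the correction. -/

section Truncation

variable {d : ℕ}

theorem norm_wtd_sq {k : Space d → ℝ} {f : L2 d} (h : MemLp (wfun k f) 2) :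
    Integrable (fun ξ => k ξ ^ 2 * ‖fourierL2 f ξ‖ ^ 2)
      ∧ ‖wtd k f‖ ^ 2 = ∫ ξ, k ξ ^ 2 * ‖fourierL2 f ξ‖ ^ 2 := by
  have e := inner_wtd h h
  simp only [real_inner_self_eq_norm_sq] at e
  refine ⟨((L2.integrable_inner (𝕜 := ℝ) (wtd k f) (wtd k f)).congr ?_), ?_⟩
  · simpa only [real_inner_self_eq_norm_sq] using e
  · rw [← real_inner_self_eq_norm_sq, L2.inner_def, ← integral_congr_ae e]
    simp only [real_inner_self_eq_norm_sq]

theorem hsNorm_sq {s : ℝ} {f : L2 d} (hf : MemHs s f) :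
    Integrable (fun ξ => jb ξ ^ (2 * s) * ‖fourierL2 f ξ‖ ^ 2)
      ∧ hsNorm s f ^ 2 = ∫ ξ, jb ξ ^ (2 * s) * ‖fourierL2 f ξ‖ ^ 2 := by
  have h := norm_wtd_sq ((memHs_iff s f).1 hf)
  rw [← hsNorm_eq_norm_wtd hf] at h
  have e : ∀ ξ : Space d, (jb ξ ^ s) ^ 2 = jb ξ ^ (2 * s) := fun ξ => by
    rw [← Real.rpow_natCast, ← Real.rpow_mul (jb_pos ξ).le, mul_comm]; rfl
  simpa only [e] using h

/-- The symbol of 1 - (μ/3)Δ equals (1 - μ/3) + (μ/3)⟨2πξ⟩², which explains the coefficients in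
`energy`. -/
theorem hsNorm_disp_sq (μ : ℝ) {s : ℝ} {f : L2 d} (hf : MemHs s f) (hf' : MemHs (s + 1) f) :
    Integrable (fun ξ => jb ξ ^ (2 * s) * dispSym μ ξ * ‖fourierL2 f ξ‖ ^ 2)
      ∧ (1 - μ / 3) * hsNorm s f ^ 2 + μ / 3 * hsNorm (s + 1) f ^ 2
        = ∫ ξ, jb ξ ^ (2 * s) * dispSym μ ξ * ‖fourierL2 f ξ‖ ^ 2 := by
  have e : ∀ ξ : Space d, jb ξ ^ (2 * s) * dispSym μ ξ * ‖fourierL2 f ξ‖ ^ 2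
      = (1 - μ / 3) * (jb ξ ^ (2 * s) * ‖fourierL2 f ξ‖ ^ 2)
        + μ / 3 * (jb ξ ^ (2 * (s + 1)) * ‖fourierL2 f ξ‖ ^ 2) := fun ξ => by
    rw [show 2 * (s + 1) = 2 * s + 2 by ring, Real.rpow_add (jb_pos ξ), Real.rpow_two, sq_jb,
      dispSym]
    ring
  obtain ⟨i1, h1⟩ := hsNorm_sq hf
  obtain ⟨i2, h2⟩ := hsNorm_sq hf'
  simp only [e]
  refine ⟨(i1.const_mul _).add (i2.const_mul _), ?_⟩
  rw [integral_add (i1.const_mul _) (i2.const_mul _), integral_const_mul, integral_const_mul,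
    ← h1, ← h2]

theorem norm_wtd_sq_le {k g : Space d → ℝ} {f : L2 d} (h : MemLp (wfun k f) 2)
    (hg : Integrable (fun ξ => g ξ * ‖fourierL2 f ξ‖ ^ 2)) (hk : ∀ ξ, k ξ ^ 2 ≤ g ξ) :
    ‖wtd k f‖ ^ 2 ≤ ∫ ξ, g ξ * ‖fourierL2 f ξ‖ ^ 2 := by
  rw [(norm_wtd_sq h).2]
  exact integral_mono (norm_wtd_sq h).1 hg fun ξ => by
    dsimp only
    gcongr
    exact hk ξ

/-- Dominated convergence: at each frequency the truncation is eventually inactive. -/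
theorem tendsto_norm_wtd_sq {k : ℕ → Space d → ℝ} {g : Space d → ℝ} {f : L2 d}
    (h : ∀ n, MemLp (wfun (k n) f) 2) (hg : Integrable (fun ξ => g ξ * ‖fourierL2 f ξ‖ ^ 2))
    (hk : ∀ n ξ, k n ξ ^ 2 ≤ g ξ) (hl : ∀ ξ, ∀ᶠ n in atTop, k n ξ ^ 2 = g ξ) :
    Tendsto (fun n => ‖wtd (k n) f‖ ^ 2) atTop (𝓝 (∫ ξ, g ξ * ‖fourierL2 f ξ‖ ^ 2)) := by
  simp only [fun n => (norm_wtd_sq (h n)).2]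
  refine tendsto_integral_of_dominated_convergence _ (fun n => (norm_wtd_sq (h n)).1.1) hg
    (fun n => Eventually.of_forall fun ξ => ?_) (Eventually.of_forall fun ξ => ?_)
  · rw [Real.norm_of_nonneg (by positivity)]
    gcongr
    exact hk n ξ
  · refine tendsto_const_nhds.congr' ?_
    filter_upwards [hl ξ] with n hn
    rw [hn]

theorem eventually_trunc_eq (s : ℝ) (ξ : Space d) :
    ∀ᶠ n : ℕ in atTop, trunc s (n + 1 : ℝ) ξ = jb ξ ^ (2 * s) := by
  obtain ⟨N, hN⟩ := exists_nat_ge (jb ξ)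
  filter_upwards [eventually_ge_atTop N] with n hn
  have : (N : ℝ) ≤ n := by exact_mod_cast hn
  rw [trunc, min_eq_left (by linarith)]

/-- The truncated energy, without the correction of the velocity. -/
def plainEnergy (p : Params) (s R : ℝ) (U : State d) (Z : Space d) : ℝ :=
  1 / 2 * (‖wtd (fun ξ => √(trunc s R ξ)) U.1‖ ^ 2
    + ∑ i, ‖wtd (dispWeight p.μ s R) (U.2 i)‖ ^ 2 + ‖Z‖ ^ 2 / p.ε)

theorem energy_eq_integral (p : Params) {s : ℝ} {U : State d} (hU : MemX s U) (Z : Space d) :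
    energy p s U Z = 1 / 2 * ((∫ ξ, jb ξ ^ (2 * s) * ‖fourierL2 U.1 ξ‖ ^ 2)
      + ∑ i, (∫ ξ, jb ξ ^ (2 * s) * dispSym p.μ ξ * ‖fourierL2 (U.2 i) ξ‖ ^ 2)
      + ‖Z‖ ^ 2 / p.ε) := by
  simp only [energy, ← (hsNorm_sq hU.1).2, ← (hsNorm_disp_sq p.μ (hU.2 _).1 (hU.2 _).2).2,
    Finset.sum_add_distrib, ← Finset.mul_sum, hsNormVec_sq]

theorem sq_sqrt_trunc_le {s R : ℝ} (hs : 0 ≤ s) (hR : 1 ≤ R) (ξ : Space d) :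
    √(trunc s R ξ) ^ 2 ≤ jb ξ ^ (2 * s) := by
  rw [Real.sq_sqrt (trunc_nonneg hR ξ)]
  exact trunc_le_rpow hs hR ξ

theorem sq_dispWeight_le {μ s R : ℝ} (hμ : 0 ≤ μ) (hs : 0 ≤ s) (hR : 1 ≤ R) (ξ : Space d) :
    dispWeight μ s R ξ ^ 2 ≤ jb ξ ^ (2 * s) * dispSym μ ξ := by
  rw [dispWeight_sq hμ hR]
  have := one_le_dispSym hμ ξ
  gcongr
  exact trunc_le_rpow hs hR ξ

variable {s : ℝ} {U : State d}

theorem MemX.memLp_elevation (hU : MemX s U) (hs : 1 ≤ s) {R : ℝ} (hR : 1 ≤ R) :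
    MemLp (wfun (fun ξ => √(trunc s R ξ)) U.1) 2 :=
  (hU.1.mono (by linarith)).memLp (measurable_sqrt_trunc (by linarith)) (abs_sqrt_trunc_le hs hR)

theorem MemX.memLp_velocity (hU : MemX s U) (hs : 1 ≤ s) {R : ℝ} (hR : 1 ≤ R) {μ : ℝ} (hμ : 0 ≤ μ)
    (i : Fin d) : MemLp (wfun (dispWeight μ s R) (U.2 i)) 2 :=
  (hU.2 i).1.memLp (measurable_dispWeight μ (by linarith)) (abs_dispWeight_le_rpow hμ hs hR)

theorem plainEnergy_le (p : Params) (hs : 1 ≤ s) {R : ℝ} (hR : 1 ≤ R) (hU : MemX s U)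
    (Z : Space d) : plainEnergy p s R U Z ≤ energy p s U Z := by
  rw [energy_eq_integral p hU, plainEnergy]
  gcongr with i
  · exact norm_wtd_sq_le (hU.memLp_elevation hs hR) (hsNorm_sq hU.1).1
      (sq_sqrt_trunc_le (by linarith) hR)
  · exact norm_wtd_sq_le (hU.memLp_velocity hs hR p.μ_pos.le i)
      (hsNorm_disp_sq p.μ (hU.2 i).1 (hU.2 i).2).1
      (sq_dispWeight_le p.μ_pos.le (by linarith) hR)

theorem tendsto_plainEnergy (p : Params) (hs : 1 ≤ s) (hU : MemX s U) (Z : Space d) :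
    Tendsto (fun n : ℕ => plainEnergy p s (n + 1) U Z) atTop (𝓝 (energy p s U Z)) := by
  have hn : ∀ n : ℕ, (1 : ℝ) ≤ n + 1 := fun n => by
    have : (0 : ℝ) ≤ n := n.cast_nonneg
    linarith
  have hμ := p.μ_pos.le
  rw [energy_eq_integral p hU]
  unfold plainEnergy
  refine ((Tendsto.add ?_ (tendsto_finsetSum _ fun i _ => ?_)).add_const _).const_mul _
  · refine tendsto_norm_wtd_sq (fun n => hU.memLp_elevation hs (hn n)) (hsNorm_sq hU.1).1
      (fun n => sq_sqrt_trunc_le (by linarith) (hn n)) fun ξ => ?_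
    filter_upwards [eventually_trunc_eq s ξ] with n h
    rw [Real.sq_sqrt (trunc_nonneg (hn n) ξ), h]
  · refine tendsto_norm_wtd_sq (fun n => hU.memLp_velocity hs (hn n) hμ i)
      (hsNorm_disp_sq p.μ (hU.2 i).1 (hU.2 i).2).1
      (fun n => sq_dispWeight_le hμ (by linarith) (hn n)) fun ξ => ?_
    filter_upwards [eventually_trunc_eq s ξ] with n h
    rw [dispWeight_sq hμ (hn n), h]

/-- Two derivatives of the profile from the correction and one power of ⟨2πξ⟩ from the square root
of the dispersive symbol. The factor μ is what makes the correction small. -/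
theorem norm_wtdCorrection_le (p : Params) (hs : 0 ≤ s) {R : ℝ} (hR : 1 ≤ R) (b : Solid d)
    (Y Z : Space d) (i : Fin d) :
    ‖wtdCorrection p hs hR b Y Z i‖ ≤ p.μ * (1 + p.μ) / 2 * ‖Z‖ * hsNorm (s + 3) b.toL2 := by
  have hμ := p.μ_pos.le
  have hm := (memHs_iff (s + 3) b.toL2).1 (b.memHs (s + 3))
  have e : hsNorm (s + 3) b.toL2 = ‖hm.toLp‖ := by rw [hsNorm_eq, Lp.norm_toLp]
  rw [e]
  refine Lp.norm_le_mul_norm_of_ae_le_mul ?_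
  have h0 := (memLp_mul_correction (measurable_dispWeight p.μ hs) (abs_dispWeight_le p.μ_pos.le
    hs hR) p.μ_pos.le b Y Z i).coeFn_toLp
  filter_upwards [h0, hm.coeFn_toLp, b.fourierL2_toL2] with ξ h1 h2 h3
  have hj := (jb_pos ξ).le
  rw [wtdCorrection, h1, h2, wfun, h3, norm_mul, norm_mul, Complex.norm_real, Complex.norm_real,
    Real.norm_of_nonneg (dispWeight_nonneg _ _ _ ξ), Real.norm_of_nonneg (Real.rpow_nonneg hj _)]
  have c1 := norm_correction_le hμ (b.translate Y) Z i ξ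
  rw [Solid.hat_translate, norm_mul, norm_shiftChar, one_mul] at c1
  have c2 : dispWeight p.μ s R ξ ≤ jb ξ ^ s * ((1 + p.μ) * jb ξ) := by
    unfold dispWeight
    gcongr
    · exact sqrt_trunc_le_rpow hs hR ξ
    · exact sqrt_dispSym_le hμ ξ
  calc _ ≤ jb ξ ^ s * ((1 + p.μ) * jb ξ) * (p.μ / 2 * ‖Z‖ * jb ξ ^ 2 * ‖b.hat ξ‖) := by gcongr
    _ = _ := by
      rw [Real.rpow_add (jb_pos ξ), show (3 : ℝ) = (3 : ℕ) by norm_num, Real.rpow_natCast]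
      ring

theorem norm_add_sq_le {E : Type*} [NormedAddCommGroup E] (w q : E) :
    ‖w + q‖ ^ 2 ≤ 21 / 20 * ‖w‖ ^ 2 + 21 * ‖q‖ ^ 2 := by
  have h := norm_add_le w q
  have h1 : ‖w + q‖ ^ 2 ≤ (‖w‖ + ‖q‖) ^ 2 := by gcongr
  nlinarith [sq_nonneg (‖w‖ - 20 * ‖q‖)]

theorem le_norm_add_sq {E : Type*} [NormedAddCommGroup E] (w q : E) :
    19 / 20 * ‖w‖ ^ 2 - 21 * ‖q‖ ^ 2 ≤ ‖w + q‖ ^ 2 := by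
  have h : ‖w‖ ≤ ‖w + q‖ + ‖q‖ := by simpa using norm_sub_le (w + q) q
  have h1 : ‖w‖ ^ 2 ≤ (‖w + q‖ + ‖q‖) ^ 2 := by gcongr
  nlinarith [sq_nonneg (‖w + q‖ - 19 * ‖q‖), sq_nonneg ‖q‖]

/-- The correction of the velocity is a small perturbation of the energy. -/
theorem truncEnergy_bounds (p : Params) (hs : 0 ≤ s) {R : ℝ} (hR : 1 ≤ R) (b : Solid d)
    (U : State d) (Y Z : Space d) (hμ : p.μ ≤ 1)
    (hsmall : 420 * d * hsNorm (s + 3) b.toL2 ^ 2 * (p.μ ^ 2 * p.ε) ≤ 1) :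
    truncEnergy p hs hR b U Y Z ≤ 21 / 20 * plainEnergy p s R U Z
      ∧ 19 / 20 * plainEnergy p s R U Z ≤ truncEnergy p hs hR b U Y Z := by
  set β := hsNorm (s + 3) b.toL2 with hβ
  have hβ0 : 0 ≤ β := hsNorm_nonneg _ _
  have hμ0 := p.μ_pos.le
  have hε := p.ε_pos
  have q1 : ∀ i, ‖wtdCorrection p hs hR b Y Z i‖ ^ 2 ≤ (p.μ * ‖Z‖ * β) ^ 2 := fun i => by
    have h1 := norm_wtdCorrection_le p hs hR b Y Z i
    have h2 : p.μ * (1 + p.μ) / 2 ≤ p.μ := by nlinarith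
    gcongr
    exact h1.trans (by gcongr)
  -- The correction is linear in Z, so the kinetic energy of the solid absorbs it; 420 = 21 · 20 in
  -- the smallness condition comes from here.
  have q2 : 21 * ∑ i, ‖wtdCorrection p hs hR b Y Z i‖ ^ 2 ≤ 1 / 20 * (‖Z‖ ^ 2 / p.ε) := by
    have h1 := Finset.sum_le_sum fun i (_ : i ∈ Finset.univ) => q1 i
    rw [Finset.sum_const, Finset.card_univ, Fintype.card_fin, nsmul_eq_mul] at h1
    refine (mul_le_mul_of_nonneg_left h1 (by norm_num)).trans ?_
    rw [← mul_div_assoc, le_div_iff₀ hε]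
    have := mul_le_mul_of_nonneg_left hsmall (sq_nonneg ‖Z‖)
    linarith
  have w1 := Finset.sum_le_sum fun i (_ : i ∈ Finset.univ) =>
    norm_add_sq_le (wtd (dispWeight p.μ s R) (U.2 i)) (wtdCorrection p hs hR b Y Z i)
  have w2 := Finset.sum_le_sum fun i (_ : i ∈ Finset.univ) =>
    le_norm_add_sq (wtd (dispWeight p.μ s R) (U.2 i)) (wtdCorrection p hs hR b Y Z i)
  rw [Finset.sum_add_distrib, ← Finset.mul_sum, ← Finset.mul_sum] at w1
  rw [Finset.sum_sub_distrib, ← Finset.mul_sum, ← Finset.mul_sum] at w2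
  have := sq_nonneg ‖wtd (fun ξ => √(trunc s R ξ)) U.1‖
  have := div_nonneg (sq_nonneg ‖Z‖) hε.le
  unfold truncEnergy plainEnergy
  constructor <;> linarith

end Truncation

/-! ### The integrated energy inequality and comparison with the `X^s` norms. -/

section EnergyEstimate

variable {d : ℕ} {p : Params} {b : Solid d} {s T : ℝ} {U U' : ℝ → State d}
  {X X' X'' : ℝ → Space d}

theorem ContinuousInX.continuousOn_elevation {μ : ℝ} (h : ContinuousInX μ s T U) :
    ContinuousOn (fun t => hsNorm s (U t).1) (Icc 0 T) :=
  continuousOn_hsNorm (fun t ht => (h t ht).1.1) fun t ht =>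
    squeeze_zero (fun _ => hsNorm_nonneg _ _) (fun r => hsNorm_le_xNorm μ s (U r - U t)) (h t ht).2

theorem ContinuousInX.continuousOn_velocity {μ : ℝ} (h : ContinuousInX μ s T U) (i : Fin d) :
    ContinuousOn (fun t => hsNorm s ((U t).2 i)) (Icc 0 T) :=
  continuousOn_hsNorm (fun t ht => ((h t ht).1.2 i).1) fun t ht =>
    squeeze_zero (fun _ => hsNorm_nonneg _ _) (fun r => hsNorm_vec_le_xNorm μ s (U r - U t) i)
      (h t ht).2

theorem ContinuousInX.continuousOn_velocity_succ {μ : ℝ} (hμ : 0 < μ) (h : ContinuousInX μ s T U)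
    (i : Fin d) : ContinuousOn (fun t => hsNorm (s + 1) ((U t).2 i)) (Icc 0 T) := by
  refine continuousOn_hsNorm (fun t ht => ((h t ht).1.2 i).2) fun t ht => ?_
  have h2 := (h t ht).2.const_mul (√μ)⁻¹
  rw [mul_zero] at h2
  exact squeeze_zero (fun _ => hsNorm_nonneg _ _)
    (fun r => hsNorm_vec_succ_le_xNorm hμ s (U r - U t) i) h2

/-- Continuity on a compact interval bounds the family; without boundedness the real supremum would
be the default value 0. -/
theorem ContinuousInX.hsNormState_le_iSup {μ : ℝ} (h : ContinuousInX μ s T U) {t : ℝ}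
    (ht : t ∈ Icc 0 T) : hsNormState s (U t) ≤ ⨆ t : Icc (0 : ℝ) T, hsNormState s (U t) := by
  have hc : ContinuousOn (fun t => hsNormState s (U t)) (Icc 0 T) := by
    simp only [hsNormState, hsNormVec_sq]
    exact ((h.continuousOn_elevation.pow 2).add (continuousOn_finsetSum _ fun i _ =>
      (h.continuousOn_velocity i).pow 2)).sqrt
  have hb := (isCompact_Icc.image_of_continuousOn hc).bddAbove
  rw [image_eq_range] at hb
  exact le_ciSup (f := fun t : Icc (0 : ℝ) T => hsNormState s (U t)) hb ⟨t, ht⟩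

theorem IsSolution.continuousOn_energy (h : IsSolution p b s T U U' X X' X'') :
    ContinuousOn (fun t => energy p s (U t) (X' t)) (Icc 0 T) := by
  have hX : ContinuousOn X' (Icc 0 T) := fun t ht => (h.hasDeriv_X' t ht).continuousWithinAt
  simp only [energy, hsNormVec_sq]
  exact continuousOn_const.mul (((h.continuous.continuousOn_elevation.pow 2).add
    ((continuousOn_const.mul (continuousOn_finsetSum _ fun i _ =>
      (h.continuous.continuousOn_velocity i).pow 2)).add
    (continuousOn_const.mul (continuousOn_finsetSum _ fun i _ =>
      (h.continuous.continuousOn_velocity_succ p.μ_pos i).pow 2)))).add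
    ((hX.norm.pow 2).div_const _))

/-- The growth of the energy. -/
theorem IsSolution.energy_le (h : IsSolution p b s T U U' X X' X'') (hs1 : 1 ≤ s)
    (hs : (d : ℝ) / 2 + 1 < s) {κ : ℝ} (hμ : p.μ ≤ 1) (hε : p.ε ≤ κ * p.μ)
    (hsmall : 420 * d * hsNorm (s + 3) b.toL2 ^ 2 * (p.μ ^ 2 * p.ε) ≤ 1)
    (hh : ∀ t ∈ Ico 0 T, ∀ᵐ x, 0 ≤ height p b (U t).1 (X t) x) {C : ℝ}
    (hC : C = √p.ε * (rateConst d s κ * ((1 + p.M⁻¹)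
      * (1 + ⨆ t : Icc (0 : ℝ) T, hsNormState s (U t)) * (1 + hsNorm (s + 3) b.toL2))))
    (hC0 : 0 ≤ C) {t : ℝ} (ht : t ∈ Icc 0 T) :
    energy p s (U t) (X' t) ≤ 21 / 19 * energy p s (U 0) (X' 0) * Real.exp (20 / 19 * C * t) := by
  have hs0 : 0 ≤ s := by linarith
  have hE := h.continuousOn_energy
  refine le_mul_exp_of_le_integral (f := fun t => energy p s (U t) (X' t)) (by positivity) hE
    (fun t ht => ?_) ht
  have h0 : (0 : ℝ) ∈ Icc 0 T := ⟨le_rfl, ht.1.trans ht.2⟩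
  have hsub : Icc 0 t ⊆ Icc 0 T := Icc_subset_Icc_right ht.2
  have key : ∀ n : ℕ, 19 / 20 * plainEnergy p s (n + 1) (U t) (X' t)
      ≤ 21 / 20 * energy p s (U 0) (X' 0) + C * ∫ r in (0 : ℝ)..t, energy p s (U r) (X' r) := by
    intro n
    have hn : (1 : ℝ) ≤ n + 1 := by
      have : (0 : ℝ) ≤ n := n.cast_nonneg
      linarith
    have hd := fun r (hr : r ∈ Icc 0 T) => h.hasDerivWithinAt_truncEnergy hs0 hs1 hs hn hr
    -- The derivative bound is needed only on the open interval, so the water height is not used at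
    -- time T. Only the majorant has to be integrable, not the rate itself.
    have h1 := intervalIntegral.sub_le_integral_of_hasDeriv_right_of_le
      (g := fun r => truncEnergy p hs0 hn b (U r) (X r) (X' r))
      (φ := fun r => C * energy p s (U r) (X' r)) ht.1
      (fun r hr => (hd r (hsub hr)).continuousWithinAt.mono hsub)
      (fun r hr => ((hd r (hsub (Ioo_subset_Icc_self hr))).hasDerivAt
        (Icc_mem_nhds hr.1 (hr.2.trans_le ht.2))).hasDerivWithinAt)
      ((continuousOn_const.mul (hE.mono hsub)).integrableOn_compact isCompact_Icc)
      (fun r hr => by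
        have hr' : r ∈ Icc 0 T := hsub (Ioo_subset_Icc_self hr)
        rw [h.newton r hr', hC]
        exact rate_le_energy hs1 (by linarith) hn p hμ hε b _ _ (h.continuous r hr').1
          (hh r ⟨hr'.1, hr.2.trans_le ht.2⟩) (h.continuous.hsNormState_le_iSup hr'))
    rw [intervalIntegral.integral_const_mul] at h1
    have h2 := (truncEnergy_bounds p hs0 hn b (U 0) (X 0) (X' 0) hμ hsmall).1
    have h3 := (truncEnergy_bounds p hs0 hn b (U t) (X t) (X' t) hμ hsmall).2
    have h4 := plainEnergy_le p hs1 hn (h.continuous 0 h0).1 (X' 0)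
    linarith
  -- The right side of `key` is free of the truncation, so R = n + 1 may tend to infinity.
  have hl := le_of_tendsto' ((tendsto_plainEnergy p hs1 (h.continuous t ht).1 (X' t)).const_mul
    (19 / 20)) key
  linarith

theorem sq_xHilbertNorm {μ : ℝ} (hμ : 0 ≤ μ) (s : ℝ) (U : State d) :
    xHilbertNorm μ s U ^ 2
      = hsNorm s U.1 ^ 2 + hsNormVec s U.2 ^ 2 + μ * hsNormVec (s + 1) U.2 ^ 2 :=
  Real.sq_sqrt (by positivity)

theorem sq_xHilbertNorm_le {μ : ℝ} (hμ : 0 ≤ μ) (s : ℝ) (U : State d) :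
    xHilbertNorm μ s U ^ 2 ≤ xNorm μ s U ^ 2 := by
  have h1 := hsNorm_nonneg s U.1
  have h2 := hsNormVec_nonneg s U.2
  have h3 := mul_nonneg (Real.sqrt_nonneg μ) (hsNormVec_nonneg (s + 1) U.2)
  have h4 : μ * hsNormVec (s + 1) U.2 ^ 2 = (√μ * hsNormVec (s + 1) U.2) ^ 2 := by
    rw [mul_pow, Real.sq_sqrt hμ]
  rw [sq_xHilbertNorm hμ, h4, xNorm]
  nlinarith [mul_nonneg h1 h2, mul_nonneg h1 h3, mul_nonneg h2 h3]

theorem energy_le_xHilbertNorm (p : Params) (s : ℝ) (U : State d) (Z : Space d) :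
    energy p s U Z ≤ 1 / 2 * xHilbertNorm p.μ s U ^ 2 + 1 / 2 * (‖Z‖ ^ 2 / p.ε) := by
  have hμ := p.μ_pos.le
  rw [sq_xHilbertNorm hμ, energy]
  have h1 := mul_nonneg hμ (sq_nonneg (hsNormVec s U.2))
  have h2 := mul_nonneg hμ (sq_nonneg (hsNormVec (s + 1) U.2))
  linarith

theorem xHilbertNorm_le_energy (p : Params) (hμ : p.μ ≤ 1) (s : ℝ) (U : State d) (Z : Space d) :
    1 / 2 * xHilbertNorm p.μ s U ^ 2 + 1 / (2 * p.ε) * ‖Z‖ ^ 2 ≤ 3 * energy p s U Z := by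
  rw [sq_xHilbertNorm p.μ_pos.le, energy]
  have h1 := sq_nonneg (hsNorm s U.1)
  have h2 := sq_nonneg (hsNormVec s U.2)
  have h3 := mul_le_mul_of_nonneg_right hμ h2
  have h4 := div_nonneg (sq_nonneg ‖Z‖) p.ε_pos.le
  have h5 : 1 / (2 * p.ε) * ‖Z‖ ^ 2 = 1 / 2 * (‖Z‖ ^ 2 / p.ε) := by
    have := p.ε_pos
    field_simp
  rw [h5]
  linarith

/-- Cauchy–Schwarz with weights 1, 29/30 and 1/3 gives the factor 1 + 30/29 + 3, slightly below
76/15; the value 29/30 is 1 - μ/3 at μ = 1/10. -/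
theorem xNorm_le_energy (p : Params) (hμ : p.μ ≤ 1 / 10) (s : ℝ) (U : State d) (Z : Space d) :
    1 / 2 * xNorm p.μ s U ^ 2 + 1 / (2 * p.ε) * ‖Z‖ ^ 2 ≤ 76 / 15 * energy p s U Z := by
  have hμ0 := p.μ_pos.le
  set x := hsNorm s U.1 with hx
  set y := hsNormVec s U.2 with hy
  set z := √p.μ * hsNormVec (s + 1) U.2 with hz
  have h4 : p.μ * hsNormVec (s + 1) U.2 ^ 2 = z ^ 2 := by rw [hz, mul_pow, Real.sq_sqrt hμ0]
  have h5 : 1 / (2 * p.ε) * ‖Z‖ ^ 2 = 1 / 2 * (‖Z‖ ^ 2 / p.ε) := by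
    have := p.ε_pos
    field_simp
  have h6 := div_nonneg (sq_nonneg ‖Z‖) p.ε_pos.le
  have h7 := mul_le_mul_of_nonneg_right hμ (sq_nonneg y)
  have h8 : (x + y + z) ^ 2 ≤ 76 / 15 * (x ^ 2 + 29 / 30 * y ^ 2 + 1 / 3 * z ^ 2) := by
    nlinarith [sq_nonneg (x - y), sq_nonneg (x - 1 / 3 * z), sq_nonneg (y - 1 / 3 * z), sq_nonneg x,
      sq_nonneg y, sq_nonneg z]
  have h9 : energy p s U Z = 1 / 2 * (x ^ 2 + ((1 - p.μ / 3) * y ^ 2 + 1 / 3 * z ^ 2)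
      + ‖Z‖ ^ 2 / p.ε) := by
    rw [energy, ← hx, ← hy, ← h4]; ring
  have h10 : xNorm p.μ s U = x + y + z := rfl
  rw [h5, h9, h10]
  linarith

end EnergyEstimate

/-! ### The constant of the theorem and the decay form of the estimate. -/

section MainEstimate

variable {d : ℕ} {p : Params} {b : Solid d} {s T : ℝ} {U U' : ℝ → State d}
  {X X' X'' : ℝ → Space d}

/-- The constant of the a priori estimate, as a function of the parameters. -/
def estimateConst (d : ℕ) (s κ : ℝ) (x : ℝ × ℝ × ℝ × ℝ) : ℝ :=
  2 * (rateConst d s κ * ((1 + max x.2.1 0) * (1 + max x.2.2.1 0) * (1 + max x.2.2.2 0)))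

theorem continuous_estimateConst (d : ℕ) (s κ : ℝ) : Continuous (estimateConst d s κ) := by
  unfold estimateConst; fun_prop

theorem monotone_estimateConst {s : ℝ} (hs : 0 ≤ s) (κ : ℝ) : Monotone (estimateConst d s κ) := by
  intro x y hxy
  have h0 := rateConst_nonneg (d := d) hs κ
  have h1 : max x.2.1 0 ≤ max y.2.1 0 := max_le_max_right 0 hxy.2.1
  have h2 : max x.2.2.1 0 ≤ max y.2.2.1 0 := max_le_max_right 0 hxy.2.2.1
  have h3 : max x.2.2.2 0 ≤ max y.2.2.2 0 := max_le_max_right 0 hxy.2.2.2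
  have := fun r : ℝ => le_max_right r 0
  have p1 := this x.2.1
  have p2 := this x.2.2.1
  have p3 := this x.2.2.2
  have p4 := this y.2.1
  have p5 := this y.2.2.1
  unfold estimateConst
  gcongr

theorem small_of_le_inv {D κ B β μ ε : ℝ} (hD : 0 ≤ D) (hκ : 0 ≤ κ) (hβ : 0 ≤ β) (hβB : β ≤ B)
    (hμ0 : 0 ≤ μ) (hμ : μ ≤ (10 + 420 * D * κ * B ^ 2)⁻¹) (hε0 : 0 ≤ ε)
    (hε : ε ≤ κ * μ) : μ ≤ 1 / 10 ∧ 420 * D * β ^ 2 * (μ ^ 2 * ε) ≤ 1 := by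
  have h0 : 0 ≤ 420 * D * κ * B ^ 2 := by positivity
  have h1 : μ * (10 + 420 * D * κ * B ^ 2) ≤ 1 := by
    rwa [← le_div_iff₀ (by linarith), one_div]
  have h2 := mul_nonneg hμ0 h0
  have h3 : μ ≤ 1 / 10 := by linarith
  refine ⟨h3, ?_⟩
  calc 420 * D * β ^ 2 * (μ ^ 2 * ε) ≤ 420 * D * B ^ 2 * (1 ^ 2 * (κ * μ)) := by
        gcongr
        linarith
    _ = μ * (420 * D * κ * B ^ 2) := by ring
    _ ≤ 1 := by linarith

/-- The decay form of the energy estimate. -/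
theorem IsSolution.exp_mul_energy_le (h : IsSolution p b s T U U' X X' X'') (hs1 : 1 ≤ s)
    (hs : (d : ℝ) / 2 + 1 < s) {κ : ℝ} (hμ : p.μ ≤ 1) (hε : p.ε ≤ κ * p.μ)
    (hsmall : 420 * d * hsNorm (s + 3) b.toL2 ^ 2 * (p.μ ^ 2 * p.ε) ≤ 1)
    (hh : ∀ t ∈ Ico 0 T, ∀ᵐ x, 0 ≤ height p b (U t).1 (X t) x) {cs : ℝ}
    (hcs : cs = estimateConst d s κ (p.cfric, p.M⁻¹, ⨆ t : Icc (0 : ℝ) T, hsNormState s (U t),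
      hsNorm (s + 3) b.toL2)) {t : ℝ} (ht : t ∈ Icc 0 T) :
    0 ≤ cs ∧ Real.exp (-(√p.ε * cs * t)) * energy p s (U t) (X' t)
      ≤ 21 / 19 * energy p s (U 0) (X' 0) := by
  set M₀ := ⨆ t : Icc (0 : ℝ) T, hsNormState s (U t)
  have hM₀ : 0 ≤ M₀ := (Real.sqrt_nonneg _).trans (h.continuous.hsNormState_le_iSup ht)
  have hβ : 0 ≤ hsNorm (s + 3) b.toL2 := hsNorm_nonneg _ _
  have hM := inv_nonneg.2 p.M_pos.le
  have hK := rateConst_nonneg (d := d) (by linarith : 0 ≤ s) κ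
  rw [estimateConst, max_eq_left hM, max_eq_left hM₀, max_eq_left hβ] at hcs
  have hcs0 : 0 ≤ cs := by rw [hcs]; positivity
  refine ⟨hcs0, ?_⟩
  have hε0 := Real.sqrt_nonneg p.ε
  -- The factor 2 in `estimateConst` leaves room for the 20/19 in the exponent.
  have key := h.energy_le hs1 hs hμ hε hsmall hh (C := √p.ε * (cs / 2)) (by rw [hcs]; ring)
    (by positivity) ht
  have hE : 0 ≤ energy p s (U 0) (X' 0) := by
    have := (energy_bounds p hμ s (U 0) (X' 0)).1
    linarith [sq_nonneg (hsNorm s (U 0).1)]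
  refine (mul_le_mul_of_nonneg_left key (Real.exp_pos _).le).trans ?_
  rw [mul_left_comm, ← Real.exp_add]
  refine mul_le_of_le_one_right (by positivity) (Real.exp_le_one_iff.2 ?_)
  have := mul_nonneg (mul_nonneg hε0 hcs0) ht.1
  linarith

end MainEstimate

end BoussinesqSolid

end

theorem mainTheorem3 (d : ℕ) (hd : 1 ≤ d) (s : ℝ) (hs : (d : ℝ) / 2 + 1 < s)
    (κ : ℝ) (hκ : 0 < κ) :
    ∃ c : ℝ × ℝ × ℝ × ℝ → ℝ, Continuous c ∧ Monotone c ∧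
      ∀ B : ℝ, ∃ μ₀ : ℝ, 0 < μ₀ ∧
        ∀ (b : Solid d) (p : Params) (T : ℝ) (U U' : ℝ → State d) (X X' X'' : ℝ → Space d)
          (V₀ : Space d),
          hsNorm (s + 3) b.toL2 ≤ B → p.μ ≤ μ₀ → p.ε ≤ κ * p.μ → 0 < T →
          (∃ hmin : ℝ, 0 < hmin ∧
            ∀ t ∈ Ico 0 T, ∀ᵐ x, hmin ≤ height p b (U t).1 (X t) x) →
          IsSolution p b s T U U' X X' X'' →
          X 0 = 0 → X' 0 = √p.ε • V₀ →
          ∀ cs : ℝ,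
            cs = c (p.cfric, p.M⁻¹, ⨆ t : Icc (0 : ℝ) T, hsNormState s (U t),
              hsNorm (s + 3) b.toL2) →
            (∀ t ∈ Icc 0 T,
              Real.exp (-(√p.ε * cs * t)) *
                  (1 / 2 * xHilbertNorm p.μ s (U t) ^ 2 + 1 / (2 * p.ε) * ‖X' t‖ ^ 2)
                ≤ 2 * xHilbertNorm p.μ s (U 0) ^ 2 + 2 * ‖V₀‖ ^ 2
                  + √p.ε * T * cs * hsNorm (s + 3) b.toL2 ^ 2) ∧
            (∀ t ∈ Icc 0 T,
              Real.exp (-(√p.ε * cs * t)) *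
                  (1 / 2 * xNorm p.μ s (U t) ^ 2 + 1 / (2 * p.ε) * ‖X' t‖ ^ 2)
                ≤ 3 * xNorm p.μ s (U 0) ^ 2 + 3 * ‖V₀‖ ^ 2
                  + √p.ε * T * cs * hsNorm (s + 3) b.toL2 ^ 2) := by
  have hd' : (1 : ℝ) ≤ d := by exact_mod_cast hd
  have hs1 : 1 ≤ s := by linarith
  -- This μ₀ gives μ ≤ 1/10 and, through ε ≤ κμ and the bound B on the profile, the smallness of the
  -- correction.
  refine ⟨estimateConst d s κ, continuous_estimateConst d s κ,
    monotone_estimateConst (by linarith) κ, fun B => ⟨(10 + 420 * d * κ * B ^ 2)⁻¹, by positivity,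
    ?_⟩⟩
  intro b p T U U' X X' X'' V₀ hB hμ hε _ ⟨hmin, hmin0, hh⟩ h _ hX' cs hcs
  obtain ⟨hμ1, hsmall⟩ := small_of_le_inv (Nat.cast_nonneg d) hκ.le (hsNorm_nonneg (s + 3) b.toL2)
    hB p.μ_pos.le hμ p.ε_pos.le hε
  have hh' : ∀ t ∈ Ico 0 T, ∀ᵐ x, 0 ≤ height p b (U t).1 (X t) x := fun t ht => by
    filter_upwards [hh t ht] with x hx
    linarith
  have hV : ‖X' 0‖ ^ 2 / p.ε = ‖V₀‖ ^ 2 := by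
    have := p.ε_pos
    rw [hX', norm_smul, mul_pow, Real.norm_of_nonneg (Real.sqrt_nonneg _), Real.sq_sqrt this.le]
    field_simp
  have h0 := energy_le_xHilbertNorm p s (U 0) (X' 0)
  rw [hV] at h0
  have h1 := sq_xHilbertNorm_le p.μ_pos.le s (U 0)
  have h2 := sq_nonneg (xHilbertNorm p.μ s (U 0))
  have h3 := sq_nonneg ‖V₀‖
  have key := fun t (ht : t ∈ Icc 0 T) =>
    h.exp_mul_energy_le hs1 hs (by linarith) hε hsmall hh' hcs ht
  have rem : ∀ t ∈ Icc 0 T, 0 ≤ √p.ε * T * cs * hsNorm (s + 3) b.toL2 ^ 2 := fun t ht => by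
    have := (key t ht).1
    have := ht.1.trans ht.2
    positivity
  refine ⟨fun t ht => ?_, fun t ht => ?_⟩
  -- The constant is 3 · 21/19 · 1/2 = 63/38 < 2; the term in ‖b‖² has only to be nonnegative, since
  -- the correction absorbed the source.
  · have e1 := mul_le_mul_of_nonneg_left (xHilbertNorm_le_energy p (by linarith) s (U t) (X' t))
      (Real.exp_pos (-(√p.ε * cs * t))).le
    linarith [(key t ht).2, rem t ht]
  -- Here the constant is 76/15 · 21/19 · 1/2 = 14/5 < 3, and the Hilbert norm at time 0 is at most
  -- the sum norm.
  · have e1 := mul_le_mul_of_nonneg_left (xNorm_le_energy p hμ1 s (U t) (X' t))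
      (Real.exp_pos (-(√p.ε * cs * t))).le
    linarith [(key t ht).2, rem t ht]
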